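/- \textbf{Definitions.} Let $\lambda$ be the uniform probability measure on the unit circle $\mathbb S^1$. For distinct $x,y\in\mathbb S^1$ let $[xy]$ be the closed line segment joining them. A \emph{figela} $S$ is a finite set of unordered pairs $\{x,y\}$ of distinct points of $\mathbb S^1$ whose chords $[xy]$ pairwise do not cross (the open segments $]xy[$ are disjoint). Its \emph{fragments} are the connected components of $\overline{\mathbb D}\setminus\bigcup_{\{x,y\}\in S}[xy]$, where $\overline{\mathbb D}$ is the closed unit disk. The \emph{mass} of a fragment $R$ is $\mathrm m(R)=\lambda(R\cap\mathbb S^1)$. The \emph{ends} of $R$ are the connected components of $R\cap\mathbb S^1$, and $\mathrm e(R)$ denotes their number, except that by convention $\mathrm e(\overline{\mathbb D})=0$. Let $\alpha\ge 0$. The \emph{figela process} $(S_\alpha(t),t\ge 0)$ with autosimilarity parameter $\alpha$ is the figela-valued jump process with jump times $\tau_1<\tau_2<\cdots$ (and $\tau_0=0$) that is constant on each $[\tau_n,\tau_{n+1})$, starts from $S_\alpha(0)=\varnothing$, and satisfies $S_\alpha(\tau_{n+1})=S_\alpha(\tau_n)\cup\{\{X_{n+1},Y_{n+1}\}\}$,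 where the conditional law of $(\tau_{n+1}-\tau_n,X_{n+1},Y_{n+1})$ given $\tau_0,\dots,\tau_n,X_1,Y_1,\dots,X_n,Y_n$ is as follows: attach to the fragments $R_1,\dots,R_{n+1}$ of $S_\alpha(\tau_n)$ independent exponential variables $e_1,\dots,e_{n+1}$ of parameter $1$, let $j_0$ be the (a.s. unique) index minimizing $\mathrm m(R_j)^{-\alpha}e_j$; then $\tau_{n+1}-\tau_n=\mathrm m(R_{j_0})^{-\alpha}e_{j_0}$, and $X_{n+1},Y_{n+1}$ are independent and uniformly distributed over $R_{j_0}\cap\mathbb S^1$. The \emph{genealogical tree of fragments} has as vertices the fragments of the figelas $S_\alpha(\tau_n)$, $n\ge0$. Its root is $\overline{\mathbb D}$, and the offspring of a fragment $R$ are the two fragments into which $R$ is split by the first chord that falls inside $R$. A \emph{ray} is an infinite sequence $\rho_0=\overline{\mathbb D},\rho_1,\rho_2,\dots$ such that $\rho_{k+1}$ is an offspring of $\rho_k$ for every $k\ge0$. \textbf{Lemma.} Almost surely, in the infinite genealogical tree of fragments of the figela process, there is no ray along which all fragments have eventually strictly more than $3$ ends; that is, almost surely there is no ray $(\rho_k)_{k\ge0}$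 for which there exists $k_0$ with $\mathrm e(\rho_k)>3$ for all $k\ge k_0$. -/

import Mathlib

open MeasureTheory ProbabilityTheory Set Filter

noncomputable section

namespace Figela

/-! ### The circle, chords, figelas -/

/-- The Borel sigma-algebra on the unit circle. -/
instance instMeasurableSpaceCircle : MeasurableSpace Circle := borel Circle

instance instBorelSpaceCircle : BorelSpace Circle := ⟨rfl⟩

/-- The uniform probability measure on the unit circle: the law of `exp (2 i π U)`, where `U` is
uniform on `[0, 1)`. -/
def unif : Measure Circle :=
  (volume.restrict (Ico (0 : ℝ) 1)).map (fun t : ℝ => Circle.exp (2 * Real.pi * t))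

/-- The closed unit disk of the complex plane. -/
def disk : Set ℂ := Metric.closedBall 0 1

/-- The chord `[xy]`: the closed line segment joining the two feet. -/
def chord : Sym2 Circle → Set ℂ :=
  Sym2.lift ⟨fun x y => segment ℝ (x : ℂ) (y : ℂ), fun x y => segment_symm ℝ (x : ℂ) (y : ℂ)⟩

/-- The chord `]xy[` without its two feet. -/
def openChord (p : Sym2 Circle) : Set ℂ := chord p \ {z | ∃ x ∈ p, z = (x : ℂ)}

/-- A figela: a finite set of unordered pairs of distinct points of the circle whose chords
do not cross each other. -/
structure IsFigela (S : Set (Sym2 Circle)) : Prop where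
  finite : S.Finite
  not_diag : ∀ p ∈ S, ¬ p.IsDiag
  noncrossing : ∀ p ∈ S, ∀ q ∈ S, p ≠ q → Disjoint (openChord p) (openChord q)

/-- The set of connected components of a subset `A` of the plane. -/
def components (A : Set ℂ) : Set (Set ℂ) := (connectedComponentIn A) '' A

/-- The fragments of a figela: the connected components of the closed disk deprived of
all the chords. -/
def fragments (S : Set (Sym2 Circle)) : Set (Set ℂ) := components (disk \ ⋃ p ∈ S, chord p)

/-- `R ∩ 𝕊¹`, as a set of points of the circle. -/
def trace (R : Set ℂ) : Set Circle := {z | (z : ℂ) ∈ R}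

/-- The mass of a fragment: the uniform measure of its intersection with the circle. -/
def mass (R : Set ℂ) : ℝ := unif.real (trace R)

open Classical in
/-- The number of ends of a fragment: the number of connected components of its intersection with
the circle, except that the full closed disk is viewed as a fragment with `0` end. -/
def ends (R : Set ℂ) : ℕ∞ :=
  if R = disk then 0 else (components (R ∩ Metric.sphere 0 1)).encard

/-! ### The figela process -/

instance instIsProbabilityMeasureExp : IsProbabilityMeasure (expMeasure 1) :=
  isProbabilityMeasure_expMeasure one_pos

/-- The clock `m(R)^(-α) e_R` attached to the fragment `R`. -/
def clock (α : ℝ) {S : Set (Sym2 Circle)} (e : fragments S → ℝ) (R : fragments S) : ℝ :=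
  mass (R : Set ℂ) ^ (-α) * e R

/-- The conditional law of (waiting time, first foot, second foot) for the next chord when the
present figela is `S`. To each fragment `R` of `S` (there are finitely many of them) is attached
an independent exponential variable `e_R` of parameter `1`. On the event that the clock of `R`
is the smallest one, the waiting time is the value of that clock and the two feet are independent
and uniform over `R ∩ 𝕊¹`. -/
def stepLaw (α : ℝ) (S : Set (Sym2 Circle)) : Measure (ℝ × Circle × Circle) :=
  Measure.sum fun R : fragments S =>
    (((Measure.infinitePi fun _ : fragments S => expMeasure 1).restrict
        {e | ∀ R' : fragments S, R' ≠ R → clock α e R < clock α e R'}).map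
      (fun e => clock α e R)).prod
    ((cond unif (trace (R : Set ℂ))).prod (cond unif (trace (R : Set ℂ))))

/-- The sigma-algebra generated by `τ 0, …, τ n` and by the feet `X i, Y i` of the chords number
`i = 1, …, n`. -/
abbrev history {Ω : Type*} (τ : ℕ → Ω → ℝ) (X Y : ℕ → Ω → Circle) (n : ℕ) : MeasurableSpace Ω :=
  (⨆ i ∈ Icc 0 n, MeasurableSpace.comap (τ i) inferInstance) ⊔
    ⨆ i ∈ Icc 1 n, MeasurableSpace.comap (fun ω => (X i ω, Y i ω)) inferInstance

/-- `S` (indexed by times `t ≥ 0`) is a figela process with autosimilarity parameter `α`, with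
jump times `τ 1 < τ 2 < ⋯` (and `τ 0 = 0`), the chord added at time `τ n` having feet `X n` and
`Y n` (for `n ≥ 1`; the values `X 0`, `Y 0` play no role). -/
structure IsFigelaProcess {Ω : Type*} [MeasurableSpace Ω] (P : Measure Ω) (α : ℝ)
    (τ : ℕ → Ω → ℝ) (X Y : ℕ → Ω → Circle) (S : ℝ → Ω → Set (Sym2 Circle)) : Prop where
  measurable_τ : ∀ n, Measurable (τ n)
  measurable_X : ∀ n, Measurable (X n)
  measurable_Y : ∀ n, Measurable (Y n)
  /-- The process starts at time `0` from the empty figela. -/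
  start : ∀ᵐ ω ∂P, τ 0 ω = 0 ∧ S (τ 0 ω) ω = ∅
  strictMono : ∀ᵐ ω ∂P, StrictMono fun n => τ n ω
  /-- The process is constant between two successive jump times. -/
  const : ∀ᵐ ω ∂P, ∀ n t, τ n ω ≤ t → t < τ (n + 1) ω → S t ω = S (τ n ω) ω
  /-- At time `τ (n + 1)` the chord with feet `X (n + 1)` and `Y (n + 1)` is added. -/
  jump : ∀ᵐ ω ∂P, ∀ n, S (τ (n + 1) ω) ω = S (τ n ω) ω ∪ {s(X (n + 1) ω, Y (n + 1) ω)}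
  /-- The process takes its values in the space of figelas. -/
  isFigela : ∀ᵐ ω ∂P, ∀ n, IsFigela (S (τ n ω) ω)
  /-- The conditional law of the next waiting time and of the next chord, given the past. -/
  law : ∀ n, ∀ A : Set (ℝ × Circle × Circle), MeasurableSet A →
    condExp (history τ X Y n) P
        (indicator {ω | (τ (n + 1) ω - τ n ω, X (n + 1) ω, Y (n + 1) ω) ∈ A} fun _ => (1 : ℝ))
      =ᵐ[P] fun ω => (stepLaw α (S (τ n ω) ω)).real A

/-! ### The genealogical tree of fragments -/

/-- For a trajectory `s` with jump times `t 1 < t 2 < ⋯`, the fragment `R'` is an offspring of the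
fragment `R` if `R` is present until some jump time, at which it is split by the new chord,
and `R'` is one of the fragments into which it is split. -/
def IsOffspring (t : ℕ → ℝ) (s : ℝ → Set (Sym2 Circle)) (R R' : Set ℂ) : Prop :=
  ∃ n, R ∈ fragments (s (t n)) ∧ R ∉ fragments (s (t (n + 1))) ∧
    R' ∈ fragments (s (t (n + 1))) ∧ R' ⊆ R

/-- An infinite ray of the genealogical tree of fragments: it starts at the root, which is the full
closed disk, and goes at each step from a fragment to one of its offspring. -/
def IsRay (t : ℕ → ℝ) (s : ℝ → Set (Sym2 Circle)) (ρ : ℕ → Set ℂ) : Prop :=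
  ρ 0 = disk ∧ ∀ k, IsOffspring t s (ρ k) (ρ (k + 1))

end Figela

end

/-!
Why no ray of the genealogical tree keeps more than three ends.

*Fragments as intervals with cuts.* Cut the circle open at angle `0`. The circular part of a
fragment becomes a set `A ⊆ [0, 1)`, which `glue A` collapses onto the interval `[0, ℓ)`, where `ℓ`
is the measure of `A`, sending the uniform law to the uniform law (`map_glue`). The removed arcs
leave cut points in `[0, ℓ)`, kept in a list `v`, and the fragment has at most `v.length + 1` ends
(`ends_le`). A uniform chord of the fragment becomes a pair of independent uniform points `x < y` of
`[0, ℓ)`. It produces the interval `[x, y)` with the cuts inside it, and the interval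
`[0, ℓ) \ [x, y)` with its two parts glued, whose cuts are the remaining ones and the new cut `x`.

*Types.* If the `j` cuts are independent and uniform, the cuts of each of the two pieces, given
their number and the length of the piece, are again independent and uniform, and a beta integral
shows that the expected number of pieces with `i` cuts is `2 / (j + 2)` for each `i ≤ j + 1`
(`cutIntegral_splitMean_le`). So the numbers of cuts are governed by the matrix
`M j i = 2 / (j + 2)`, `i ≤ j + 1`, whatever the lengths. Restricted to the types `i ≥ 3`, this
matrix has the positive harmonic function `j ↦ j - 1`, which is unbounded. By a maximum principle, a
bounded nonnegative subharmonic function vanishes (`eq_zero_of_subharmonic`). Iterating the union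
bound over the two offspring, truncated at `1`, bounds the probability that some line of descent has
at least `3` cuts during `m` generations, and this bound therefore tends to `0` as `m → ∞`
(`tendsto_typeBound`).

*The process.* Given the past, the next chord falls in a random fragment and, in that fragment, is
uniform (`nextChord_hits`); the waiting times and the parameter `α` only decide when a fragment is
split. Integrating over the step at which a fragment is split first, the probability that it has a
long-lived line of descent is at most the truncated union bound `survival` (`survivalBound`).

*Geometry.* The fragments are the nonempty sets of points of the disk that lie strictly on given
sides of all the chords; these sets are convex (`mem_fragments_iff`). On the circle, the side of a
chord is read off the order of the angles (`side_circ_sign`). Consequently, a ray with more than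
three ends from generation `k` on yields, for every `m`, a line of descent with at least three cuts
in the generations `k, …, k + m - 1` (`longLived_of_ray`).
-/

noncomputable section

namespace Figela

open scoped ENNReal Topology

/-! ### Types and the maximum principle -/

/-- A bound on the probability that a fragment with `j` independent uniform cuts has a line of
descent along which the `i`-th fragment has at least `3` cuts whenever the `i`-th entry of the list
is `true`. It is the union bound over the two offspring, truncated at `1` at each generation. -/
def typeBound : List Bool → ℕ → ℝ≥0∞
  | [], _ => 1
  | f :: w, j => if f = true ∧ j < 3 then 0 else
      min 1 (2 / (j + 2) * ∑ i ∈ Finset.range (j + 2), typeBound w i)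

lemma typeBound_le_one (w : List Bool) (j : ℕ) : typeBound w j ≤ 1 := by
  cases w with
  | nil => simp [typeBound]
  | cons f w => rw [typeBound]; split_ifs <;> simp

lemma typeBound_cons_le (f : Bool) (w : List Bool) (j : ℕ) :
    typeBound (f :: w) j ≤ 2 / (j + 2) * ∑ i ∈ Finset.range (j + 2), typeBound w i := by
  rw [typeBound]; split_ifs <;> simp

lemma typeBound_replicate_succ_le (m j : ℕ) :
    typeBound (List.replicate (m + 1) true) j ≤ typeBound (List.replicate m true) j := by
  induction m generalizing j with
  | zero => simpa [typeBound] using typeBound_le_one [true] j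
  | succ m ih =>
    rw [List.replicate_succ, typeBound, List.replicate_succ, typeBound]
    split_ifs
    · exact le_rfl
    · gcongr with i
      exact ih i

/-- A bounded nonnegative subharmonic function of the mean matrix
`j ↦ 2 / (j + 2) * ∑_{3 ≤ i ≤ j + 1}` vanishes: the function `j ↦ j - 1` is harmonic and unbounded,
so that the ratio of the two has a last maximum, which the maximum principle forbids. -/
lemma eq_zero_of_subharmonic (r : ℕ → ℝ) (h0 : ∀ j, 0 ≤ r j) (h1 : ∀ j, r j ≤ 1)
    (h3 : ∀ j < 3, r j = 0)
    (hr : ∀ j, r j ≤ 2 / (j + 2) * ∑ i ∈ Finset.range (j + 2), r i) (j : ℕ) : r j = 0 := by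
  have harm : ∀ n : ℕ, ∑ i ∈ Finset.range (n + 2), (if i < 3 then (0 : ℝ) else (i : ℝ) - 1)
      = if n < 2 then 0 else ((n : ℝ) + 2) / 2 * ((n : ℝ) - 1) := by
    intro n
    induction n with
    | zero => simp [Finset.sum_range_succ]
    | succ n ih =>
      rw [Finset.sum_range_succ, ih]
      rcases Nat.lt_or_ge n 2 with h | h
      · interval_cases n <;> norm_num
      · rw [if_neg (by omega), if_neg (by omega), if_neg (by omega)]
        push_cast; ring
  by_contra hj
  have hj3 : 3 ≤ j := by
    by_contra h; exact hj (h3 j (by omega))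
  have hjpos : 0 < r j := lt_of_le_of_ne (h0 j) (Ne.symm hj)
  have pos : ∀ i : ℕ, 3 ≤ i → (0 : ℝ) < (i : ℝ) - 1 := by
    intro i hi
    have : (3 : ℝ) ≤ i := by exact_mod_cast hi
    linarith
  set f : ℕ → ℝ := fun i => r i / ((i : ℝ) - 1) with hf
  obtain ⟨B, hB⟩ := exists_nat_gt (1 / f j + 1 : ℝ)
  have hfj : 0 < f j := div_pos hjpos (pos j hj3)
  have hlarge : ∀ i, 3 ≤ i → f j ≤ f i → i < B := by
    intro i hi hle
    have h2 : f j ≤ 1 / ((i : ℝ) - 1) := hle.trans (by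
      have := pos i hi
      simp only [hf]; gcongr; exact h1 i)
    rw [le_div_iff₀ (pos i hi)] at h2
    have h4 : (i : ℝ) - 1 ≤ 1 / f j := by rw [le_div_iff₀ hfj]; linarith
    have : (i : ℝ) < B := by linarith
    exact_mod_cast this
  obtain ⟨a, ha, hmax⟩ := Finset.exists_max_image ((Finset.range B).filter (3 ≤ ·)) f
    ⟨j, by simp [hj3, hlarge j hj3 le_rfl]⟩
  have hmax' : ∀ i, 3 ≤ i → f i ≤ f a := by
    intro i hi
    have hja : f j ≤ f a := hmax j (by simp [hj3, hlarge j hj3 le_rfl])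
    by_cases h : f j ≤ f i
    · exact hmax i (by simp [hi, hlarge i hi h])
    · exact (not_le.1 h).le.trans hja
  have hfa : f j ≤ f a := hmax' j hj3
  have ha3 : 3 ≤ a := by simpa using (Finset.mem_filter.1 ha).2
  -- the last maximum of the ratio
  obtain ⟨b, hb, hbmax⟩ := Finset.exists_max_image
    ((Finset.range B).filter fun i => 3 ≤ i ∧ f a ≤ f i) id
    ⟨a, by simp [ha3, hlarge a ha3 hfa]⟩
  simp only [Finset.mem_filter, Finset.mem_range, id] at hb hbmax
  obtain ⟨-, hb3, hbf⟩ := hb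
  have hsucc : f (b + 1) < f a := by
    by_contra h
    have := hbmax (b + 1) ⟨hlarge _ (by omega) (hfa.trans (not_lt.1 h)), by omega, not_lt.1 h⟩
    omega
  have hsum : ∑ i ∈ Finset.range (b + 2), r i
      < ∑ i ∈ Finset.range (b + 2), f a * (if i < 3 then (0 : ℝ) else (i : ℝ) - 1) := by
    apply Finset.sum_lt_sum
    · intro i _
      split_ifs with h
      · simp [h3 i h]
      · have := hmax' i (by omega)
        rwa [hf, div_le_iff₀ (pos i (by omega))] at this
    · refine ⟨b + 1, by simp, ?_⟩
      rw [if_neg (by omega)]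
      have := pos (b + 1) (by omega)
      rwa [hf, div_lt_iff₀ this] at hsucc
  rw [← Finset.mul_sum, harm, if_neg (by omega)] at hsum
  have h5 := hr b
  have hb' : (0 : ℝ) < (b : ℝ) + 2 := by positivity
  have h6 : r b < f a * ((b : ℝ) - 1) := by
    refine h5.trans_lt ?_
    calc _ < 2 / ((b : ℝ) + 2) * (f a * (((b : ℝ) + 2) / 2 * ((b : ℝ) - 1))) := by gcongr
      _ = _ := by field_simp
  rw [← div_lt_iff₀ (pos b hb3)] at h6
  exact absurd hbf (not_le.2 h6)

lemma tendsto_typeBound_true (j : ℕ) :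
    Tendsto (fun m => typeBound (List.replicate m true) j) atTop (𝓝 0) := by
  set u : ℕ → ℕ → ℝ≥0∞ := fun j m => typeBound (List.replicate m true) j with hu
  have hanti : ∀ j, Antitone (u j) := fun j =>
    antitone_nat_of_succ_le fun m => typeBound_replicate_succ_le m j
  have hlim : ∀ j, Tendsto (u j) atTop (𝓝 (⨅ m, u j m)) := fun j => tendsto_atTop_iInf (hanti j)
  set l : ℕ → ℝ≥0∞ := fun j => ⨅ m, u j m with hl
  have hl1 : ∀ j, l j ≤ 1 := fun j => (iInf_le _ 0).trans (typeBound_le_one _ _)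
  have hltop : ∀ j, l j ≠ ∞ := fun j => ((hl1 j).trans_lt ENNReal.one_lt_top).ne
  have key : ∀ j, l j ≤ 2 / (j + 2) * ∑ i ∈ Finset.range (j + 2), l i := by
    intro j
    have h2 : (2 / (j + 2) : ℝ≥0∞) ≠ ∞ := by
      apply ENNReal.div_ne_top <;> simp
    refine le_of_tendsto_of_tendsto ((hlim j).comp (tendsto_add_atTop_nat 1))
      (ENNReal.Tendsto.const_mul (tendsto_finsetSum _ fun i _ => hlim i) (Or.inr h2))
      (Eventually.of_forall fun m => ?_)
    simpa [hu, List.replicate_succ] using typeBound_cons_le true (List.replicate m true) j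
  have hz : ∀ j, (l j).toReal = 0 := by
    apply eq_zero_of_subharmonic
    · intro j; positivity
    · intro j; simpa using ENNReal.toReal_mono ENNReal.one_ne_top (hl1 j)
    · intro j hj
      have : l j ≤ 0 := (iInf_le _ 1).trans (by simp [hu, typeBound, hj])
      simp [nonpos_iff_eq_zero.1 this]
    · intro j
      have hfin : (∑ i ∈ Finset.range (j + 2), l i) ≠ ∞ :=
        ENNReal.sum_ne_top.2 fun i _ => hltop i
      have := ENNReal.toReal_mono (ENNReal.mul_ne_top
        (ENNReal.div_ne_top (by simp) (by simp)) hfin) (key j)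
      rw [ENNReal.toReal_mul, ENNReal.toReal_sum fun i _ => hltop i, ENNReal.toReal_div] at this
      have e : ((j : ℝ≥0∞) + 2).toReal = j + 2 := by
        rw [ENNReal.toReal_add (by simp) (by simp)]; simp
      rw [e] at this
      simpa using this
  have : l j = 0 := by
    rcases (ENNReal.toReal_eq_zero_iff _).1 (hz j) with h | h
    · exact h
    · exact absurd h (hltop j)
  rw [← this]; exact hlim j

lemma tendsto_typeBound (k j : ℕ) :
    Tendsto (fun m => typeBound (List.replicate k false ++ List.replicate m true) j) atTop
      (𝓝 0) := by
  induction k generalizing j with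
  | zero => simpa using tendsto_typeBound_true j
  | succ k ih =>
    have h2 : (2 / (j + 2) : ℝ≥0∞) ≠ ∞ := by
      apply ENNReal.div_ne_top <;> simp
    have := ENNReal.Tendsto.const_mul (tendsto_finsetSum (Finset.range (j + 2)) fun i _ => ih i)
      (Or.inr h2)
    rw [Finset.sum_const_zero, mul_zero] at this
    refine tendsto_of_tendsto_of_tendsto_of_le_of_le tendsto_const_nhds this
      (fun _ => zero_le) fun m => ?_
    simpa [List.replicate_succ] using
      typeBound_cons_le false (List.replicate k false ++ List.replicate m true) j

/-! ### Measurability for lists of reals -/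

/-- A list is coded by its length and its entries, continued by `0`. -/
def listCode (l : List ℝ) : ℕ × (ℕ → ℝ) := (l.length, fun i => l.getD i 0)

/-- The sigma-algebra on lists generated by the length and the entries. -/
instance instMeasurableSpaceListReal : MeasurableSpace (List ℝ) :=
  MeasurableSpace.comap listCode inferInstance

variable {γ : Type*} [MeasurableSpace γ]

lemma measurable_list_iff {f : γ → List ℝ} :
    Measurable f ↔ Measurable (fun a => (f a).length) ∧
      ∀ i, Measurable fun a => (f a).getD i 0 := by
  rw [measurable_comap_iff]
  constructor
  · exact fun h => ⟨measurable_fst.comp h,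
      fun i => (measurable_pi_apply i).comp (measurable_snd.comp h)⟩
  · exact fun h => h.1.prodMk (measurable_pi_iff.2 h.2)

lemma measurable_length : Measurable (List.length : List ℝ → ℕ) :=
  (measurable_list_iff.1 (measurable_id (α := List ℝ))).1

lemma measurable_getD (i : ℕ) : Measurable fun l : List ℝ => l.getD i 0 :=
  (measurable_list_iff.1 (measurable_id (α := List ℝ))).2 i

lemma measurable_list_cons {a : γ → ℝ} {f : γ → List ℝ} (ha : Measurable a) (hf : Measurable f) :
    Measurable fun s => a s :: f s := by
  refine measurable_list_iff.2 ⟨?_, fun i => ?_⟩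
  · simpa using (measurable_length.comp hf).add_const 1
  · cases i with
    | zero => simpa using ha
    | succ i => exact (measurable_getD i).comp hf

lemma measurable_list_tail : Measurable (List.tail : List ℝ → List ℝ) := by
  refine measurable_list_iff.2 ⟨?_, fun i => ?_⟩
  · have : (fun l : List ℝ => l.tail.length) = (fun n : ℕ => n - 1) ∘ List.length := by
      ext l; simp
    rw [this]; exact (measurable_of_countable _).comp measurable_length
  · have : (fun l : List ℝ => l.tail.getD i 0) = fun l => l.getD (i + 1) 0 := by
      ext l; cases l <;> simp
    rw [this]; exact measurable_getD _

open Classical in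
/-- Selecting the entries with a given property and transforming them. -/
def selectMap (p : ℝ → Prop) (F : ℝ → ℝ) (l : List ℝ) : List ℝ := (l.filter (p ·)).map F

@[simp] lemma selectMap_nil (p : ℝ → Prop) (F : ℝ → ℝ) : selectMap p F [] = [] := rfl

open Classical in
lemma selectMap_cons (p : ℝ → Prop) (F : ℝ → ℝ) (c : ℝ) (l : List ℝ) :
    selectMap p F (c :: l) = if p c then F c :: selectMap p F l else selectMap p F l := by
  by_cases h : p c <;> simp [selectMap, h]

lemma mem_selectMap {p : ℝ → Prop} {F : ℝ → ℝ} {c : ℝ} {l : List ℝ} (hc : c ∈ l) (hp : p c) :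
    F c ∈ selectMap p F l := by
  simp only [selectMap, List.mem_map, List.mem_filter]
  exact ⟨c, ⟨hc, by simpa using hp⟩, rfl⟩

open Classical in
lemma measurable_selectMap {p : γ → ℝ → Prop} {F : γ → ℝ → ℝ}
    (hp : MeasurableSet {q : γ × ℝ | p q.1 q.2}) (hF : Measurable fun q : γ × ℝ => F q.1 q.2) :
    Measurable fun q : γ × List ℝ => selectMap (p q.1) (F q.1) q.2 := by
  -- the same function, following the list to a bounded depth only
  let g : ℕ → γ × List ℝ → List ℝ := fun n => Nat.rec (fun _ => []) (fun _ r q =>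
    if q.2.length = 0 then [] else
      if p q.1 (q.2.getD 0 0) then F q.1 (q.2.getD 0 0) :: r (q.1, q.2.tail)
      else r (q.1, q.2.tail)) n
  have hg : ∀ n, Measurable (g n) := by
    intro n
    induction n with
    | zero => exact measurable_const
    | succ n ih =>
      have h0 : Measurable fun q : γ × List ℝ => (q.1, q.2.getD 0 0) :=
        measurable_fst.prodMk ((measurable_getD 0).comp measurable_snd)
      have hr : Measurable fun q : γ × List ℝ => g n (q.1, q.2.tail) :=
        ih.comp (measurable_fst.prodMk (measurable_list_tail.comp measurable_snd))
      exact Measurable.ite ((measurable_length.comp measurable_snd) (measurableSet_singleton 0))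
        measurable_const (Measurable.ite (h0 hp) (measurable_list_cons (hF.comp h0) hr) hr)
  have key : ∀ n (s : γ) (l : List ℝ), l.length ≤ n → g n (s, l) = selectMap (p s) (F s) l := by
    intro n
    induction n with
    | zero =>
      intro s l hl
      rw [List.length_eq_zero_iff.1 (Nat.le_zero.1 hl)]; rfl
    | succ n ih =>
      intro s l hl
      cases l with
      | nil => simp [g]
      | cons c l =>
        rw [selectMap_cons, ← ih s l (by simpa using hl)]
        simp [g]
  have hG : Measurable fun r : ℕ × (γ × List ℝ) => g r.1 r.2 :=
    measurable_from_prod_countable_right hg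
  have := hG.comp ((measurable_length.comp measurable_snd).prodMk (measurable_id (α := γ × List ℝ)))
  convert this using 2 with q
  exact (key _ q.1 q.2 le_rfl).symm

/-! ### Cuts -/

/-- The cuts between `x` and `y`, counted from `x`. -/
def inside (x y : ℝ) (l : List ℝ) : List ℝ := selectMap (fun c => x ≤ c ∧ c < y) (fun c => c - x) l

/-- The cuts left after the interval `[x, y)` has been removed and its borders glued. -/
def outside (x y : ℝ) (l : List ℝ) : List ℝ :=
  selectMap (fun c => c < x ∨ y ≤ c) (fun c => if c < x then c else c - (y - x)) l

lemma measurable_inside {x y : γ → ℝ} {l : γ → List ℝ} (hx : Measurable x) (hy : Measurable y)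
    (hl : Measurable l) : Measurable fun s => inside (x s) (y s) (l s) := by
  have h1 : MeasurableSet {q : (ℝ × ℝ) × ℝ | q.1.1 ≤ q.2} :=
    measurableSet_le (by fun_prop) (by fun_prop)
  have h2 : MeasurableSet {q : (ℝ × ℝ) × ℝ | q.2 < q.1.2} :=
    measurableSet_lt (by fun_prop) (by fun_prop)
  have := measurable_selectMap (γ := ℝ × ℝ) (p := fun q c => q.1 ≤ c ∧ c < q.2)
    (F := fun q c => c - q.1) (h1.inter h2) (by fun_prop)
  exact this.comp ((hx.prodMk hy).prodMk hl)

lemma measurable_outside {x y : γ → ℝ} {l : γ → List ℝ} (hx : Measurable x) (hy : Measurable y)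
    (hl : Measurable l) : Measurable fun s => outside (x s) (y s) (l s) := by
  have h1 : MeasurableSet {q : (ℝ × ℝ) × ℝ | q.2 < q.1.1} :=
    measurableSet_lt (by fun_prop) (by fun_prop)
  have h2 : MeasurableSet {q : (ℝ × ℝ) × ℝ | q.1.2 ≤ q.2} :=
    measurableSet_le (by fun_prop) (by fun_prop)
  have := measurable_selectMap (γ := ℝ × ℝ) (p := fun q c => c < q.1 ∨ q.2 ≤ c)
    (F := fun q c => if c < q.1 then c else c - (q.2 - q.1)) (h1.union h2)
    (Measurable.ite h1 (by fun_prop) (by fun_prop))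
  exact this.comp ((hx.prodMk hy).prodMk hl)

/-- The sum of `Ψ` over the two pieces of an interval of length `ℓ` with cuts `v`, when it is split
by the chord with feet `x ≤ y`. The arguments of `Ψ` are the length and the cuts. Gluing the borders
of the outer piece creates the new cut `x`. -/
def children (Ψ : ℝ → List ℝ → ℝ≥0∞) (ℓ : ℝ) (v : List ℝ) (x y : ℝ) : ℝ≥0∞ :=
  Ψ (y - x) (inside x y v) + Ψ (ℓ - (y - x)) (x :: outside x y v)

/-- The mean of `children` over a chord with independent uniform feet in `[0, ℓ)`. It is `0` if
`ℓ ≤ 0`, since the double integral vanishes then. -/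
def splitMean (Ψ : ℝ → List ℝ → ℝ≥0∞) (ℓ : ℝ) (v : List ℝ) : ℝ≥0∞ :=
  ((ENNReal.ofReal ℓ)⁻¹) ^ 2 *
    ∫⁻ s in Ico 0 ℓ, ∫⁻ t in Ico 0 ℓ, children Ψ ℓ v (min s t) (max s t)

/-- The analogue of `typeBound` for an interval of length `ℓ` with given cuts `v`: the union bound
over the two offspring for the existence of a line of descent satisfying the flags, truncated at `1`
at each generation. -/
def survival : List Bool → ℝ → List ℝ → ℝ≥0∞
  | [], _, _ => 1
  | f :: w, ℓ, v => if f = true ∧ v.length < 3 then 0 else min 1 (splitMean (survival w) ℓ v)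

lemma measurable_children {Ψ : ℝ → List ℝ → ℝ≥0∞} (hΨ : Measurable fun q : ℝ × List ℝ => Ψ q.1 q.2)
    {ℓ x y : γ → ℝ} {v : γ → List ℝ} (hℓ : Measurable ℓ) (hv : Measurable v) (hx : Measurable x)
    (hy : Measurable y) : Measurable fun s => children Ψ (ℓ s) (v s) (x s) (y s) := by
  refine (hΨ.comp ((hy.sub hx).prodMk (measurable_inside hx hy hv))).add
    (hΨ.comp ((hℓ.sub (hy.sub hx)).prodMk (measurable_list_cons hx (measurable_outside hx hy hv))))

lemma measurable_setLIntegral_Ico {ℓ : γ → ℝ} (hℓ : Measurable ℓ) {H : γ → ℝ → ℝ≥0∞}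
    (hH : Measurable fun q : γ × ℝ => H q.1 q.2) :
    Measurable fun s => ∫⁻ c in Ico 0 (ℓ s), H s c := by
  have : ∀ s, ∫⁻ c in Ico 0 (ℓ s), H s c
      = ∫⁻ c, {q : γ × ℝ | 0 ≤ q.2 ∧ q.2 < ℓ q.1}.indicator (fun q => H q.1 q.2) (s, c) := by
    intro s
    rw [← lintegral_indicator measurableSet_Ico]
    rfl
  simp_rw [this]
  have h1 : MeasurableSet {q : γ × ℝ | 0 ≤ q.2} := measurableSet_le (by fun_prop) (by fun_prop)
  have h2 : MeasurableSet {q : γ × ℝ | q.2 < ℓ q.1} :=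
    measurableSet_lt (by fun_prop) (by fun_prop)
  exact Measurable.lintegral_prod_right' (hH.indicator (h1.inter h2))

lemma measurable_splitMean {Ψ : ℝ → List ℝ → ℝ≥0∞}
    (hΨ : Measurable fun q : ℝ × List ℝ => Ψ q.1 q.2) :
    Measurable fun q : ℝ × List ℝ => splitMean Ψ q.1 q.2 := by
  refine Measurable.mul ((ENNReal.measurable_ofReal.comp measurable_fst).inv.pow_const 2) ?_
  refine measurable_setLIntegral_Ico (γ := ℝ × List ℝ) measurable_fst
    (H := fun q s => ∫⁻ t in Ico 0 q.1, children Ψ q.1 q.2 (min s t) (max s t)) ?_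
  refine measurable_setLIntegral_Ico (γ := (ℝ × List ℝ) × ℝ) (ℓ := fun q => q.1.1) (by fun_prop)
    (H := fun q t => children Ψ q.1.1 q.1.2 (min q.2 t) (max q.2 t)) ?_
  exact measurable_children hΨ (by fun_prop) (by fun_prop) (by fun_prop) (by fun_prop)

lemma measurable_survival (w : List Bool) :
    Measurable fun q : ℝ × List ℝ => survival w q.1 q.2 := by
  induction w with
  | nil => exact measurable_const
  | cons f w ih =>
    simp only [survival]
    refine Measurable.ite ?_ measurable_const (measurable_const.min (measurable_splitMean ih))
    have : MeasurableSet {q : ℝ × List ℝ | q.2.length < 3} :=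
      (measurable_length.comp measurable_snd) (measurableSet_Iio (a := 3))
    exact (MeasurableSet.const (f = true)).inter this

/-! ### Averages over independent uniform cuts -/

/-- The integral of `h` over `j` cuts that range independently over `[0, ℓ)`. It is not normalized:
the total mass is `ℓ ^ j`. -/
def cutIntegral : ℕ → ℝ → (List ℝ → ℝ≥0∞) → ℝ≥0∞
  | 0, _, h => h []
  | j + 1, ℓ, h => ∫⁻ c in Ico 0 ℓ, cutIntegral j ℓ fun l => h (c :: l)

lemma measurable_cutIntegral (j : ℕ) {γ : Type*} [MeasurableSpace γ] {ℓ : γ → ℝ}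
    (hℓ : Measurable ℓ) {H : γ → List ℝ → ℝ≥0∞}
    (hH : Measurable fun q : γ × List ℝ => H q.1 q.2) :
    Measurable fun s => cutIntegral j (ℓ s) (H s) := by
  induction j generalizing γ with
  | zero => exact hH.comp (measurable_id.prodMk measurable_const)
  | succ j ih =>
    simp only [cutIntegral]
    refine measurable_setLIntegral_Ico hℓ
      (H := fun s c => cutIntegral j (ℓ s) fun l => H s (c :: l)) ?_
    refine ih (γ := γ × ℝ) (ℓ := fun q => ℓ q.1) (hℓ.comp measurable_fst)
      (H := fun q l => H q.1 (q.2 :: l)) ?_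
    exact hH.comp (Measurable.prodMk (by fun_prop)
      (measurable_list_cons (by fun_prop) (by fun_prop)))

lemma cutIntegral_mono (j : ℕ) (ℓ : ℝ) {g h : List ℝ → ℝ≥0∞} (hgh : ∀ l, l.length = j → g l ≤ h l) :
    cutIntegral j ℓ g ≤ cutIntegral j ℓ h := by
  induction j generalizing g h with
  | zero => exact hgh [] rfl
  | succ j ih =>
    exact lintegral_mono fun c => ih fun l hl => hgh (c :: l) (by simp [hl])

lemma cutIntegral_const (j : ℕ) (ℓ : ℝ) (a : ℝ≥0∞) :
    cutIntegral j ℓ (fun _ => a) = ENNReal.ofReal ℓ ^ j * a := by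
  induction j with
  | zero => simp [cutIntegral]
  | succ j ih => simp [cutIntegral, ih, pow_succ]; ring

lemma cutIntegral_add (j : ℕ) (ℓ : ℝ) {g h : List ℝ → ℝ≥0∞} (hg : Measurable g) :
    cutIntegral j ℓ (fun l => g l + h l) = cutIntegral j ℓ g + cutIntegral j ℓ h := by
  induction j generalizing g h with
  | zero => rfl
  | succ j ih =>
    simp only [cutIntegral]
    rw [← lintegral_add_left]
    · exact lintegral_congr fun c => ih (hg.comp (measurable_list_cons (by fun_prop) (by fun_prop)))
    · refine measurable_cutIntegral j (γ := ℝ) (ℓ := fun _ => ℓ) measurable_const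
        (H := fun c l => g (c :: l)) ?_
      exact hg.comp (measurable_list_cons (by fun_prop) (by fun_prop))

lemma cutIntegral_const_mul (j : ℕ) (ℓ : ℝ) (a : ℝ≥0∞) (ha : a ≠ ∞) (g : List ℝ → ℝ≥0∞) :
    cutIntegral j ℓ (fun l => a * g l) = a * cutIntegral j ℓ g := by
  induction j generalizing g with
  | zero => rfl
  | succ j ih =>
    simp only [cutIntegral]
    rw [← lintegral_const_mul' _ _ ha]
    exact lintegral_congr fun c => ih _

/-- Tonelli's theorem for cut integrals. -/
lemma cutIntegral_lintegral (j : ℕ) (ℓ : ℝ) {γ : Type*} [MeasurableSpace γ] (μ : Measure γ)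
    [SFinite μ] {H : γ → List ℝ → ℝ≥0∞} (hH : Measurable fun q : γ × List ℝ => H q.1 q.2) :
    cutIntegral j ℓ (fun l => ∫⁻ s, H s l ∂μ) = ∫⁻ s, cutIntegral j ℓ (H s) ∂μ := by
  induction j generalizing H with
  | zero => rfl
  | succ j ih =>
    simp only [cutIntegral]
    have h1 : Measurable fun q : (γ × ℝ) × List ℝ => H q.1.1 (q.1.2 :: q.2) :=
      hH.comp (Measurable.prodMk (by fun_prop) (measurable_list_cons (by fun_prop) (by fun_prop)))
    rw [lintegral_lintegral_swap]
    · refine lintegral_congr fun c => ih (H := fun s l => H s (c :: l)) ?_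
      exact h1.comp (Measurable.prodMk (Measurable.prodMk (by fun_prop) measurable_const)
        (by fun_prop))
    · exact (measurable_cutIntegral j (γ := γ × ℝ) (ℓ := fun _ => ℓ) measurable_const
        (H := fun q l => H q.1 (q.2 :: l)) h1).aemeasurable

/-! ### One split of an interval with uniform cuts -/

/-- Binomial thinning: if the cuts with property `p` are kept and mapped to `[0, D)` by a map that
preserves Lebesgue measure, and the others range over a set of measure `B`, then the integral over
all cuts decomposes according to the number of cuts kept. -/
lemma cutIntegral_selectMap {ℓ D : ℝ} {B : ℝ≥0∞} {p : ℝ → Prop} {F : ℝ → ℝ}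
    (hp : MeasurableSet {c | p c}) (hF : Measurable F)
    (hmap : (volume.restrict (Ico 0 ℓ ∩ {c | p c})).map F = volume.restrict (Ico 0 D))
    (hB : volume (Ico 0 ℓ \ {c | p c}) = B) (j : ℕ) {g : List ℝ → ℝ≥0∞} (hg : Measurable g) :
    cutIntegral j ℓ (fun l => g (selectMap p F l))
      = ∑ i ∈ Finset.range (j + 1), (j.choose i : ℝ≥0∞) * (B ^ (j - i) * cutIntegral i D g) := by
  induction j generalizing g with
  | zero => simp [cutIntegral]
  | succ j ih =>
    have hcons : ∀ c : ℝ, Measurable fun l => g (c :: l) := fun c =>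
      hg.comp (measurable_list_cons measurable_const measurable_id)
    have hgm : Measurable fun q : ℝ × List ℝ => g (q.1 :: q.2) :=
      hg.comp (measurable_list_cons (by fun_prop) (by fun_prop))
    have hm : ∀ i, Measurable fun c => cutIntegral i D fun l => g (c :: l) := fun i =>
      measurable_cutIntegral i (γ := ℝ) (ℓ := fun _ => D) measurable_const
        (H := fun c l => g (c :: l)) hgm
    have hBtop : B ≠ ∞ := by
      rw [← hB]
      exact ((measure_mono sdiff_subset).trans_lt measure_Ico_lt_top).ne
    rw [cutIntegral, ← lintegral_inter_add_sdiff _ (Ico 0 ℓ) hp]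
    have e1 : ∫⁻ c in Ico 0 ℓ ∩ {c | p c}, cutIntegral j ℓ (fun l => g (selectMap p F (c :: l)))
        = ∑ i ∈ Finset.range (j + 1),
            (j.choose i : ℝ≥0∞) * (B ^ (j - i) * cutIntegral (i + 1) D g) := by
      have : ∀ c ∈ Ico 0 ℓ ∩ {c | p c}, cutIntegral j ℓ (fun l => g (selectMap p F (c :: l)))
          = (fun a => ∑ i ∈ Finset.range (j + 1), (j.choose i : ℝ≥0∞) *
            (B ^ (j - i) * cutIntegral i D fun l => g (a :: l))) (F c) := by
        intro c hc
        have hpc : p c := hc.2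
        simp only [selectMap_cons, if_pos hpc]
        exact ih (hcons (F c))
      have hsum : Measurable fun a => ∑ i ∈ Finset.range (j + 1), (j.choose i : ℝ≥0∞) *
          (B ^ (j - i) * cutIntegral i D fun l => g (a :: l)) :=
        Finset.measurable_fun_sum _ fun i _ => ((hm i).const_mul _).const_mul _
      rw [setLIntegral_congr_fun (measurableSet_Ico.inter hp) this, ← lintegral_map hsum hF, hmap,
        lintegral_finsetSum]
      · refine Finset.sum_congr rfl fun i _ => ?_
        rw [lintegral_const_mul _ ((hm i).const_mul _), lintegral_const_mul _ (hm i)]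
        rfl
      · exact fun i _ => ((hm i).const_mul _).const_mul _
    have e2 : ∫⁻ c in Ico 0 ℓ \ {c | p c}, cutIntegral j ℓ (fun l => g (selectMap p F (c :: l)))
        = ∑ i ∈ Finset.range (j + 1),
            (j.choose i : ℝ≥0∞) * (B ^ (j + 1 - i) * cutIntegral i D g) := by
      have : ∀ c ∈ Ico 0 ℓ \ {c | p c}, cutIntegral j ℓ (fun l => g (selectMap p F (c :: l)))
          = ∑ i ∈ Finset.range (j + 1), (j.choose i : ℝ≥0∞) *
            (B ^ (j - i) * cutIntegral i D g) := by
        intro c hc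
        have hpc : ¬ p c := hc.2
        simp only [selectMap_cons, if_neg hpc]
        exact ih hg
      rw [setLIntegral_congr_fun (measurableSet_Ico.diff hp) this, lintegral_const,
        Measure.restrict_apply_univ, hB, Finset.sum_mul]
      refine Finset.sum_congr rfl fun i hi => ?_
      rw [Nat.succ_sub (by simpa [Nat.lt_succ_iff] using hi), pow_succ]
      ring
    rw [e1, e2, Finset.sum_choose_succ_mul fun i k => B ^ k * cutIntegral i D g, add_comm]

lemma map_sub_restrict_Ico (a b r : ℝ) :
    (volume.restrict (Ico a b)).map (fun c => c - r) = volume.restrict (Ico (a - r) (b - r)) := by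
  have h := (measurePreserving_sub_right (volume : Measure ℝ) r).restrict_preimage
    (s := Ico (a - r) (b - r)) measurableSet_Ico
  simpa using h.map_eq

lemma cutIntegral_inside {ℓ x y : ℝ} (hx : 0 ≤ x) (hxy : x ≤ y) (hy : y ≤ ℓ) (j : ℕ)
    {g : List ℝ → ℝ≥0∞} (hg : Measurable g) :
    cutIntegral j ℓ (fun l => g (inside x y l)) = ∑ i ∈ Finset.range (j + 1), (j.choose i : ℝ≥0∞) *
      (ENNReal.ofReal (ℓ - (y - x)) ^ (j - i) * cutIntegral i (y - x) g) := by
  refine cutIntegral_selectMap (p := fun c => x ≤ c ∧ c < y) measurableSet_Ico (by fun_prop)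
    ?_ ?_ j hg
  · have : Ico 0 ℓ ∩ {c | x ≤ c ∧ c < y} = Ico x y := by
      ext c; simp only [mem_inter_iff, mem_Ico, mem_ofPred_eq]
      constructor
      · exact fun h => h.2
      · exact fun h => ⟨⟨hx.trans h.1, h.2.trans_le hy⟩, h⟩
    rw [this, map_sub_restrict_Ico, sub_self]
  · have : {c | x ≤ c ∧ c < y} = Ico x y := rfl
    rw [this, measure_sdiff (Ico_subset_Ico hx hy) measurableSet_Ico.nullMeasurableSet
      measure_Ico_lt_top.ne, Real.volume_Ico, Real.volume_Ico, sub_zero,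
      ← ENNReal.ofReal_sub _ (sub_nonneg.2 hxy)]

lemma cutIntegral_outside {ℓ x y : ℝ} (hx : 0 ≤ x) (hxy : x ≤ y) (hy : y ≤ ℓ) (j : ℕ)
    {g : List ℝ → ℝ≥0∞} (hg : Measurable g) :
    cutIntegral j ℓ (fun l => g (outside x y l)) = ∑ i ∈ Finset.range (j + 1), (j.choose i : ℝ≥0∞) *
      (ENNReal.ofReal (y - x) ^ (j - i) * cutIntegral i (ℓ - (y - x)) g) := by
  have hF : Measurable fun c : ℝ => if c < x then c else c - (y - x) :=
    Measurable.ite measurableSet_Iio (by fun_prop) (by fun_prop)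
  refine cutIntegral_selectMap (p := fun c => c < x ∨ y ≤ c)
    (measurableSet_Iio.union measurableSet_Ici) hF ?_ ?_ j hg
  · have e : Ico 0 ℓ ∩ {c | c < x ∨ y ≤ c} = Ico 0 x ∪ Ico y ℓ := by
      ext c; simp only [mem_inter_iff, mem_Ico, mem_ofPred_eq, mem_union]
      constructor
      · rintro ⟨h, h1 | h1⟩
        · exact Or.inl ⟨h.1, h1⟩
        · exact Or.inr ⟨h1, h.2⟩
      · rintro (h | h)
        · exact ⟨⟨h.1, by linarith⟩, Or.inl h.2⟩
        · exact ⟨⟨by linarith, h.2⟩, Or.inr h.1⟩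
    have d1 : Disjoint (Ico 0 x) (Ico y ℓ) := by
      rw [Set.disjoint_left]; intro c h1 h2; exact absurd h1.2 (not_lt.2 (hxy.trans h2.1))
    have d2 : Disjoint (Ico 0 x) (Ico x (ℓ - (y - x))) := by
      rw [Set.disjoint_left]; intro c h1 h2; exact absurd h1.2 (not_lt.2 h2.1)
    have m1 : (volume.restrict (Ico 0 x)).map (fun c : ℝ => if c < x then c else c - (y - x))
        = volume.restrict (Ico 0 x) := by
      conv_rhs => rw [← Measure.map_id (μ := volume.restrict (Ico 0 x))]
      refine Measure.map_congr ?_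
      filter_upwards [ae_restrict_mem measurableSet_Ico] with c hc
      simp [hc.2]
    have m2 : (volume.restrict (Ico y ℓ)).map (fun c : ℝ => if c < x then c else c - (y - x))
        = volume.restrict (Ico x (ℓ - (y - x))) := by
      have := map_sub_restrict_Ico y ℓ (y - x)
      rw [show y - (y - x) = x by ring] at this
      rw [← this]
      refine Measure.map_congr ?_
      filter_upwards [ae_restrict_mem measurableSet_Ico] with c hc
      rw [if_neg (not_lt.2 (hxy.trans hc.1))]
    rw [e, Measure.restrict_union d1 measurableSet_Ico, Measure.map_add _ _ hF]
    rw [← Ico_union_Ico_eq_Ico hx (show x ≤ ℓ - (y - x) by linarith),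
      Measure.restrict_union d2 measurableSet_Ico]
    congr 1
  · have : Ico 0 ℓ \ {c | c < x ∨ y ≤ c} = Ico x y := by
      ext c; simp only [Set.mem_sdiff, mem_Ico, mem_ofPred_eq, not_or, not_lt, not_le]
      constructor
      · exact fun h => h.2
      · exact fun h => ⟨⟨hx.trans h.1, h.2.trans_le hy⟩, h⟩
    rw [this, Real.volume_Ico]

/-- A bound for the integral over the two feet by one over their distance `d` and the smaller foot `s`. -/
lemma lintegral_min_max_le {ℓ : ℝ} {G : ℝ → ℝ → ℝ≥0∞} (hG : Measurable fun q : ℝ × ℝ => G q.1 q.2) :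
    ∫⁻ s in Ico 0 ℓ, ∫⁻ t in Ico 0 ℓ, G (min s t) (max s t)
      ≤ 2 * ∫⁻ d in Ico 0 ℓ, ∫⁻ s in Ico 0 (ℓ - d), G s (s + d) := by
  set T : Set (ℝ × ℝ) := {q | 0 ≤ q.1 ∧ q.1 ≤ q.2 ∧ q.2 < ℓ} with hT
  have hTm : MeasurableSet T := by
    have h1 : MeasurableSet {q : ℝ × ℝ | 0 ≤ q.1} := measurableSet_le (by fun_prop) (by fun_prop)
    have h2 : MeasurableSet {q : ℝ × ℝ | q.1 ≤ q.2} := measurableSet_le (by fun_prop) (by fun_prop)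
    have h3 : MeasurableSet {q : ℝ × ℝ | q.2 < ℓ} := measurableSet_lt (by fun_prop) (by fun_prop)
    exact h1.inter (h2.inter h3)
  -- the integrand of the ordered pairs of feet, extended by zero to the plane
  set K : ℝ × ℝ → ℝ≥0∞ := T.indicator fun q => G q.1 q.2 with hK
  have hKm : Measurable K := hG.indicator hTm
  have hswap : ∫⁻ s, ∫⁻ t, K (t, s) = ∫⁻ s, ∫⁻ t, K (s, t) :=
    lintegral_lintegral_swap (f := fun s t => K (t, s)) (hKm.comp measurable_swap).aemeasurable
  have hle : ∫⁻ s in Ico 0 ℓ, ∫⁻ t in Ico 0 ℓ, G (min s t) (max s t)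
      ≤ ∫⁻ s, ((∫⁻ t, K (s, t)) + ∫⁻ t, K (t, s)) := by
    rw [← lintegral_indicator measurableSet_Ico]
    refine lintegral_mono fun s => ?_
    rw [← lintegral_add_left (f := fun t => K (s, t)) (hKm.comp (by fun_prop))]
    refine indicator_apply_le' (fun hs => ?_) (fun _ => zero_le)
    rw [← lintegral_indicator measurableSet_Ico]
    refine lintegral_mono fun t => indicator_apply_le' (fun ht => ?_) (fun _ => zero_le)
    rcases le_total s t with h | h
    · refine le_trans (le_of_eq ?_) le_self_add
      rw [hK, indicator_of_mem (show (s, t) ∈ T from ⟨hs.1, h, ht.2⟩), min_eq_left h,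
        max_eq_right h]
    · refine le_trans (le_of_eq ?_) le_add_self
      rw [hK, indicator_of_mem (show (t, s) ∈ T from ⟨ht.1, h, hs.2⟩), min_eq_right h,
        max_eq_left h]
  have hint : ∫⁻ s, ∫⁻ t, K (s, t) = ∫⁻ d in Ico 0 ℓ, ∫⁻ s in Ico 0 (ℓ - d), G s (s + d) := by
    have h1 : ∀ s, ∫⁻ t, K (s, t) = ∫⁻ d, K (s, s + d) := fun s =>
      (lintegral_add_left_eq_self (fun t => K (s, t)) s).symm
    simp_rw [h1]
    rw [lintegral_lintegral_swap (f := fun s d => K (s, s + d))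
      (hKm.comp (by fun_prop : Measurable fun q : ℝ × ℝ => (q.1, q.1 + q.2))).aemeasurable,
      ← lintegral_indicator measurableSet_Ico]
    refine lintegral_congr fun d => ?_
    by_cases hd : d ∈ Ico 0 ℓ
    · rw [indicator_of_mem hd, ← lintegral_indicator measurableSet_Ico]
      refine lintegral_congr fun s => ?_
      by_cases hs : s ∈ Ico 0 (ℓ - d)
      · rw [indicator_of_mem hs, hK, indicator_of_mem]
        exact ⟨hs.1, by linarith [hd.1], by linarith [hs.2]⟩
      · rw [indicator_of_notMem hs, hK, indicator_of_notMem]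
        rintro ⟨a, b, c⟩
        exact hs ⟨a, by simp only at c; linarith⟩
    · rw [indicator_of_notMem hd]
      refine (lintegral_eq_zero_iff (hKm.comp (by fun_prop))).2
        (Eventually.of_forall fun s => ?_)
      simp only [Pi.zero_apply, Function.comp_apply, hK]
      rw [indicator_of_notMem]
      rintro ⟨a, b, c⟩
      exact hd ⟨by simp only at b; linarith, by simp only at a c; linarith⟩
  have hK1 : Measurable fun s => ∫⁻ t, K (s, t) := hKm.lintegral_prod_right'
  rw [lintegral_add_left hK1, hswap, hint, ← two_mul] at hle
  exact hle

/-- The beta integral with integer parameters. -/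
lemma integral_pow_mul_sub_pow (ℓ : ℝ) (i k : ℕ) :
    ∫ x in (0 : ℝ)..ℓ, x ^ i * (ℓ - x) ^ k
      = ℓ ^ (i + k + 1) * ((i.factorial * k.factorial : ℝ) / (i + k + 1).factorial) := by
  induction i generalizing k with
  | zero =>
    have : ∫ x in (0 : ℝ)..ℓ, (ℓ - x) ^ k = ∫ x in (0 : ℝ)..ℓ, x ^ k := by
      simpa using intervalIntegral.integral_comp_sub_left (fun x : ℝ => x ^ k) ℓ (a := 0) (b := ℓ)
    simp only [pow_zero, one_mul, zero_add, this, integral_pow, Nat.factorial]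
    have := Nat.factorial_ne_zero k
    push_cast
    field_simp
    simp
  | succ i ih =>
    have hd : ∀ x : ℝ, HasDerivAt (fun x : ℝ => x ^ (i + 1) * (ℓ - x) ^ (k + 1))
        (((i : ℝ) + 1) * (x ^ i * (ℓ - x) ^ (k + 1)) - ((k : ℝ) + 1) * (x ^ (i + 1) * (ℓ - x) ^ k))
        x := by
      intro x
      have h1 := hasDerivAt_pow (i + 1) x
      have h2 := ((hasDerivAt_id x).const_sub ℓ).pow (k + 1)
      refine (h1.mul h2).congr_deriv ?_
      simp
      ring
    have hint := intervalIntegral.integral_eq_sub_of_hasDerivAt (a := 0) (b := ℓ)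
      (fun x _ => hd x) (by apply Continuous.intervalIntegrable; fun_prop)
    rw [intervalIntegral.integral_sub (by apply Continuous.intervalIntegrable; fun_prop)
      (by apply Continuous.intervalIntegrable; fun_prop), intervalIntegral.integral_const_mul,
      intervalIntegral.integral_const_mul, ih] at hint
    simp only [sub_self, ne_eq, Nat.add_eq_zero_iff, one_ne_zero, and_false, not_false_eq_true,
      zero_pow, mul_zero, zero_mul, sub_zero] at hint
    have hk : (k : ℝ) + 1 ≠ 0 := by positivity
    have h3 : ∫ x in (0 : ℝ)..ℓ, x ^ (i + 1) * (ℓ - x) ^ k = ((i : ℝ) + 1) / (k + 1) *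
        (ℓ ^ (i + (k + 1) + 1) * ((i.factorial * (k + 1).factorial : ℝ)
          / (i + (k + 1) + 1).factorial)) := by
      rw [div_mul_eq_mul_div, eq_div_iff hk]
      linarith
    rw [h3, show i + 1 + k + 1 = i + (k + 1) + 1 by ring, Nat.factorial_succ k,
      Nat.factorial_succ i]
    push_cast
    field_simp

lemma lintegral_pow_mul_sub_pow {ℓ : ℝ} (hℓ : 0 ≤ ℓ) (i k : ℕ) :
    ∫⁻ x in Ico 0 ℓ, ENNReal.ofReal x ^ i * ENNReal.ofReal (ℓ - x) ^ k
      = ENNReal.ofReal ℓ ^ (i + k + 1) *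
        ENNReal.ofReal ((i.factorial * k.factorial : ℝ) / (i + k + 1).factorial) := by
  have h1 : ∫⁻ x in Ico 0 ℓ, ENNReal.ofReal x ^ i * ENNReal.ofReal (ℓ - x) ^ k
      = ∫⁻ x in Ico 0 ℓ, ENNReal.ofReal (x ^ i * (ℓ - x) ^ k) := by
    refine setLIntegral_congr_fun measurableSet_Ico fun x hx => ?_
    have : 0 ≤ ℓ - x := by linarith [hx.2]
    rw [ENNReal.ofReal_mul (pow_nonneg hx.1 _), ENNReal.ofReal_pow hx.1, ENNReal.ofReal_pow this]
  rw [h1, ← ofReal_integral_eq_lintegral_ofReal, integral_Ico_eq_integral_Ioc,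
    ← intervalIntegral.integral_of_le hℓ, integral_pow_mul_sub_pow,
    ENNReal.ofReal_mul (by positivity), ENNReal.ofReal_pow hℓ]
  · exact ((by fun_prop : Continuous fun x : ℝ => x ^ i * (ℓ - x) ^ k).integrableOn_Icc).mono_set
      Ico_subset_Icc_self
  · filter_upwards [ae_restrict_mem measurableSet_Ico] with x hx
    have : 0 ≤ ℓ - x := by linarith [hx.2]
    exact mul_nonneg (pow_nonneg hx.1 _) (pow_nonneg this _)

lemma choose_mul_beta_left {i j : ℕ} (h : i ≤ j) :
    (j.choose i : ℝ≥0∞) *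
        ENNReal.ofReal ((i.factorial * (j - i + 1).factorial : ℝ) / (j + 2).factorial)
      = ENNReal.ofReal (((j + 1 : ℝ) * (j + 2))⁻¹) * ((j + 1 - i : ℕ) : ℝ≥0∞) := by
  rw [← ENNReal.ofReal_natCast, ← ENNReal.ofReal_natCast, ← ENNReal.ofReal_mul (by positivity),
    ← ENNReal.ofReal_mul (by positivity)]
  congr 1
  rw [Nat.cast_choose ℝ h, Nat.factorial_succ (j - i), Nat.factorial_succ (j + 1),
    Nat.factorial_succ j, show j + 1 - i = j - i + 1 by omega]
  push_cast
  have h1 := Nat.factorial_ne_zero i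
  have h2 := Nat.factorial_ne_zero (j - i)
  have h3 := Nat.factorial_ne_zero j
  field_simp
  ring

lemma choose_mul_beta_right {i j : ℕ} (h : i ≤ j) :
    (j.choose i : ℝ≥0∞) *
        ENNReal.ofReal (((j - i).factorial * (i + 1).factorial : ℝ) / (j + 2).factorial)
      = ENNReal.ofReal (((j + 1 : ℝ) * (j + 2))⁻¹) * ((i + 1 : ℕ) : ℝ≥0∞) := by
  have := choose_mul_beta_left (Nat.sub_le j i)
  rwa [Nat.choose_symm h, show j - (j - i) + 1 = i + 1 by omega,
    show j + 1 - (j - i) = i + 1 by omega] at this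

/-- In a split, an inner piece with `i` cuts has weight `j + 1 - i` and an outer piece with `i + 1`
cuts has weight `i + 1`; the two weights of a given type add up to `j + 1`. -/
lemma sum_weights (q : ℕ → ℝ≥0∞) (j : ℕ) :
    ∑ i ∈ Finset.range (j + 1), (((j + 1 - i : ℕ) : ℝ≥0∞) * q i + ((i + 1 : ℕ) : ℝ≥0∞) * q (i + 1))
      = (j + 1) * ∑ i ∈ Finset.range (j + 2), q i := by
  have h1 : ∑ i ∈ Finset.range (j + 1), ((j + 1 - i : ℕ) : ℝ≥0∞) * q i
      = ∑ i ∈ Finset.range (j + 2), ((j + 1 - i : ℕ) : ℝ≥0∞) * q i := by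
    rw [Finset.sum_range_succ _ (j + 1)]; simp
  have h2 : ∑ i ∈ Finset.range (j + 1), ((i + 1 : ℕ) : ℝ≥0∞) * q (i + 1)
      = ∑ i ∈ Finset.range (j + 2), (i : ℝ≥0∞) * q i := by
    rw [Finset.sum_range_succ' _ (j + 1)]; simp
  rw [Finset.sum_add_distrib, h1, h2, ← Finset.sum_add_distrib, Finset.mul_sum]
  refine Finset.sum_congr rfl fun i hi => ?_
  rw [← add_mul]
  congr 1
  have : i ≤ j + 1 := by have := Finset.mem_range.1 hi; omega
  exact_mod_cast Nat.sub_add_cancel this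

/-- With uniform cuts, the mean of a split is governed by the number of cuts only: the mean number
of pieces with `i` cuts is `2 / (j + 2)` for each `i ≤ j + 1`. -/
lemma cutIntegral_splitMean_le {Ψ : ℝ → List ℝ → ℝ≥0∞} {q : ℕ → ℝ≥0∞}
    (hΨ : Measurable fun r : ℝ × List ℝ => Ψ r.1 r.2)
    (hq : ∀ i D, cutIntegral i D (Ψ D) ≤ ENNReal.ofReal D ^ i * q i) {ℓ : ℝ} (hℓ : 0 < ℓ) (j : ℕ) :
    cutIntegral j ℓ (splitMean Ψ ℓ)
      ≤ ENNReal.ofReal ℓ ^ j * (2 / (j + 2) * ∑ i ∈ Finset.range (j + 2), q i) := by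
  set L := ENNReal.ofReal ℓ with hL
  have hL0 : L ≠ 0 := by simpa [hL] using hℓ
  have hLtop : L ≠ ∞ := ENNReal.ofReal_ne_top
  have hΨD : ∀ D, Measurable (Ψ D) := fun D =>
    hΨ.comp (measurable_const.prodMk measurable_id)
  set G : ℝ → ℝ → ℝ≥0∞ := fun x y => cutIntegral j ℓ fun v => children Ψ ℓ v x y with hGdef
  have hG : Measurable fun r : ℝ × ℝ => G r.1 r.2 :=
    measurable_cutIntegral j (γ := ℝ × ℝ) (ℓ := fun _ => ℓ) measurable_const
      (H := fun r v => children Ψ ℓ v r.1 r.2)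
      (measurable_children hΨ (by fun_prop) (by fun_prop) (by fun_prop) (by fun_prop))
  have hmm : Measurable fun r : (List ℝ × ℝ) × ℝ =>
      children Ψ ℓ r.1.1 (min r.1.2 r.2) (max r.1.2 r.2) :=
    measurable_children hΨ (by fun_prop) (by fun_prop) (by fun_prop) (by fun_prop)
  have h1 : cutIntegral j ℓ (splitMean Ψ ℓ)
      = L⁻¹ ^ 2 * ∫⁻ s in Ico 0 ℓ, ∫⁻ t in Ico 0 ℓ, G (min s t) (max s t) := by
    unfold splitMean
    rw [cutIntegral_const_mul _ _ _ (by simpa [hL] using hℓ)]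
    congr 1
    rw [cutIntegral_lintegral j ℓ (volume.restrict (Ico 0 ℓ))
      (H := fun s v => ∫⁻ t in Ico 0 ℓ, children Ψ ℓ v (min s t) (max s t))]
    · refine lintegral_congr fun s => ?_
      rw [cutIntegral_lintegral j ℓ (volume.restrict (Ico 0 ℓ))
        (H := fun t v => children Ψ ℓ v (min s t) (max s t))]
      exact hmm.comp (by fun_prop : Measurable fun r : ℝ × List ℝ => ((r.2, s), r.1))
    · exact Measurable.lintegral_prod_right' (ν := volume.restrict (Ico 0 ℓ))
        (hmm.comp (by fun_prop : Measurable fun r : (ℝ × List ℝ) × ℝ => ((r.1.2, r.1.1), r.2)))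
  -- the smaller foot ranges over an interval of length `ℓ - d`: as a cut of the outer piece, it is
  -- uniform and independent of the other cuts
  have h2 : ∀ d ∈ Ico 0 ℓ, ∫⁻ s in Ico 0 (ℓ - d), G s (s + d)
      ≤ ∑ i ∈ Finset.range (j + 1), ((j.choose i : ℝ≥0∞) *
        (ENNReal.ofReal d ^ i * ENNReal.ofReal (ℓ - d) ^ (j - i + 1) * q i
          + ENNReal.ofReal d ^ (j - i) * ENNReal.ofReal (ℓ - d) ^ (i + 1) * q (i + 1))) := by
    intro d hd
    have e : ∀ s ∈ Ico 0 (ℓ - d), G s (s + d)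
        = (∑ i ∈ Finset.range (j + 1), (j.choose i : ℝ≥0∞) *
            (ENNReal.ofReal (ℓ - d) ^ (j - i) * cutIntegral i d (Ψ d)))
          + ∑ i ∈ Finset.range (j + 1), (j.choose i : ℝ≥0∞) *
            (ENNReal.ofReal d ^ (j - i) * cutIntegral i (ℓ - d) fun v => Ψ (ℓ - d) (s :: v)) := by
      intro s hs
      have a1 : s ≤ s + d := by linarith [hd.1]
      have a2 : s + d ≤ ℓ := by linarith [hs.2]
      have e1 := cutIntegral_inside hs.1 a1 a2 j (hΨD d)
      have e2 := cutIntegral_outside hs.1 a1 a2 j (g := fun v => Ψ (ℓ - d) (s :: v))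
        ((hΨD _).comp (measurable_list_cons measurable_const measurable_id))
      rw [add_sub_cancel_left] at e1 e2
      rw [← e1, ← e2, ← cutIntegral_add]
      · simp only [hGdef, children, add_sub_cancel_left]
      · exact (hΨD d).comp (measurable_inside measurable_const measurable_const measurable_id)
    have hm : ∀ i, Measurable fun s => cutIntegral i (ℓ - d) fun v => Ψ (ℓ - d) (s :: v) := fun i =>
      measurable_cutIntegral i (γ := ℝ) (ℓ := fun _ => ℓ - d) measurable_const
        (H := fun s v => Ψ (ℓ - d) (s :: v))
        ((hΨD _).comp (measurable_list_cons (by fun_prop) (by fun_prop)))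
    rw [setLIntegral_congr_fun measurableSet_Ico e, lintegral_add_left measurable_const,
      lintegral_const, Measure.restrict_apply_univ, Real.volume_Ico, sub_zero, lintegral_finsetSum _
        (fun i _ => ((hm i).const_mul _).const_mul _), Finset.sum_mul, ← Finset.sum_add_distrib]
    refine Finset.sum_le_sum fun i _ => ?_
    rw [lintegral_const_mul _ ((hm i).const_mul _), lintegral_const_mul _ (hm i), mul_assoc,
      ← mul_add]
    refine mul_le_mul_right (add_le_add ?_ ?_) _
    · calc _ ≤ ENNReal.ofReal (ℓ - d) ^ (j - i) * (ENNReal.ofReal d ^ i * q i) *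
            ENNReal.ofReal (ℓ - d) := by gcongr; exact hq i d
        _ = _ := by rw [pow_succ]; ring
    · calc _ ≤ ENNReal.ofReal d ^ (j - i) * (ENNReal.ofReal (ℓ - d) ^ (i + 1) * q (i + 1)) := by
            gcongr; exact hq (i + 1) (ℓ - d)
        _ = _ := by ring
  have h3 : ∫⁻ d in Ico 0 ℓ, ∫⁻ s in Ico 0 (ℓ - d), G s (s + d)
      ≤ L ^ (j + 2) * (ENNReal.ofReal (((j + 1 : ℝ) * (j + 2))⁻¹) *
        ((j + 1) * ∑ i ∈ Finset.range (j + 2), q i)) := by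
    refine (setLIntegral_mono' measurableSet_Ico h2).trans (le_of_eq ?_)
    rw [lintegral_finsetSum _ (fun i _ => by fun_prop), ← sum_weights, Finset.mul_sum,
      Finset.mul_sum]
    refine Finset.sum_congr rfl fun i hi => ?_
    have hij : i ≤ j := by have := Finset.mem_range.1 hi; omega
    rw [lintegral_const_mul _ (by fun_prop), lintegral_add_left (by fun_prop),
      lintegral_mul_const _ (by fun_prop), lintegral_mul_const _ (by fun_prop),
      lintegral_pow_mul_sub_pow hℓ.le, lintegral_pow_mul_sub_pow hℓ.le,
      show i + (j - i + 1) + 1 = j + 2 by omega, show j - i + (i + 1) + 1 = j + 2 by omega]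
    have b1 := choose_mul_beta_left hij
    have b2 := choose_mul_beta_right hij
    calc _ = L ^ (j + 2) * (((j.choose i : ℝ≥0∞) *
        ENNReal.ofReal ((i.factorial * (j - i + 1).factorial : ℝ) / (j + 2).factorial)) * q i
        + ((j.choose i : ℝ≥0∞) *
        ENNReal.ofReal (((j - i).factorial * (i + 1).factorial : ℝ) / (j + 2).factorial))
          * q (i + 1)) := by ring
      _ = _ := by rw [b1, b2]; ring
  rw [h1]
  have hcoef : 2 * (ENNReal.ofReal (((j + 1 : ℝ) * (j + 2))⁻¹) * (j + 1)) =
      (2 / (j + 2) : ℝ≥0∞) := by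
    have hj1 : ((j : ℝ≥0∞) + 1) = ENNReal.ofReal (j + 1) := by
      rw [ENNReal.ofReal_add (by positivity) (by positivity)]; simp
    have hj2 : ((j : ℝ≥0∞) + 2) = ENNReal.ofReal (j + 2) := by
      rw [ENNReal.ofReal_add (by positivity) (by positivity)]; simp
    rw [hj1, hj2, ← ENNReal.ofReal_mul (by positivity), div_eq_mul_inv,
      ← ENNReal.ofReal_inv_of_pos (by positivity)]
    congr 2
    have : (j : ℝ) + 1 ≠ 0 := by positivity
    field_simp
  calc _ ≤ L⁻¹ ^ 2 * (2 * (L ^ (j + 2) * (ENNReal.ofReal (((j + 1 : ℝ) * (j + 2))⁻¹) *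
        ((j + 1) * ∑ i ∈ Finset.range (j + 2), q i)))) := by
        gcongr
        exact (lintegral_min_max_le hG).trans (by gcongr)
    _ = (L⁻¹ * L) ^ 2 * L ^ j * ((2 * (ENNReal.ofReal (((j + 1 : ℝ) * (j + 2))⁻¹) * (j + 1))) *
        ∑ i ∈ Finset.range (j + 2), q i) := by ring
    _ = _ := by rw [ENNReal.inv_mul_cancel hL0 hLtop, hcoef]; ring

/-- Averaging `survival` over uniform cuts gives at most `typeBound`. -/
lemma cutIntegral_survival_le (w : List Bool) (j : ℕ) (ℓ : ℝ) :
    cutIntegral j ℓ (survival w ℓ) ≤ ENNReal.ofReal ℓ ^ j * typeBound w j := by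
  induction w generalizing j ℓ with
  | nil =>
    change cutIntegral j ℓ (fun _ => 1) ≤ _
    rw [cutIntegral_const]; simp [typeBound]
  | cons f w ih =>
    rw [typeBound]
    split_ifs with hf
    · rw [mul_zero, ← mul_zero (ENNReal.ofReal ℓ ^ j), ← cutIntegral_const]
      refine cutIntegral_mono j ℓ fun l hl => ?_
      rw [survival, if_pos (by rwa [hl])]
    · rcases le_or_gt ℓ 0 with hℓ | hℓ
      · cases j with
        | zero =>
          have : survival (f :: w) ℓ [] ≤ 0 := by
            rw [survival]
            split_ifs
            · rfl
            · refine (min_le_right _ _).trans ?_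
              simp [splitMean, Ico_eq_empty (not_lt.2 hℓ)]
          rw [cutIntegral, nonpos_iff_eq_zero.1 this]
          exact zero_le
        | succ j => simp [cutIntegral, Ico_eq_empty (not_lt.2 hℓ)]
      · rw [mul_min]
        refine le_min ?_ ?_
        · rw [← cutIntegral_const]
          refine cutIntegral_mono j ℓ fun l hl => ?_
          rw [survival]; split_ifs <;> simp
        · refine le_trans (cutIntegral_mono j ℓ fun l hl => ?_)
            (cutIntegral_splitMean_le (measurable_survival w) ih hℓ j)
          rw [survival]; split_ifs <;> simp

/-! ### Angles -/

/-- The point of the circle with angle `t`, in turns. -/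
def circ (t : ℝ) : Circle := Circle.exp (2 * Real.pi * t)

/-- The angle of a point of the circle, in turns, chosen in `[0, 1)`. -/
def ang (z : Circle) : ℝ := Int.fract (Complex.arg (z : ℂ) / (2 * Real.pi))

lemma ang_mem (z : Circle) : ang z ∈ Ico (0 : ℝ) 1 := ⟨Int.fract_nonneg _, Int.fract_lt_one _⟩

lemma circ_ang (z : Circle) : circ (ang z) = z := by
  have hpi : (2 * Real.pi) ≠ 0 := by positivity
  have : 2 * Real.pi * ang z
      = Complex.arg (z : ℂ) - (⌊Complex.arg (z : ℂ) / (2 * Real.pi)⌋ : ℤ) * (2 * Real.pi) := by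
    rw [ang, ← Int.self_sub_floor]; field_simp
  rw [circ, this, Circle.periodic_exp.sub_int_mul_eq, Circle.exp_arg]

lemma circ_injOn : InjOn circ (Ico 0 1) := by
  intro s hs t ht h
  have hpi : (0 : ℝ) < 2 * Real.pi := by positivity
  obtain ⟨m, hm⟩ := Circle.exp_eq_exp.1 h
  have h1 : s = t + m := by
    have : 2 * Real.pi * s = 2 * Real.pi * (t + m) := by rw [hm]; ring
    exact mul_left_cancel₀ hpi.ne' this
  have h2 : m = 0 := by
    have a : (m : ℝ) < 1 := by linarith [hs.2, ht.1]
    have b : (-1 : ℝ) < m := by linarith [hs.1, ht.2]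
    have a' : m < 1 := by exact_mod_cast a
    have b' : -1 < m := by exact_mod_cast b
    omega
  simp [h1, h2]

lemma ang_circ {t : ℝ} (ht : t ∈ Ico (0 : ℝ) 1) : ang (circ t) = t :=
  circ_injOn (ang_mem _) ht (circ_ang _)

lemma continuous_circ : Continuous circ := by unfold circ; fun_prop

lemma measurable_ang : Measurable ang :=
  measurable_fract.comp ((Complex.measurable_arg.comp
    (by fun_prop : Continuous fun z : Circle => (z : ℂ)).measurable).div_const _)

/-- The smaller angle of the feet. -/
def lo (p : Circle × Circle) : ℝ := min (ang p.1) (ang p.2)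

/-- The larger angle of the feet. -/
def hi (p : Circle × Circle) : ℝ := max (ang p.1) (ang p.2)

lemma lo_le_hi (p : Circle × Circle) : lo p ≤ hi p := min_le_max

lemma measurable_lo : Measurable lo :=
  (measurable_ang.comp measurable_fst).min (measurable_ang.comp measurable_snd)

lemma measurable_hi : Measurable hi :=
  (measurable_ang.comp measurable_fst).max (measurable_ang.comp measurable_snd)

/-! ### Sides -/

/-- The position of `z` with respect to the line through the feet of `p`: an affine function of `z`
that vanishes on this line. -/
def side (p : Circle × Circle) (z : ℂ) : ℝ :=
  (z.im - (p.1 : ℂ).im) * ((p.2 : ℂ).re - (p.1 : ℂ).re)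
    - (z.re - (p.1 : ℂ).re) * ((p.2 : ℂ).im - (p.1 : ℂ).im)

lemma continuous_side (p : Circle × Circle) : Continuous (side p) := by unfold side; fun_prop

lemma side_combo (p : Circle × Circle) (z w : ℂ) {a b : ℝ} (hab : a + b = 1) :
    side p (a • z + b • w) = a * side p z + b * side p w := by
  obtain rfl : b = 1 - a := by linarith
  simp [side]; ring

lemma side_fst (p : Circle × Circle) : side p p.1 = 0 := by simp [side]

lemma side_snd (p : Circle × Circle) : side p p.2 = 0 := by simp [side]; ring

lemma coe_mem_disk (z : Circle) : (z : ℂ) ∈ disk := by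
  rw [disk, mem_closedBall_zero_iff, Circle.norm_coe]

lemma mem_chord_iff {p : Circle × Circle} (hp : p.1 ≠ p.2) {z : ℂ} (hz : z ∈ disk) :
    z ∈ chord s(p.1, p.2) ↔ side p z = 0 := by
  change z ∈ segment ℝ (p.1 : ℂ) (p.2 : ℂ) ↔ _
  constructor
  · rintro ⟨a, b, -, -, hab, rfl⟩
    rw [side_combo p _ _ hab, side_fst, side_snd]; simp
  · intro h
    obtain ⟨x, y⟩ := p
    simp only [side] at h hp ⊢
    have hx : (x : ℂ).re ^ 2 + (x : ℂ).im ^ 2 = 1 := by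
      have := Circle.normSq_coe x; rw [Complex.normSq_apply] at this; linarith
    have hy : (y : ℂ).re ^ 2 + (y : ℂ).im ^ 2 = 1 := by
      have := Circle.normSq_coe y; rw [Complex.normSq_apply] at this; linarith
    have hz' : z.re ^ 2 + z.im ^ 2 ≤ 1 := by
      have h1 : ‖z‖ ≤ 1 := by simpa [disk] using hz
      have h2 : ‖z‖ ^ 2 ≤ 1 := by nlinarith [norm_nonneg z]
      rw [← Complex.normSq_eq_norm_sq, Complex.normSq_apply] at h2
      linarith
    set x1 := (x : ℂ).re
    set x2 := (x : ℂ).im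
    set y1 := (y : ℂ).re
    set y2 := (y : ℂ).im
    set N := (y1 - x1) ^ 2 + (y2 - x2) ^ 2 with hN
    have hNpos : 0 < N := by
      rcases (by positivity : 0 ≤ N).lt_or_eq with h | h
      · exact h
      · exfalso; apply hp
        have e1 : y1 - x1 = 0 := by nlinarith [sq_nonneg (y1 - x1), sq_nonneg (y2 - x2)]
        have e2 : y2 - x2 = 0 := by nlinarith [sq_nonneg (y1 - x1), sq_nonneg (y2 - x2)]
        exact Subtype.ext (Complex.ext (by linarith) (by linarith))
    set s := ((z.re - x1) * (y1 - x1) + (z.im - x2) * (y2 - x2)) / N with hs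
    have e1 : z.re = x1 + s * (y1 - x1) := by
      rw [hs]; field_simp; rw [hN]; linear_combination (-(y2 - x2)) * h
    have e2 : z.im = x2 + s * (y2 - x2) := by
      rw [hs]; field_simp; rw [hN]; linear_combination (y1 - x1) * h
    have h3 : 0 ≤ s * (1 - s) * N := by
      have : z.re ^ 2 + z.im ^ 2 = 1 - s * (1 - s) * N := by
        rw [e1, e2, hN]; linear_combination (1 - s) * hx + s * hy
      linarith
    have h4 : 0 ≤ s * (1 - s) := by
      by_contra hneg
      exact absurd h3 (not_le.2 (mul_neg_of_neg_of_pos (not_le.1 hneg) hNpos))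
    have h5 : 0 ≤ s := by by_contra h; nlinarith
    have h6 : 0 ≤ 1 - s := by by_contra h; nlinarith
    refine ⟨1 - s, s, h6, h5, by ring, Complex.ext ?_ ?_⟩
    · simp; rw [e1]; ring
    · simp; rw [e2]; ring

/-- On the circle, the position with respect to a chord is a product of three sines, whose signs are
given by the order of the angles. -/
lemma side_circ (a b t : ℝ) : side (circ a, circ b) (circ t)
    = 4 * Real.sin (Real.pi * (b - a)) *
      (Real.sin (Real.pi * (t - a)) * Real.sin (Real.pi * (t - b))) := by
  have hre : ∀ r, ((circ r : Circle) : ℂ).re = Real.cos (2 * (Real.pi * r)) := by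
    intro r
    rw [circ, Circle.coe_exp, Complex.exp_ofReal_mul_I_re, mul_assoc]
  have him : ∀ r, ((circ r : Circle) : ℂ).im = Real.sin (2 * (Real.pi * r)) := by
    intro r
    rw [circ, Circle.coe_exp, Complex.exp_ofReal_mul_I_im, mul_assoc]
  simp only [side, hre, him, mul_sub, Real.sin_sub, Real.cos_two_mul, Real.sin_two_mul]
  have h1 := Real.sin_sq_add_cos_sq (Real.pi * a)
  have h2 := Real.sin_sq_add_cos_sq (Real.pi * b)
  have h3 := Real.sin_sq_add_cos_sq (Real.pi * t)
  generalize Real.sin (Real.pi * a) = sa at *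
  generalize Real.cos (Real.pi * a) = ca at *
  generalize Real.sin (Real.pi * b) = sb at *
  generalize Real.cos (Real.pi * b) = cb at *
  generalize Real.sin (Real.pi * t) = st at *
  generalize Real.cos (Real.pi * t) = ct at *
  have h1' : sa ^ 2 = 1 - ca ^ 2 := by linarith
  have h2' : sb ^ 2 = 1 - cb ^ 2 := by linarith
  have h3' : st ^ 2 = 1 - ct ^ 2 := by linarith
  ring_nf
  simp only [h1', h2', h3']
  ring

/-- Two points of the circle are strictly on the same side of a chord iff their angles are both
strictly between those of the feet, or both outside. -/
lemma side_circ_sign {p : Circle × Circle} (hp : p.1 ≠ p.2) {s t : ℝ} (hs : s ∈ Ico (0 : ℝ) 1)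
    (ht : t ∈ Ico (0 : ℝ) 1) : 0 < side p (circ s) * side p (circ t) ↔
      (s ∈ Ioo (lo p) (hi p) ∧ t ∈ Ioo (lo p) (hi p)) ∨
        (s ∉ Icc (lo p) (hi p) ∧ t ∉ Icc (lo p) (hi p)) := by
  have key : ∀ a ∈ Ico (0 : ℝ) 1, ∀ b ∈ Ico (0 : ℝ) 1, a < b →
      (0 < side (circ a, circ b) (circ s) * side (circ a, circ b) (circ t) ↔
        (s ∈ Ioo a b ∧ t ∈ Ioo a b) ∨ (s ∉ Icc a b ∧ t ∉ Icc a b)) := by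
    intro a ha b hb hab
    have pos : ∀ r : ℝ, 0 < r → r < 1 → 0 < Real.sin (Real.pi * r) := fun r h0 h1 =>
      Real.sin_pos_of_pos_of_lt_pi (by positivity) (by nlinarith [Real.pi_pos])
    have neg : ∀ r : ℝ, r < 0 → -1 < r → Real.sin (Real.pi * r) < 0 := fun r h0 h1 => by
      have := pos (-r) (by linarith) (by linarith)
      rw [mul_neg, Real.sin_neg] at this; linarith
    have hC : 0 < 4 * Real.sin (Real.pi * (b - a)) := by
      have := pos (b - a) (by linarith) (by linarith [ha.1, hb.2]); linarith
    have h0 : ∀ r ∈ Ico (0 : ℝ) 1, (side (circ a, circ b) (circ r) < 0 ∧ r ∈ Ioo a b) ∨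
        (side (circ a, circ b) (circ r) = 0 ∧ r ∉ Ioo a b ∧ r ∈ Icc a b) ∨
        (0 < side (circ a, circ b) (circ r) ∧ r ∉ Icc a b) := by
      intro r hr
      rw [side_circ]
      rcases lt_trichotomy r a with h | h | h
      · refine Or.inr (Or.inr ⟨mul_pos hC (mul_pos_of_neg_of_neg ?_ ?_), fun h' => ?_⟩)
        · exact neg _ (by linarith) (by linarith [hr.1, ha.2])
        · exact neg _ (by linarith) (by linarith [hr.1, hb.2])
        · linarith [h'.1]
      · refine Or.inr (Or.inl ⟨by simp [h], fun h' => ?_, ⟨h.ge, by linarith⟩⟩)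
        linarith [h'.1]
      · rcases lt_trichotomy r b with h2 | h2 | h2
        · refine Or.inl ⟨mul_neg_of_pos_of_neg hC (mul_neg_of_pos_of_neg ?_ ?_), h, h2⟩
          · exact pos _ (by linarith) (by linarith [hr.2, ha.1])
          · exact neg _ (by linarith) (by linarith [hr.1, hb.2])
        · refine Or.inr (Or.inl ⟨by simp [h2], fun h' => ?_, ⟨h.le, h2.le⟩⟩)
          linarith [h'.2]
        · refine Or.inr (Or.inr ⟨mul_pos hC (mul_pos ?_ ?_), fun h' => ?_⟩)
          · exact pos _ (by linarith) (by linarith [hr.2, ha.1])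
          · exact pos _ (by linarith) (by linarith [hr.2, hb.1])
          · linarith [h'.2]
    rcases h0 s hs with ⟨h1, h1'⟩ | ⟨h1, h1', h1''⟩ | ⟨h1, h1'⟩ <;>
      rcases h0 t ht with ⟨h2, h2'⟩ | ⟨h2, h2', h2''⟩ | ⟨h2, h2'⟩
    · exact iff_of_true (mul_pos_of_neg_of_neg h1 h2) (Or.inl ⟨h1', h2'⟩)
    · exact iff_of_false (by simp [h2]) (by tauto)
    · refine iff_of_false (not_lt.2 (mul_neg_of_neg_of_pos h1 h2).le) ?_
      have := Ioo_subset_Icc_self h1'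
      have := fun h => h2' (Ioo_subset_Icc_self h)
      tauto
    · exact iff_of_false (by simp [h1]) (by tauto)
    · exact iff_of_false (by simp [h1]) (by tauto)
    · exact iff_of_false (by simp [h1]) (by tauto)
    · refine iff_of_false (not_lt.2 (mul_neg_of_pos_of_neg h1 h2).le) ?_
      have := Ioo_subset_Icc_self h2'
      have := fun h => h1' (Ioo_subset_Icc_self h)
      tauto
    · exact iff_of_false (by simp [h2]) (by tauto)
    · exact iff_of_true (mul_pos h1 h2) (Or.inr ⟨h1', h2'⟩)
  have hne : ang p.1 ≠ ang p.2 := fun h => hp (by rw [← circ_ang p.1, h, circ_ang])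
  have hp' : p = (circ (ang p.1), circ (ang p.2)) := by simp [circ_ang]
  rcases hne.lt_or_gt with h | h
  · rw [lo, hi, min_eq_left h.le, max_eq_right h.le]
    conv_lhs => rw [hp']
    exact key _ (ang_mem _) _ (ang_mem _) h
  · rw [lo, hi, min_eq_right h.le, max_eq_left h.le]
    have hsw : ∀ z, side p z = - side (p.2, p.1) z := by intro z; simp [side]; ring
    rw [hsw, hsw, neg_mul_neg]
    have := key _ (ang_mem p.2) _ (ang_mem p.1) h
    rwa [circ_ang, circ_ang] at this

/-! ### Fragments as cells -/

/-- The chords `c 0, …, c (n - 1)`. -/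
def chords (c : ℕ → Circle × Circle) (n : ℕ) : Set (Sym2 Circle) :=
  {p | ∃ i < n, p = s((c i).1, (c i).2)}

/-- The points of the disk that are strictly on the same side as `z` of each of the first `n`
chords. It is empty if `z` lies on the line of one of these chords. -/
def cell (c : ℕ → Circle × Circle) (n : ℕ) (z : ℂ) : Set ℂ :=
  {w | w ∈ disk ∧ ∀ i < n, 0 < side (c i) z * side (c i) w}

lemma mul_pos_trans {a b d : ℝ} (h1 : 0 < a * b) (h2 : 0 < b * d) : 0 < a * d := by
  have hb : b ≠ 0 := by rintro rfl; simp at h1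
  have : 0 < (a * d) * (b * b) := by
    calc 0 < (a * b) * (b * d) := mul_pos h1 h2
      _ = _ := by ring
  exact pos_of_mul_pos_left this (mul_self_nonneg b)

lemma cell_eq {c : ℕ → Circle × Circle} {n : ℕ} {z w : ℂ} (h : w ∈ cell c n z) :
    cell c n w = cell c n z := by
  ext u
  refine and_congr_right fun _ => forall₂_congr fun i hi => ?_
  have h1 := h.2 i hi
  exact ⟨fun h2 => mul_pos_trans h1 h2, fun h2 => mul_pos_trans (by rwa [mul_comm]) h2⟩

lemma cell_eq_of_mem {c : ℕ → Circle × Circle} {n : ℕ} {z z' w : ℂ} (h : w ∈ cell c n z)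
    (h' : w ∈ cell c n z') : cell c n z = cell c n z' := by
  rw [← cell_eq h, cell_eq h']

lemma convex_cell (c : ℕ → Circle × Circle) (n : ℕ) (z : ℂ) : Convex ℝ (cell c n z) := by
  intro u hu w hw a b ha hb hab
  refine ⟨convex_closedBall 0 1 hu.1 hw.1 ha hb hab, fun i hi => ?_⟩
  rw [side_combo _ _ _ hab]
  have h1 := hu.2 i hi
  have h2 := hw.2 i hi
  have : side (c i) z * (a * side (c i) u + b * side (c i) w)
      = a * (side (c i) z * side (c i) u) + b * (side (c i) z * side (c i) w) := by ring
  rw [this]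
  rcases ha.lt_or_eq with h | h
  · have := mul_pos h h1
    have := mul_nonneg hb h2.le
    linarith
  · have hb1 : b = 1 := by linarith
    rw [← h, hb1]; simpa using h2

lemma measurableSet_cell (c : ℕ → Circle × Circle) (n : ℕ) (z : ℂ) :
    MeasurableSet (cell c n z) := by
  have : cell c n z = disk ∩ ⋂ i, ⋂ (_ : i < n), {w | 0 < side (c i) z * side (c i) w} := by
    ext w; simp [cell]
  rw [this]
  refine Metric.isClosed_closedBall.measurableSet.inter
    (MeasurableSet.iInter fun i => MeasurableSet.iInter fun _ => ?_)
  exact (isOpen_lt continuous_const (continuous_const.mul (continuous_side _))).measurableSet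

lemma side_same_sign {p : Circle × Circle} {K : Set ℂ} (hK : IsPreconnected K)
    (h0 : ∀ w ∈ K, side p w ≠ 0) {z w : ℂ} (hz : z ∈ K) (hw : w ∈ K) :
    0 < side p z * side p w := by
  by_contra h
  have hc := (hK.image (side p) (continuous_side p).continuousOn).ordConnected
  have hmem : (0 : ℝ) ∈ side p '' K := by
    rcases le_total (side p z) 0 with h1 | h1 <;> rcases le_total (side p w) 0 with h2 | h2
    · exact absurd (mul_pos_of_neg_of_neg (h1.lt_of_ne (h0 z hz)) (h2.lt_of_ne (h0 w hw))) h
    · exact hc.out (mem_image_of_mem _ hz) (mem_image_of_mem _ hw) ⟨h1, h2⟩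
    · exact hc.out (mem_image_of_mem _ hw) (mem_image_of_mem _ hz) ⟨h2, h1⟩
    · exact absurd (mul_pos (h1.lt_of_ne (h0 z hz).symm) (h2.lt_of_ne (h0 w hw).symm)) h
  obtain ⟨u, hu, hu0⟩ := hmem
  exact h0 u hu hu0

/-- The fragments are the nonempty cells. -/
lemma mem_fragments_iff {c : ℕ → Circle × Circle} {n : ℕ} (hc : ∀ i < n, (c i).1 ≠ (c i).2)
    {R : Set ℂ} : R ∈ fragments (chords c n) ↔ ∃ z ∈ cell c n z, cell c n z = R := by
  have hreg : ∀ w, w ∈ disk \ ⋃ p ∈ chords c n, chord p ↔ w ∈ cell c n w := by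
    intro w
    simp only [Set.mem_sdiff, mem_iUnion, not_exists, cell, mem_ofPred_eq]
    refine and_congr_right fun hw => ⟨fun h i hi => ?_, ?_⟩
    · refine mul_self_pos.2 fun h0 => h s((c i).1, (c i).2) ⟨i, hi, rfl⟩ ?_
      exact (mem_chord_iff (hc i hi) hw).2 h0
    · rintro h p ⟨i, hi, rfl⟩ hm
      have := h i hi
      rw [(mem_chord_iff (hc i hi) hw).1 hm] at this
      simp at this
  have hcomp : ∀ z ∈ cell c n z, connectedComponentIn (disk \ ⋃ p ∈ chords c n, chord p) z
      = cell c n z := by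
    intro z hz
    refine Subset.antisymm (fun w hw => ?_) ?_
    · have hzm := mem_connectedComponentIn ((hreg z).2 hz)
      have hsub := connectedComponentIn_subset (disk \ ⋃ p ∈ chords c n, chord p) z
      refine ⟨(hsub hw).1, fun i hi => ?_⟩
      refine side_same_sign isPreconnected_connectedComponentIn (fun u hu h0 => ?_) hzm hw
      have := ((hreg u).1 (hsub hu)).2 i hi
      rw [h0] at this; simp at this
    · refine (convex_cell c n z).isPreconnected.subset_connectedComponentIn hz fun w hw => ?_
      rw [hreg, cell_eq hw]; exact hw
  constructor
  · rintro ⟨z, hz, rfl⟩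
    have hz' := (hreg z).1 hz
    exact ⟨z, hz', (hcomp z hz').symm⟩
  · rintro ⟨z, hz, rfl⟩
    exact ⟨z, (hreg z).2 hz, hcomp z hz⟩

/-- A sequence of chords is good if none of them is degenerate and if the two feet of each of them
are strictly on the same side of all the previous ones. -/
def IsGood (c : ℕ → Circle × Circle) : Prop :=
  ∀ n, (c n).1 ≠ (c n).2 ∧ ∀ i < n, 0 < side (c i) (c n).1 * side (c i) (c n).2

lemma IsGood.mem_fragments_iff {c : ℕ → Circle × Circle} (hc : IsGood c) {n : ℕ} {R : Set ℂ} :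
    R ∈ fragments (chords c n) ↔ ∃ z ∈ cell c n z, cell c n z = R :=
  Figela.mem_fragments_iff fun i _ => (hc i).1

/-- The angles, in `[0, 1)`, of the points of `R` on the circle. -/
def angles (R : Set ℂ) : Set ℝ := {t | t ∈ Ico (0 : ℝ) 1 ∧ (circ t : ℂ) ∈ R}

lemma ang_mem_angles {R : Set ℂ} {z : Circle} : ang z ∈ angles R ↔ (z : ℂ) ∈ R := by
  simp only [angles, mem_ofPred_eq, circ_ang, ang_mem, true_and]

lemma cell_succ {c : ℕ → Circle × Circle} {n : ℕ} (z : ℂ) :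
    cell c (n + 1) z = {w | w ∈ cell c n z ∧ 0 < side (c n) z * side (c n) w} := by
  ext w
  simp only [cell, mem_ofPred_eq, and_assoc, Nat.forall_lt_succ_right]

/-- A fragment survives a chord whose feet are not both in it. -/
lemma mem_fragments_succ_of_not_mem {c : ℕ → Circle × Circle} (hc : IsGood c) {n : ℕ} {R : Set ℂ}
    (hR : R ∈ fragments (chords c n)) (h : ¬ (((c n).1 : ℂ) ∈ R ∧ ((c n).2 : ℂ) ∈ R)) :
    R ∈ fragments (chords c (n + 1)) := by
  obtain ⟨z, hz, rfl⟩ := hc.mem_fragments_iff.1 hR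
  have h0 : ∀ w ∈ cell c n z, side (c n) w ≠ 0 := by
    intro w hw hs
    have hch : w ∈ segment ℝ ((c n).1 : ℂ) ((c n).2 : ℂ) := (mem_chord_iff (hc n).1 hw.1).2 hs
    have h2 : ((c n).2 : ℂ) ∈ cell c n (c n).1 := ⟨coe_mem_disk _, (hc n).2⟩
    have h1 : ((c n).1 : ℂ) ∈ cell c n (c n).1 :=
      ⟨coe_mem_disk _, fun i hi => by
        have := (hc n).2 i hi
        exact mul_pos_trans this (by rwa [mul_comm])⟩
    have := (convex_cell c n (c n).1).segment_subset h1 h2 hch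
    rw [← cell_eq_of_mem this hw] at h
    exact h ⟨h1, h2⟩
  have : cell c (n + 1) z = cell c n z := by
    rw [cell_succ]
    refine Subset.antisymm (fun w hw => hw.1) fun w hw => ⟨hw, ?_⟩
    exact side_same_sign (convex_cell c n z).isPreconnected h0 hz hw
  exact hc.mem_fragments_iff.2 ⟨z, this ▸ hz, this⟩

/-- Near any of its points, a fragment contains the angles slightly larger. The restriction to one
side comes from the choice of `0` as the origin of the angles. -/
lemma right_open_angles {c : ℕ → Circle × Circle} {n : ℕ} {z : ℂ} {t : ℝ}
    (ht : t ∈ angles (cell c n z)) : ∃ ε > 0, Ico t (t + ε) ⊆ angles (cell c n z) := by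
  have hopen : IsOpen (⋂ i ∈ Finset.range n, {r : ℝ | 0 < side (c i) z * side (c i) (circ r)}) :=
    isOpen_biInter_finset fun i _ => isOpen_lt continuous_const
      (continuous_const.mul ((continuous_side _).comp
        (continuous_subtype_val.comp continuous_circ)))
  have hmem : t ∈ ⋂ i ∈ Finset.range n, {r : ℝ | 0 < side (c i) z * side (c i) (circ r)} := by
    simp only [mem_iInter, Finset.mem_range]
    exact ht.2.2
  obtain ⟨ε, hε, hsub⟩ := Metric.isOpen_iff.1 hopen t hmem
  refine ⟨min ε (1 - t), lt_min hε (by linarith [ht.1.2]), fun r hr => ?_⟩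
  have h1 : r < t + ε := hr.2.trans_le (by gcongr; exact min_le_left _ _)
  have h2 : r < 1 := hr.2.trans_le (by linarith [min_le_right ε (1 - t)])
  refine ⟨⟨ht.1.1.trans hr.1, h2⟩, coe_mem_disk _, ?_⟩
  have := hsub (show r ∈ Metric.ball t ε by
    rw [Metric.mem_ball, Real.dist_eq, abs_of_nonneg (by linarith [hr.1])]; linarith)
  simpa only [mem_iInter, Finset.mem_range, mem_ofPred_eq] using this

/-- `A` is the set of angles of a fragment of the first `n` chords. -/
def IsPiece (c : ℕ → Circle × Circle) (n : ℕ) (A : Set ℝ) : Prop :=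
  ∃ R ∈ fragments (chords c n), angles R = A

/-- The chord `p` has both feet in the set of angles `A`. -/
def Hits (p : Circle × Circle) (A : Set ℝ) : Prop := ang p.1 ∈ A ∧ ang p.2 ∈ A

lemma Hits.lo_mem {p : Circle × Circle} {A : Set ℝ} (h : Hits p A) : lo p ∈ A := by
  rcases min_choice (ang p.1) (ang p.2) with e | e <;> rw [lo, e]
  exacts [h.1, h.2]

lemma Hits.hi_mem {p : Circle × Circle} {A : Set ℝ} (h : Hits p A) : hi p ∈ A := by
  rcases max_choice (ang p.1) (ang p.2) with e | e <;> rw [hi, e]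
  exacts [h.1, h.2]

lemma lo_lt_hi {p : Circle × Circle} (hp : p.1 ≠ p.2) : lo p < hi p := by
  have hne : ang p.1 ≠ ang p.2 := fun h => hp (by rw [← circ_ang p.1, h, circ_ang])
  exact min_lt_max.2 hne

lemma hits_angles {p : Circle × Circle} {R : Set ℂ} :
    Hits p (angles R) ↔ (p.1 : ℂ) ∈ R ∧ (p.2 : ℂ) ∈ R := by
  rw [Hits, ang_mem_angles, ang_mem_angles]

lemma disk_mem_fragments (c : ℕ → Circle × Circle) : disk ∈ fragments (chords c 0) :=
  (mem_fragments_iff (by simp)).2 ⟨0, by simp [cell, disk], by ext w; simp [cell]⟩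

lemma angles_disk : angles disk = Ico 0 1 := by
  ext t; simp only [angles, mem_ofPred_eq, coe_mem_disk, and_true]

lemma isPiece_zero (c : ℕ → Circle × Circle) : IsPiece c 0 (Ico 0 1) :=
  ⟨disk, disk_mem_fragments c, angles_disk⟩

lemma IsPiece.succ {c : ℕ → Circle × Circle} (hc : IsGood c) {n : ℕ} {A : Set ℝ}
    (hA : IsPiece c n A) (h : ¬ Hits (c n) A) : IsPiece c (n + 1) A := by
  obtain ⟨R, hR, rfl⟩ := hA
  rw [hits_angles] at h
  exact ⟨R, mem_fragments_succ_of_not_mem hc hR h, rfl⟩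

lemma angles_cell_succ {c : ℕ → Circle × Circle} (hc : IsGood c) {n : ℕ} {t : ℝ}
    (ht : t ∈ Ico (0 : ℝ) 1) :
    (t ∈ Ioo (lo (c n)) (hi (c n)) →
      angles (cell c (n + 1) (circ t)) = angles (cell c n (circ t)) ∩ Ioo (lo (c n)) (hi (c n))) ∧
    (t ∉ Icc (lo (c n)) (hi (c n)) →
      angles (cell c (n + 1) (circ t)) =
        angles (cell c n (circ t)) \ Icc (lo (c n)) (hi (c n))) := by
  have h : ∀ r, r ∈ angles (cell c (n + 1) (circ t)) ↔ r ∈ angles (cell c n (circ t)) ∧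
      0 < side (c n) (circ t) * side (c n) (circ r) := by
    intro r
    rw [cell_succ]
    simp only [angles, mem_ofPred_eq, and_assoc]
  constructor
  · intro hin
    ext r
    rw [h, mem_inter_iff]
    refine and_congr_right fun hr => ?_
    rw [side_circ_sign (hc n).1 ht hr.1]
    have := Ioo_subset_Icc_self hin
    tauto
  · intro hout
    ext r
    rw [h, Set.mem_sdiff]
    refine and_congr_right fun hr => ?_
    rw [side_circ_sign (hc n).1 ht hr.1]
    have := fun h => hout (Ioo_subset_Icc_self h)
    tauto

/-- A chord with both feet in a fragment leaves points of the fragment on both of its sides. -/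
lemma exists_mem_pieces {c : ℕ → Circle × Circle} (hc : IsGood c) {n : ℕ} {z : ℂ}
    (h : Hits (c n) (angles (cell c n z))) :
    (∃ t ∈ angles (cell c n z), t ∈ Ioo (lo (c n)) (hi (c n))) ∧
      ∃ t ∈ angles (cell c n z), t ∉ Icc (lo (c n)) (hi (c n)) := by
  have hlt := lo_lt_hi (hc n).1
  constructor
  · obtain ⟨ε, hε, hsub⟩ := right_open_angles h.lo_mem
    obtain ⟨t, ht1, ht2⟩ := exists_between (lt_min hlt (show lo (c n) < lo (c n) + ε by linarith))
    exact ⟨t, hsub ⟨ht1.le, ht2.trans_le (min_le_right _ _)⟩, ht1, ht2.trans_le (min_le_left _ _)⟩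
  · obtain ⟨ε, hε, hsub⟩ := right_open_angles h.hi_mem
    obtain ⟨t, ht1, ht2⟩ := exists_between (show hi (c n) < hi (c n) + ε by linarith)
    exact ⟨t, hsub ⟨ht1.le, ht2⟩, fun h => absurd h.2 (not_le.2 ht1)⟩

/-- A chord with both feet in a fragment splits it into the angles between the feet and the others.
-/
lemma isPiece_split {c : ℕ → Circle × Circle} (hc : IsGood c) {n : ℕ} {A : Set ℝ}
    (hA : IsPiece c n A) (h : Hits (c n) A) :
    IsPiece c (n + 1) (A ∩ Ioo (lo (c n)) (hi (c n))) ∧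
      IsPiece c (n + 1) (A \ Icc (lo (c n)) (hi (c n))) := by
  obtain ⟨R, hR, rfl⟩ := hA
  obtain ⟨z, hz, rfl⟩ := hc.mem_fragments_iff.1 hR
  have aux : ∀ t ∈ angles (cell c n z), (t ∈ Ioo (lo (c n)) (hi (c n)) ∨
      t ∉ Icc (lo (c n)) (hi (c n))) → cell c (n + 1) (circ t) ∈ fragments (chords c (n + 1)) ∧
        cell c n (circ t) = cell c n z := by
    intro t ht hor
    have e := cell_eq ht.2
    refine ⟨hc.mem_fragments_iff.2 ⟨circ t, ?_, rfl⟩, e⟩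
    rw [cell_succ]
    refine ⟨e ▸ ht.2, (side_circ_sign (hc n).1 ht.1 ht.1).2 ?_⟩
    tauto
  obtain ⟨⟨s, hs, hin⟩, t, ht, hout⟩ := exists_mem_pieces hc h
  obtain ⟨h1, h2⟩ := aux s hs (Or.inl hin)
  obtain ⟨h3, h4⟩ := aux t ht (Or.inr hout)
  exact ⟨⟨_, h1, by rw [(angles_cell_succ hc hs.1).1 hin, h2]⟩,
    _, h3, by rw [(angles_cell_succ hc ht.1).2 hout, h4]⟩

/-- The offspring of a fragment have no other sets of angles than the two of `isPiece_split`. -/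
lemma angles_of_subset {c : ℕ → Circle × Circle} (hc : IsGood c) {n : ℕ} {R R' : Set ℂ}
    (hR : R ∈ fragments (chords c n)) (hR' : R' ∈ fragments (chords c (n + 1))) (hsub : R' ⊆ R)
    (h : Hits (c n) (angles R)) :
    angles R' = angles R ∩ Ioo (lo (c n)) (hi (c n)) ∨
      angles R' = angles R \ Icc (lo (c n)) (hi (c n)) := by
  obtain ⟨z, hz, rfl⟩ := hc.mem_fragments_iff.1 hR
  obtain ⟨w, hw, rfl⟩ := hc.mem_fragments_iff.1 hR'
  have e : cell c n w = cell c n z := cell_eq (hsub hw)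
  obtain ⟨⟨s, hs, hin⟩, t, ht, hout⟩ := exists_mem_pieces hc h
  have hw0 := hw.2 n (Nat.lt_succ_self n)
  have hs0 := (side_circ_sign (hc n).1 hs.1 hs.1).2 (Or.inl ⟨hin, hin⟩)
  have ht0 := (side_circ_sign (hc n).1 ht.1 ht.1).2 (Or.inr ⟨hout, hout⟩)
  have hst : ¬ 0 < side (c n) (circ s) * side (c n) (circ t) := by
    rw [side_circ_sign (hc n).1 hs.1 ht.1]
    have := Ioo_subset_Icc_self hin
    have := fun h => hout (Ioo_subset_Icc_self h)
    tauto
  have aux : ∀ r ∈ angles (cell c n z), 0 < side (c n) w * side (c n) (circ r) →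
      cell c (n + 1) w = cell c (n + 1) (circ r) ∧ cell c n (circ r) = cell c n z := by
    intro r hr hpos
    refine ⟨(cell_eq ?_).symm, cell_eq hr.2⟩
    rw [cell_succ]
    exact ⟨e ▸ hr.2, hpos⟩
  by_cases hws : 0 < side (c n) w * side (c n) (circ s)
  · left
    obtain ⟨e1, e2⟩ := aux s hs hws
    rw [e1, (angles_cell_succ hc hs.1).1 hin, e2]
  · right
    have hwt : 0 < side (c n) w * side (c n) (circ t) := by
      have e3 : side (c n) w ≠ 0 := fun h => by simp [h] at hw0
      have e4 : side (c n) (circ s) ≠ 0 := fun h => by simp [h] at hs0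
      have e5 : side (c n) (circ t) ≠ 0 := fun h => by simp [h] at ht0
      have h1 : side (c n) w * side (c n) (circ s) < 0 :=
        lt_of_le_of_ne (not_lt.1 hws) (mul_ne_zero e3 e4)
      have h2 : side (c n) (circ s) * side (c n) (circ t) < 0 :=
        lt_of_le_of_ne (not_lt.1 hst) (mul_ne_zero e4 e5)
      have h3 : 0 < (side (c n) w * side (c n) (circ t)) *
          (side (c n) (circ s) * side (c n) (circ s)) := by
        calc 0 < (side (c n) w * side (c n) (circ s)) *
              (side (c n) (circ s) * side (c n) (circ t)) := mul_pos_of_neg_of_neg h1 h2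
          _ = _ := by ring
      exact pos_of_mul_pos_left h3 (mul_self_nonneg _)
    obtain ⟨e1, e2⟩ := aux t ht hwt
    rw [e1, (angles_cell_succ hc ht.1).2 hout, e2]

/-! ### Gluing -/

/-- The map that collapses the gaps of `A`, so that `A` is mapped to the interval from `0` to the
measure of `A`. -/
def glue (A : Set ℝ) (t : ℝ) : ℝ := volume.real (A ∩ Iio t)

lemma volume_ne_top {A : Set ℝ} (hA : A ⊆ Ico 0 1) : volume A ≠ ∞ :=
  ((measure_mono hA).trans_lt measure_Ico_lt_top).ne

lemma measureReal_inter_Ico {A : Set ℝ} (hA : A ⊆ Ico 0 1) {s t : ℝ} (hst : s ≤ t) :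
    volume.real (A ∩ Ico s t) = glue A t - glue A s := by
  have h := measureReal_inter_add_sdiff (μ := volume) (s := A ∩ Iio t) (t := Iio s)
    measurableSet_Iio (volume_ne_top (inter_subset_left.trans hA))
  have e1 : A ∩ Iio t ∩ Iio s = A ∩ Iio s := by
    ext r; simp only [mem_inter_iff, mem_Iio]
    exact ⟨fun h => ⟨h.1.1, h.2⟩, fun h => ⟨⟨h.1, h.2.trans_le hst⟩, h.2⟩⟩
  have e2 : (A ∩ Iio t) \ Iio s = A ∩ Ico s t := by
    ext r; simp only [mem_inter_iff, mem_Iio, Set.mem_sdiff, not_lt, mem_Ico]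
    tauto
  rw [e1, e2] at h
  unfold glue
  linarith

lemma glue_mono {A : Set ℝ} (hA : A ⊆ Ico 0 1) : Monotone (glue A) := fun s t hst => by
  have := measureReal_inter_Ico hA hst
  have h0 : 0 ≤ volume.real (A ∩ Ico s t) := measureReal_nonneg
  linarith

lemma glue_nonneg (A : Set ℝ) (t : ℝ) : 0 ≤ glue A t := measureReal_nonneg

lemma glue_le {A : Set ℝ} (hA : A ⊆ Ico 0 1) (t : ℝ) : glue A t ≤ volume.real A :=
  measureReal_mono inter_subset_left (volume_ne_top hA)

lemma glue_sub_le {A : Set ℝ} (hA : A ⊆ Ico 0 1) {s t : ℝ} (hst : s ≤ t) :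
    glue A t - glue A s ≤ t - s := by
  rw [← measureReal_inter_Ico hA hst]
  calc _ ≤ volume.real (Ico s t) := measureReal_mono inter_subset_right measure_Ico_lt_top.ne
    _ = t - s := by rw [Real.volume_real_Ico_of_le hst]

/-- Each point of `A` is the left endpoint of an interval contained in `A`. -/
def IsRightOpen (A : Set ℝ) : Prop := ∀ t ∈ A, ∃ ε > 0, Ico t (t + ε) ⊆ A

lemma glue_lt_glue {A : Set ℝ} (hA : A ⊆ Ico 0 1) (ho : IsRightOpen A) {s t : ℝ} (hs : s ∈ A)
    (hst : s < t) : glue A s < glue A t := by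
  obtain ⟨ε, hε, hsub⟩ := ho s hs
  have h := measureReal_inter_Ico hA hst.le
  have h1 : volume.real (Ico s (min t (s + ε))) ≤ volume.real (A ∩ Ico s t) := by
    refine measureReal_mono (fun r hr => ⟨hsub ⟨hr.1, hr.2.trans_le (min_le_right _ _)⟩, hr.1,
      hr.2.trans_le (min_le_left _ _)⟩) (volume_ne_top (inter_subset_left.trans hA))
  have h2 : s < min t (s + ε) := lt_min hst (by linarith)
  rw [Real.volume_real_Ico_of_le h2.le] at h1
  linarith

lemma glue_inter_Ioo {A : Set ℝ} (hA : A ⊆ Ico 0 1) {a b t : ℝ} (hat : a ≤ t) (htb : t ≤ b) :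
    glue (A ∩ Ioo a b) t = glue A t - glue A a := by
  rw [← measureReal_inter_Ico hA hat, glue]
  refine measureReal_congr ?_
  have : (Ioo a b ∩ Iio t : Set ℝ) = Ioo a t := by
    ext r; simp only [mem_inter_iff, mem_Ioo, mem_Iio]
    exact ⟨fun h => ⟨h.1.1, h.2⟩, fun h => ⟨⟨h.1, h.2.trans_le htb⟩, h.2⟩⟩
  rw [inter_assoc, this]
  exact (ae_eq_refl A).inter Ioo_ae_eq_Ico

lemma measureReal_inter_Ioo {A : Set ℝ} (hA : A ⊆ Ico 0 1) {a b : ℝ} (hab : a ≤ b) :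
    volume.real (A ∩ Ioo a b) = glue A b - glue A a := by
  rw [← measureReal_inter_Ico hA hab]
  exact measureReal_congr ((ae_eq_refl A).inter Ioo_ae_eq_Ico)

lemma measureReal_diff_Icc {A : Set ℝ} (hA : A ⊆ Ico 0 1) {a b : ℝ} (hab : a ≤ b) :
    volume.real (A \ Icc a b) = volume.real A - (glue A b - glue A a) := by
  rw [← measureReal_inter_Ico hA hab, ← measureReal_inter_add_sdiff (s := A) (t := Icc a b)
    measurableSet_Icc (volume_ne_top hA)]
  have : volume.real (A ∩ Icc a b) = volume.real (A ∩ Ico a b) :=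
    measureReal_congr ((ae_eq_refl A).inter Ico_ae_eq_Icc.symm)
  linarith

lemma glue_diff_left {A : Set ℝ} {a b t : ℝ} (hta : t ≤ a) :
    glue (A \ Icc a b) t = glue A t := by
  unfold glue
  congr 1
  ext r; simp only [mem_inter_iff, Set.mem_sdiff, mem_Icc, mem_Iio]
  exact ⟨fun h => ⟨h.1.1, h.2⟩, fun h => ⟨⟨h.1, fun h' => by linarith [h'.1, h.2]⟩, h.2⟩⟩

lemma glue_diff_right {A : Set ℝ} (hA : A ⊆ Ico 0 1) {a b t : ℝ} (hab : a ≤ b) (hbt : b < t) :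
    glue (A \ Icc a b) t = glue A t - (glue A b - glue A a) := by
  have h := measureReal_diff_Icc (inter_subset_left.trans hA : A ∩ Iio t ⊆ Ico 0 1) hab
  have e : ∀ r ≤ t, glue (A ∩ Iio t) r = glue A r := by
    intro r hr
    rw [glue, inter_assoc, Iio_inter_Iio, min_eq_right hr]; rfl
  rw [e b hbt.le, e a (hab.trans hbt.le)] at h
  have e2 : (A \ Icc a b) ∩ Iio t = (A ∩ Iio t) \ Icc a b := by
    ext r; simp only [mem_inter_iff, Set.mem_sdiff]; tauto
  rw [glue, e2, h]
  rfl

/-- After gluing, any two points of `A` with a gap of `A` between them are separated by an entry of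
`v`. The gap that may contain the angle `0` needs no entry. -/
def Separates (v : List ℝ) (A : Set ℝ) : Prop :=
  ∀ s ∈ A, ∀ t ∈ A, s < t → ¬ Icc s t ⊆ A → ∃ x ∈ v, glue A s ≤ x ∧ x < glue A t

lemma Separates.inside {v : List ℝ} {A : Set ℝ} (h : Separates v A) (hA : A ⊆ Ico 0 1) {a b : ℝ} :
    Separates (inside (glue A a) (glue A b) v) (A ∩ Ioo a b) := by
  intro s hs t ht hst hn
  obtain ⟨x, hx, h1, h2⟩ := h s hs.1 t ht.1 hst fun hsub =>
    hn fun r hr => ⟨hsub hr, hs.2.1.trans_le hr.1, hr.2.trans_lt ht.2.2⟩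
  rw [glue_inter_Ioo hA hs.2.1.le hs.2.2.le, glue_inter_Ioo hA ht.2.1.le ht.2.2.le]
  refine ⟨x - glue A a, mem_selectMap (F := fun c => c - glue A a) hx ⟨?_, ?_⟩, by linarith,
    by linarith⟩
  · exact (glue_mono hA hs.2.1.le).trans h1
  · exact h2.trans_le (glue_mono hA ht.2.2.le)

/-- Removing the arc between the feet `a` and `b` creates one gap, glued at the point `glue A a`.
That the cut is strictly before the points beyond `b` uses that `A` has mass to the right of `b`. -/
lemma Separates.outside {v : List ℝ} {A : Set ℝ} (h : Separates v A) (hA : A ⊆ Ico 0 1)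
    (ho : IsRightOpen A) {a b : ℝ} (hb : b ∈ A) (hab : a < b) :
    Separates (glue A a :: outside (glue A a) (glue A b) v) (A \ Icc a b) := by
  have hle : glue A a ≤ glue A b := glue_mono hA hab.le
  intro s hs t ht hst hn
  have hcase : ∀ r ∈ A \ Icc a b, r < a ∨ b < r := fun r hr => by
    by_contra h; push Not at h; exact hr.2 h
  rcases hcase s hs with h1 | h1
  · rcases hcase t ht with h2 | h2
    · obtain ⟨x, hx, h3, h4⟩ := h s hs.1 t ht.1 hst fun hsub =>
        hn fun r hr => ⟨hsub hr, fun h => by linarith [h.1, hr.2]⟩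
      rw [glue_diff_left h1.le, glue_diff_left h2.le]
      have hxa : x < glue A a := h4.trans_le (glue_mono hA h2.le)
      refine ⟨x, List.mem_cons_of_mem _ ?_, h3, h4⟩
      have := mem_selectMap (p := fun c => c < glue A a ∨ glue A b ≤ c)
        (F := fun c => if c < glue A a then c else c - (glue A b - glue A a)) hx (Or.inl hxa)
      rwa [if_pos hxa] at this
    · rw [glue_diff_left h1.le, glue_diff_right hA hab.le h2]
      refine ⟨glue A a, by simp, glue_mono hA h1.le, ?_⟩
      linarith [glue_lt_glue hA ho hb h2]
  · have h2 : b < t := h1.trans hst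
    obtain ⟨x, hx, h3, h4⟩ := h s hs.1 t ht.1 hst fun hsub =>
      hn fun r hr => ⟨hsub hr, fun h => by linarith [h.2, hr.1]⟩
    rw [glue_diff_right hA hab.le h1, glue_diff_right hA hab.le h2]
    have hbx : glue A b ≤ x := (glue_mono hA h1.le).trans h3
    refine ⟨x - (glue A b - glue A a), List.mem_cons_of_mem _ ?_, by linarith, by linarith⟩
    have := mem_selectMap (p := fun c => c < glue A a ∨ glue A b ≤ c)
      (F := fun c => if c < glue A a then c else c - (glue A b - glue A a)) hx (Or.inr hbx)
    rwa [if_neg (not_lt.2 (hle.trans hbx))] at this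

lemma countP_lt_lt {l : List ℝ} {x a b : ℝ} (hx : x ∈ l) (hab : a ≤ b) (ha : a ≤ x) (hb : x < b) :
    l.countP (fun y => decide (y < a)) < l.countP (fun y => decide (y < b)) := by
  induction l with
  | nil => simp at hx
  | cons y l ih =>
    have hmono : l.countP (fun y => decide (y < a)) ≤ l.countP (fun y => decide (y < b)) :=
      List.countP_mono_left fun z _ hz => by
        simp only [decide_eq_true_eq] at hz ⊢
        exact hz.trans_le hab
    rcases List.mem_cons.1 hx with rfl | hx
    · rw [List.countP_cons_of_neg (by simpa using ha), List.countP_cons_of_pos (by simpa using hb)]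
      omega
    · have := ih hx
      by_cases h : y < a
      · rw [List.countP_cons_of_pos (by simpa using h),
          List.countP_cons_of_pos (by simpa using h.trans_le hab)]
        omega
      · rw [List.countP_cons_of_neg (by simpa using h), List.countP_cons]
        omega

/-- Two points of the fragment with the same number of cuts before them are in the same end, so the
ends are at most as many as the values of this number. -/
lemma ends_le {R : Set ℂ} {v : List ℝ} (h : Separates v (angles R)) : ends R ≤ v.length + 1 := by
  have hA : angles R ⊆ Ico 0 1 := fun t ht => ht.1
  rw [ends]
  split_ifs
  · exact zero_le
  set K := R ∩ Metric.sphere (0 : ℂ) 1 with hK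
  have hmem : ∀ t ∈ angles R, (circ t : ℂ) ∈ K := fun t ht => ⟨ht.2, by
    rw [mem_sphere_zero_iff_norm, Circle.norm_coe]⟩
  have hcomp : ∀ k ∈ components K, ∃ t ∈ angles R, connectedComponentIn K (circ t) = k := by
    rintro _ ⟨z, hz, rfl⟩
    obtain ⟨y, rfl⟩ : ∃ y : Circle, (y : ℂ) = z := ⟨⟨z, hz.2⟩, rfl⟩
    refine ⟨ang y, ang_mem_angles.2 hz.1, ?_⟩
    rw [circ_ang]
  choose! f hf1 hf2 using hcomp
  let N : ℝ → ℕ := fun t => v.countP fun x => decide (x < glue (angles R) t)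
  have key : ∀ s ∈ angles R, ∀ t ∈ angles R, s < t → N s = N t →
      connectedComponentIn K (circ s) = connectedComponentIn K (circ t) := by
    intro s hs t ht hst hN
    have hIcc : Icc s t ⊆ angles R := by
      by_contra hn
      obtain ⟨x, hx, h1, h2⟩ := h s hs t ht hst hn
      have hlt : N s < N t := countP_lt_lt hx (glue_mono hA hst.le) h1 h2
      omega
    refine connectedComponentIn_eq ?_
    have hpre : IsPreconnected ((fun r => (circ r : ℂ)) '' Icc s t) :=
      isPreconnected_Icc.image _
        ((by fun_prop : Continuous fun z : Circle => (z : ℂ)).comp continuous_circ).continuousOn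
    refine hpre.subset_connectedComponentIn ⟨s, left_mem_Icc.2 hst.le, rfl⟩ ?_
      ⟨t, right_mem_Icc.2 hst.le, rfl⟩
    rintro _ ⟨r, hr, rfl⟩
    exact hmem r (hIcc hr)
  have hinj : InjOn (fun k => N (f k)) (components K) := by
    intro k hk k' hk' he
    rw [← hf2 k hk, ← hf2 k' hk']
    rcases lt_trichotomy (f k) (f k') with hlt | heq | hlt
    · exact key _ (hf1 k hk) _ (hf1 k' hk') hlt he
    · rw [heq]
    · exact (key _ (hf1 k' hk') _ (hf1 k hk) hlt he.symm).symm
  have hmaps : MapsTo (fun k => N (f k)) (components K) (Finset.range (v.length + 1) : Set ℕ) := by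
    intro k _
    simp only [Finset.coe_range, mem_Iio, N]
    exact Nat.lt_succ_of_le List.countP_le_length
  calc _ ≤ (Finset.range (v.length + 1) : Set ℕ).encard := encard_le_encard_of_injOn hmaps hinj
    _ = _ := by rw [Set.encard_coe_eq_coe_finsetCard]; simp

/-! ### Long-lived lines of descent -/

/-- The piece with angles `A` and cuts `v`, present after `n` chords, has a line of descent of
`w.length` splits in which the `i`-th fragment, starting from `A` itself, has at least `3` cuts
whenever the `i`-th flag of `w` is `true`. Here `c N` is the first chord that splits the piece. -/
def LongLived : List Bool → (ℕ → Circle × Circle) → ℕ → Set ℝ → List ℝ → Prop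
  | [], _, _, _, _ => True
  | f :: w, c, n, A, v => (f = true → 3 ≤ v.length) ∧
      ∃ N, n ≤ N ∧ Hits (c N) A ∧ (∀ k, n ≤ k → k < N → ¬ Hits (c k) A) ∧
        (LongLived w c (N + 1) (A ∩ Ioo (lo (c N)) (hi (c N)))
            (inside (glue A (lo (c N))) (glue A (hi (c N))) v) ∨
          LongLived w c (N + 1) (A \ Icc (lo (c N)) (hi (c N)))
            (glue A (lo (c N)) :: outside (glue A (lo (c N))) (glue A (hi (c N))) v))

lemma not_mem_fragment_of_foot {c : ℕ → Circle × Circle} (hc : IsGood c) {n k : ℕ} (hk : k < n)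
    {R : Set ℂ} (hR : R ∈ fragments (chords c n)) : ((c k).1 : ℂ) ∉ R := by
  obtain ⟨z, hz, rfl⟩ := hc.mem_fragments_iff.1 hR
  intro h
  have := h.2 k hk
  rw [side_fst] at this
  simp at this

lemma cell_mono {c : ℕ → Circle × Circle} {k n : ℕ} (h : k ≤ n) (z : ℂ) : cell c n z ⊆ cell c k z :=
  fun _ hw => ⟨hw.1, fun i hi => hw.2 i (hi.trans_le h)⟩

/-- A ray yields long-lived lines of descent. The hypothesis `hnew` says that `ρ 0` is first present
after `n` chords: this places the split of `ρ 0` after them. -/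
lemma longLived_of_ray {c : ℕ → Circle × Circle} (hc : IsGood c) {t : ℕ → ℝ}
    {s : ℝ → Set (Sym2 Circle)} (hs : ∀ n, s (t n) = chords c n) (w : List Bool) (n : ℕ)
    (ρ : ℕ → Set ℂ) (v : List ℝ) (hρ : ∀ k, IsOffspring t s (ρ k) (ρ (k + 1)))
    (h0 : ρ 0 ∈ fragments (chords c n)) (hnew : ∀ k < n, ρ 0 ∉ fragments (chords c k))
    (hv : Separates v (angles (ρ 0))) (hw : ∀ i, w[i]? = some true → 3 < ends (ρ i)) :
    LongLived w c n (angles (ρ 0)) v := by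
  induction w generalizing n ρ v with
  | nil => trivial
  | cons f w ih =>
    have hA : angles (ρ 0) ⊆ Ico 0 1 := fun t ht => ht.1
    have ho : IsRightOpen (angles (ρ 0)) := by
      obtain ⟨z, -, hz⟩ := hc.mem_fragments_iff.1 h0
      rw [← hz]; exact fun t ht => right_open_angles ht
    refine ⟨fun hf => ?_, ?_⟩
    · have h1 := (hw 0 (by simp [hf])).trans_le (ends_le hv)
      have h2 : ((3 : ℕ) : ℕ∞) < ((v.length + 1 : ℕ) : ℕ∞) := by exact_mod_cast h1
      have := Nat.cast_lt.1 h2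
      omega
    · obtain ⟨N, hN1, hN2, hN3, hsub⟩ := hρ 0
      rw [hs] at hN1 hN2 hN3
      have hnN : n ≤ N := by
        by_contra h
        exact hnew N (not_le.1 h) hN1
      have hhit : Hits (c N) (angles (ρ 0)) := by
        rw [hits_angles]
        by_contra h
        exact hN2 (mem_fragments_succ_of_not_mem hc hN1 h)
      have hnew' : ∀ k < N + 1, ρ 1 ∉ fragments (chords c k) := by
        intro k hk hmem
        obtain ⟨z, hz, hzρ⟩ := hc.mem_fragments_iff.1 hN1
        obtain ⟨y, hy, hyρ⟩ := hc.mem_fragments_iff.1 hmem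
        have hy1 : y ∈ ρ 1 := hyρ ▸ hy
        have hy0 : y ∈ cell c N z := hzρ ▸ hsub hy1
        have : ρ 0 ⊆ ρ 1 := by
          rw [← hzρ, ← hyρ, ← cell_eq hy0]
          exact cell_mono (Nat.lt_succ_iff.1 hk) y
        rw [Subset.antisymm hsub this] at hN3
        exact hN2 hN3
      have ih' := fun v' hv' => ih (N + 1) (fun k => ρ (k + 1)) v' (fun k => hρ (k + 1)) hN3
        hnew' hv' (fun i hi => hw (i + 1) (by simpa using hi))
      refine ⟨N, hnN, hhit, fun k hnk hkN hk => ?_, ?_⟩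
      · exact not_mem_fragment_of_foot hc hkN hN1 (hits_angles.1 hk).1
      · simp only [zero_add] at ih'
        rcases angles_of_subset hc hN1 hN3 hsub hhit with e | e
        · left
          rw [← e]
          refine ih' _ ?_
          rw [e]; exact hv.inside hA
        · right
          rw [← e]
          refine ih' _ ?_
          rw [e]; exact hv.outside hA ho hhit.hi_mem (lo_lt_hi (hc N).1)

/-! ### The law of the next chord -/

/-- The conditional law of the next chord: the law of the step without the waiting time. -/
def nextChord (α : ℝ) (S : Set (Sym2 Circle)) : Measure (Circle × Circle) :=
  (stepLaw α S).map Prod.snd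

/-- The next chord is a mixture, over the fragments, of chords with independent uniform feet. The
weights play no role. -/
lemma nextChord_eq (α : ℝ) (S : Set (Sym2 Circle)) : ∃ κ : fragments S → ℝ≥0∞,
    nextChord α S = Measure.sum fun R : fragments S =>
      κ R • ((cond unif (trace (R : Set ℂ))).prod (cond unif (trace (R : Set ℂ)))) := by
  unfold nextChord stepLaw
  rw [Measure.map_sum measurable_snd.aemeasurable]
  simp_rw [Measure.map_snd_prod]
  exact ⟨_, rfl⟩

lemma measurableSet_trace {c : ℕ → Circle × Circle} {n : ℕ} (z : ℂ) :
    MeasurableSet (trace (cell c n z)) :=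
  (by fun_prop : Continuous fun z : Circle => (z : ℂ)).measurable (measurableSet_cell c n z)

instance instIsProbabilityMeasureUnif : IsProbabilityMeasure unif := by
  have : IsProbabilityMeasure ((volume : Measure ℝ).restrict (Ico (0 : ℝ) 1)) :=
    ⟨by simp⟩
  exact Measure.isProbabilityMeasure_map continuous_circ.measurable.aemeasurable

lemma measurable_side_apply {γ : Type*} [MeasurableSpace γ] {p : γ → Circle × Circle}
    {z : γ → Circle} (hp : Measurable p) (hz : Measurable z) :
    Measurable fun s => side (p s) (z s) := by
  have hc : Measurable fun z : Circle => (z : ℂ) := (by fun_prop : Continuous _).measurable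
  have h1 := hc.comp (measurable_fst.comp hp)
  have h2 := hc.comp (measurable_snd.comp hp)
  have h3 := hc.comp hz
  exact ((Complex.measurable_im.comp h3).sub (Complex.measurable_im.comp h1)).mul
    ((Complex.measurable_re.comp h2).sub (Complex.measurable_re.comp h1)) |>.sub
    (((Complex.measurable_re.comp h3).sub (Complex.measurable_re.comp h1)).mul
    ((Complex.measurable_im.comp h2).sub (Complex.measurable_im.comp h1)))

lemma nextChord_ae_same_side (α : ℝ) {c : ℕ → Circle × Circle} {n : ℕ}
    (hc : ∀ i < n, (c i).1 ≠ (c i).2) :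
    ∀ᵐ p ∂nextChord α (chords c n), ∀ i < n, 0 < side (c i) p.1 * side (c i) p.2 := by
  obtain ⟨κ, hκ⟩ := nextChord_eq α (chords c n)
  have hm : MeasurableSet {p : Circle × Circle | ∀ i < n, 0 < side (c i) p.1 * side (c i) p.2} := by
    simp only [ofPred_forall]
    refine MeasurableSet.iInter fun i => MeasurableSet.iInter fun _ => ?_
    exact measurableSet_lt measurable_const ((measurable_side_apply measurable_const
      measurable_fst).mul (measurable_side_apply measurable_const measurable_snd))
  rw [hκ, Measure.ae_sum_iff' hm]
  rintro ⟨R, hR⟩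
  refine Measure.ae_smul_measure ?_ _
  obtain ⟨z, hz, rfl⟩ := (mem_fragments_iff hc).1 hR
  have h := ae_cond_mem (μ := unif) (measurableSet_trace (c := c) (n := n) z)
  filter_upwards [Measure.quasiMeasurePreserving_fst.ae h, Measure.quasiMeasurePreserving_snd.ae h]
    with p h1 h2 i hi
  exact mul_pos_trans (by rw [mul_comm]; exact h1.2 i hi) (h2.2 i hi)

/-- The angle of a uniform point of `R` is uniform, up to normalization. -/
lemma map_ang_cond_unif {R : Set ℂ} (hR : MeasurableSet (trace R)) :
    ∃ a : ℝ≥0∞, (cond unif (trace R)).map ang = a • volume.restrict (angles R) := by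
  refine ⟨(unif (trace R))⁻¹, ?_⟩
  have e : (circ ⁻¹' trace R) ∩ Ico 0 1 = angles R := by
    ext t; exact and_comm
  rw [ProbabilityTheory.cond, Measure.map_smul, unif]
  congr 1
  rw [show (fun t : ℝ => Circle.exp (2 * Real.pi * t)) = circ from rfl,
    Measure.restrict_map continuous_circ.measurable hR,
    Measure.restrict_restrict (continuous_circ.measurable hR), e,
    Measure.map_map measurable_ang continuous_circ.measurable]
  conv_rhs => rw [← Measure.map_id (μ := volume.restrict (angles R))]
  refine Measure.map_congr ?_
  have : MeasurableSet (angles R) := e ▸ (continuous_circ.measurable hR).inter measurableSet_Ico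
  filter_upwards [ae_restrict_mem this] with t ht
  exact ang_circ ht.1

lemma measurableSet_hits {A : Set ℝ} (hA : MeasurableSet A) : MeasurableSet {p | Hits p A} :=
  ((measurable_ang.comp measurable_fst) hA).inter ((measurable_ang.comp measurable_snd) hA)

lemma IsPiece.measurableSet {c : ℕ → Circle × Circle} (hc : IsGood c) {n : ℕ} {A : Set ℝ}
    (hA : IsPiece c n A) : MeasurableSet A := by
  obtain ⟨R, hR, rfl⟩ := hA
  obtain ⟨z, -, rfl⟩ := hc.mem_fragments_iff.1 hR
  have : angles (cell c n z) = Ico 0 1 ∩ circ ⁻¹' trace (cell c n z) := rfl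
  rw [this]
  exact measurableSet_Ico.inter (continuous_circ.measurable (measurableSet_trace z))

/-- On the event that it falls in a given fragment, the next chord has independent uniform angles in
this fragment, up to a multiplicative constant. -/
lemma nextChord_hits (α : ℝ) {c : ℕ → Circle × Circle} (hc : IsGood c) {n : ℕ} {A : Set ℝ}
    (hA : IsPiece c n A) : ∃ κ : ℝ≥0∞, ∀ G : ℝ → ℝ → ℝ≥0∞, (Measurable fun q : ℝ × ℝ => G q.1 q.2) →
      ∫⁻ p in {p | Hits p A}, G (ang p.1) (ang p.2) ∂nextChord α (chords c n)
        = κ * ∫⁻ s in A, ∫⁻ t in A, G s t := by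
  have hAm := hA.measurableSet hc
  obtain ⟨R, hR, rfl⟩ := hA
  obtain ⟨κ, hκ⟩ := nextChord_eq α (chords c n)
  obtain ⟨z, hz, rfl⟩ := hc.mem_fragments_iff.1 hR
  set R := cell c n z
  have hT : MeasurableSet (trace R) := measurableSet_trace z
  obtain ⟨a, ha⟩ := map_ang_cond_unif hT
  refine ⟨κ ⟨R, hR⟩ * (a * a), fun G hG => ?_⟩
  rw [hκ, Measure.restrict_sum _ (measurableSet_hits hAm), lintegral_sum_measure,
    tsum_eq_single (⟨R, hR⟩ : fragments (chords c n))]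
  · have hfull : ∀ᵐ p ∂(cond unif (trace R)).prod (cond unif (trace R)), Hits p (angles R) := by
      have h := ae_cond_mem (μ := unif) hT
      filter_upwards [Measure.quasiMeasurePreserving_fst.ae h,
        Measure.quasiMeasurePreserving_snd.ae h] with p h1 h2
      exact hits_angles.2 ⟨h1, h2⟩
    have hres := Measure.restrict_eq_self_of_ae_mem (s := {p | Hits p (angles R)}) hfull
    rw [Measure.restrict_smul, lintegral_smul_measure, smul_eq_mul, hres, lintegral_prod _ (by
        exact (hG.comp ((measurable_ang.comp measurable_fst).prodMk
          (measurable_ang.comp measurable_snd))).aemeasurable)]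
    have h2 : ∀ s, ∫⁻ y, G s (ang y) ∂(cond unif (trace R)) = a * ∫⁻ t in angles R, G s t := by
      intro s
      rw [← lintegral_map (f := fun t => G s t)
        (hG.comp (measurable_const.prodMk measurable_id)) measurable_ang, ha,
        lintegral_smul_measure]
      rfl
    have hm : Measurable fun s => ∫⁻ t in angles R, G s t := hG.lintegral_prod_right'
    simp only [h2]
    rw [lintegral_const_mul (f := fun x => ∫⁻ t in angles R, G (ang x) t) _
      (hm.comp measurable_ang), ← lintegral_map hm measurable_ang, ha,
      lintegral_smul_measure, smul_eq_mul]
    ring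
  · rintro ⟨R', hR'⟩ hne
    rw [Measure.restrict_smul, lintegral_smul_measure]
    obtain ⟨z', -, rfl⟩ := hc.mem_fragments_iff.1 hR'
    have hnull : ∀ᵐ p ∂(cond unif (trace (cell c n z'))).prod (cond unif (trace (cell c n z'))),
        ¬ Hits p (angles R) := by
      have h := ae_cond_mem (μ := unif) (measurableSet_trace (c := c) (n := n) z')
      filter_upwards [Measure.quasiMeasurePreserving_fst.ae h] with p h1 h2
      refine hne (Subtype.ext ?_)
      exact cell_eq_of_mem h1 (hits_angles.1 h2).1
    have h0 : ((cond unif (trace (cell c n z'))).prod (cond unif (trace (cell c n z')))).restrict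
        {p | Hits p (angles R)} = 0 := by
      rw [Measure.restrict_eq_zero]
      exact measure_eq_zero_iff_ae_notMem.2 hnull
    simp only [h0, lintegral_zero_measure, smul_zero]

/-- The gluing map transports Lebesgue measure on `A` to Lebesgue measure on an interval. -/
lemma map_glue {A : Set ℝ} (hA : A ⊆ Ico 0 1) :
    (volume.restrict A).map (glue A) = volume.restrict (Ico 0 (volume.real A)) := by
  have hgm : Measurable (glue A) := (glue_mono hA).measurable
  have hfin : IsFiniteMeasure (volume.restrict A) :=
    ⟨by rw [Measure.restrict_apply_univ]; exact (volume_ne_top hA).lt_top⟩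
  have : IsFiniteMeasure ((volume.restrict A).map (glue A)) := Measure.isFiniteMeasure_map _ _
  have htot : ENNReal.ofReal (volume.real A) = volume A := ofReal_measureReal (volume_ne_top hA)
  refine Measure.ext_of_Ici _ _ fun r => ?_
  rw [Measure.map_apply hgm measurableSet_Ici, Measure.restrict_apply (hgm measurableSet_Ici),
    Measure.restrict_apply measurableSet_Ici]
  rcases le_or_gt r 0 with h0 | h0
  · have e1 : glue A ⁻¹' Ici r ∩ A = A :=
      inter_eq_right.2 fun t _ => h0.trans (glue_nonneg A t)
    have e2 : Ici r ∩ Ico 0 (volume.real A) = Ico 0 (volume.real A) :=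
      inter_eq_right.2 fun t ht => h0.trans ht.1
    rw [e1, e2, Real.volume_Ico, sub_zero, htot]
  · rcases lt_or_ge (volume.real A) r with h1 | h1
    · have e1 : glue A ⁻¹' Ici r ∩ A = ∅ := by
        ext t; simp only [mem_inter_iff, mem_preimage, mem_Ici, mem_empty_iff_false, iff_false]
        exact fun h => by linarith [h.1, glue_le hA t]
      have e2 : Ici r ∩ Ico 0 (volume.real A) = ∅ := by
        ext t; simp only [mem_inter_iff, mem_Ici, mem_Ico, mem_empty_iff_false, iff_false]
        exact fun h => by linarith [h.1, h.2.2]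
      rw [e1, e2]
    · -- the level set of `r` starts at the point `u`, where the gluing map takes the value `r`
      have hle : ∀ s t, s ≤ t → glue A t - glue A s ≤ t - s := fun s t h => glue_sub_le hA h
      have hcont : Continuous (glue A) := by
        refine (LipschitzWith.of_dist_le_mul (K := 1) fun s t => ?_).continuous
        rw [Real.dist_eq, Real.dist_eq, NNReal.coe_one, one_mul]
        rcases le_total s t with h | h
        · rw [abs_of_nonpos (sub_nonpos.2 (glue_mono hA h)), abs_of_nonpos (sub_nonpos.2 h)]
          linarith [hle s t h]
        · rw [abs_of_nonneg (sub_nonneg.2 (glue_mono hA h)), abs_of_nonneg (sub_nonneg.2 h)]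
          linarith [hle t s h]
      have hz0 : glue A 0 = 0 := by
        have : A ∩ Iio 0 = ∅ := by
          ext t; simp only [mem_inter_iff, mem_Iio, mem_empty_iff_false, iff_false]
          exact fun h => absurd (hA h.1).1 (not_le.2 h.2)
        simp [glue, this]
      have hz1 : glue A 1 = volume.real A := by
        have : A ∩ Iio 1 = A := inter_eq_left.2 fun t ht => (hA ht).2
        simp [glue, this]
      set L := glue A ⁻¹' Ici r with hL
      have hcl : IsClosed L := isClosed_Ici.preimage hcont
      have hne : L.Nonempty := ⟨1, by rw [hL, mem_preimage, hz1]; exact h1⟩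
      have hbdd : BddBelow L := ⟨0, fun t ht => by
        by_contra hneg
        have h3 : glue A t ≤ 0 := hz0 ▸ glue_mono hA (not_le.1 hneg).le
        have h4 : r ≤ glue A t := ht
        linarith⟩
      set u := sInf L with hu
      have huL : u ∈ L := hcl.csInf_mem hne hbdd
      have hLu : L = Ici u := by
        ext t
        exact ⟨fun ht => csInf_le hbdd ht, fun ht => le_trans (show r ≤ glue A u from huL)
          (glue_mono hA ht)⟩
      have hval : glue A u = r := by
        refine le_antisymm (le_of_forall_pos_le_add fun ε hε => ?_) huL
        have h5 : u - ε ∉ L := by rw [hLu]; simp [hε]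
        have h6 : glue A (u - ε) < r := not_le.1 h5
        linarith [hle (u - ε) u (by linarith)]
      have e2 : Ici r ∩ Ico 0 (volume.real A) = Ico r (volume.real A) := by
        ext t; simp only [mem_inter_iff, mem_Ici, mem_Ico]
        exact ⟨fun h => ⟨h.1, h.2.2⟩, fun h => ⟨h.1, by linarith [h.1], h.2⟩⟩
      have e3 : volume.real (A \ Iio u) = volume.real A - r := by
        have := measureReal_inter_add_sdiff (μ := volume) (s := A) (t := Iio u)
          measurableSet_Iio (volume_ne_top hA)
        have e4 : volume.real (A ∩ Iio u) = r := hval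
        linarith
      have e5 : L ∩ A = A \ Iio u := by
        rw [hLu]; ext t; simp only [mem_inter_iff, mem_Ici, Set.mem_sdiff, mem_Iio, not_lt]
        exact and_comm
      rw [e2, e5, Real.volume_Ico, ← e3,
        ofReal_measureReal ((measure_mono sdiff_subset).trans_lt (volume_ne_top hA).lt_top).ne]

/-! ### The sequence of chords -/

/-- The sequence of the first `n` chords, continued by an arbitrary constant. -/
def trunc (n : ℕ) (c : ℕ → Circle × Circle) : ℕ → Circle × Circle :=
  fun i => if i < n then c i else (1, 1)

lemma trunc_apply {n i : ℕ} (h : i < n) (c : ℕ → Circle × Circle) : trunc n c i = c i := if_pos h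

lemma trunc_trunc {m n : ℕ} (h : m ≤ n) (c : ℕ → Circle × Circle) :
    trunc m (trunc n c) = trunc m c := by
  funext i
  by_cases hi : i < m
  · rw [trunc_apply hi, trunc_apply hi, trunc_apply (hi.trans_le h)]
  · simp [trunc, hi]

lemma measurable_trunc (n : ℕ) : Measurable (trunc n) := by
  refine measurable_pi_iff.2 fun i => ?_
  by_cases hi : i < n
  · simp only [trunc, hi, if_true]; exact measurable_pi_apply i
  · simp only [trunc, hi, if_false]; exact measurable_const

/-- The sequence of the chords. The numbering is shifted by one with respect to `X` and `Y`, whose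
values at `0` play no role. -/
def feet {Ω : Type*} (X Y : ℕ → Ω → Circle) (ω : Ω) : ℕ → Circle × Circle :=
  fun i => (X (i + 1) ω, Y (i + 1) ω)

section Trajectories

variable {Ω : Type*}

/-- The jump times up to `τ n` and the first `n` chords, continued by constants. -/
def past (τ : ℕ → Ω → ℝ) (X Y : ℕ → Ω → Circle) (n : ℕ) (ω : Ω) :
    (ℕ → ℝ) × (ℕ → Circle × Circle) :=
  (fun i => if i ≤ n then τ i ω else 0, trunc n (feet X Y ω))

lemma measurable_past_of {τ : ℕ → Ω → ℝ} {X Y : ℕ → Ω → Circle} {m : MeasurableSpace Ω} {n : ℕ}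
    (hτ : ∀ i ≤ n, Measurable (τ i))
    (hXY : ∀ i < n, Measurable fun ω => feet X Y ω i) : Measurable (past τ X Y n) := by
  refine Measurable.prodMk (measurable_pi_iff.2 fun i => ?_) (measurable_pi_iff.2 fun i => ?_)
  · by_cases hi : i ≤ n
    · simp only [hi, if_true]; exact hτ i hi
    · simp only [hi, if_false]; exact measurable_const
  · by_cases hi : i < n
    · simp only [trunc, hi, if_true]; exact hXY i hi
    · simp only [trunc, hi, if_false]; exact measurable_const

/-- The past, as a random variable, generates the sigma-algebra of the definition of the process. -/
lemma comap_past (τ : ℕ → Ω → ℝ) (X Y : ℕ → Ω → Circle) (n : ℕ) :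
    MeasurableSpace.comap (past τ X Y n) inferInstance = history τ X Y n := by
  apply le_antisymm
  · rw [← measurable_iff_comap_le]
    refine measurable_past_of (m := history τ X Y n) (fun i hi => ?_) (fun i hi => ?_)
    · exact (comap_measurable (τ i)).mono
        (le_sup_of_le_left (le_iSup₂_of_le i ⟨Nat.zero_le i, hi⟩ le_rfl)) le_rfl
    · exact (comap_measurable (fun ω => (X (i + 1) ω, Y (i + 1) ω))).mono
        (le_sup_of_le_right (le_iSup₂_of_le (i + 1) ⟨by omega, by omega⟩ le_rfl)) le_rfl
  · have hp := comap_measurable (m := inferInstance) (past τ X Y n)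
    refine sup_le (iSup₂_le fun i hi => ?_) (iSup₂_le fun i hi => ?_)
    · rw [← measurable_iff_comap_le]
      have h := (measurable_pi_apply i).comp (measurable_fst.comp hp)
      have e : (fun f : ℕ → ℝ => f i) ∘ Prod.fst ∘ past τ X Y n = τ i := by
        funext ω; simp [past, hi.2]
      rwa [e] at h
    · rw [← measurable_iff_comap_le]
      have h := (measurable_pi_apply (i - 1)).comp (measurable_snd.comp hp)
      have e : (fun f : ℕ → Circle × Circle => f (i - 1)) ∘ Prod.snd ∘ past τ X Y n
          = fun ω => (X i ω, Y i ω) := by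
        funext ω
        have h1 : i - 1 < n := by have := hi.1; have := hi.2; omega
        simp [past, trunc, h1, feet, Nat.sub_add_cancel hi.1]
      rwa [e] at h

variable [MeasurableSpace Ω] {P : Measure Ω} {α : ℝ}
  {τ : ℕ → Ω → ℝ} {X Y : ℕ → Ω → Circle} {S : ℝ → Ω → Set (Sym2 Circle)}

lemma IsFigelaProcess.measurable_feet (hS : IsFigelaProcess P α τ X Y S) :
    Measurable (feet X Y) :=
  measurable_pi_iff.2 fun _ => (hS.measurable_X _).prodMk (hS.measurable_Y _)

lemma IsFigelaProcess.ae_eq_chords (hS : IsFigelaProcess P α τ X Y S) :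
    ∀ᵐ ω ∂P, ∀ n, S (τ n ω) ω = chords (feet X Y ω) n := by
  filter_upwards [hS.start, hS.jump] with ω h0 h1 n
  induction n with
  | zero =>
    rw [h0.2]; ext p; simp [chords]
  | succ n ih =>
    rw [h1, ih]
    ext p
    simp only [chords, mem_union, mem_ofPred_eq, mem_singleton_iff]
    constructor
    · rintro (⟨i, hi, rfl⟩ | rfl)
      · exact ⟨i, hi.trans (Nat.lt_succ_self n), rfl⟩
      · exact ⟨n, Nat.lt_succ_self n, rfl⟩
    · rintro ⟨i, hi, rfl⟩
      rcases Nat.lt_succ_iff_lt_or_eq.1 hi with h | rfl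
      · exact Or.inl ⟨i, h, rfl⟩
      · exact Or.inr rfl

lemma IsFigelaProcess.ae_ne (hS : IsFigelaProcess P α τ X Y S) :
    ∀ᵐ ω ∂P, ∀ i, (feet X Y ω i).1 ≠ (feet X Y ω i).2 := by
  filter_upwards [hS.ae_eq_chords, hS.isFigela] with ω h1 h2 i
  have h3 := (h2 (i + 1)).not_diag s((feet X Y ω i).1, (feet X Y ω i).2)
    (by rw [h1]; exact ⟨i, Nat.lt_succ_self i, rfl⟩)
  simpa using h3

lemma IsFigelaProcess.measurable_past (hS : IsFigelaProcess P α τ X Y S) (n : ℕ) :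
    Measurable (past τ X Y n) :=
  measurable_past_of (fun i _ => hS.measurable_τ i)
    fun i _ => (measurable_pi_apply i).comp hS.measurable_feet

/-- The regular conditional law of the next chord given the past. The definition of the process
gives the probability of each event almost surely; a countable generating algebra makes this
simultaneous. -/
lemma IsFigelaProcess.condDistrib_ae_eq [IsProbabilityMeasure P]
    (hS : IsFigelaProcess P α τ X Y S) (n : ℕ) :
    ∀ᵐ ω ∂P, condDistrib (fun ω => feet X Y ω n) (past τ X Y n) P (past τ X Y n ω)
      = nextChord α (chords (feet X Y ω) n) := by
  set C := generateSetAlgebra (MeasurableSpace.countableGeneratingSet (Circle × Circle)) with hC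
  have hgen : (inferInstance : MeasurableSpace (Circle × Circle))
      = MeasurableSpace.generateFrom C := by
    rw [hC, generateFrom_generateSetAlgebra_eq,
      MeasurableSpace.generateFrom_countableGeneratingSet]
  have hCalg : IsSetAlgebra C := isSetAlgebra_generateSetAlgebra
  have hCc : C.Countable :=
    countable_generateSetAlgebra (MeasurableSpace.countable_countableGeneratingSet)
  have hYm : Measurable fun ω => feet X Y ω n := (measurable_pi_apply n).comp hS.measurable_feet
  have hone : ∀ B : Set (Circle × Circle), MeasurableSet B → ∀ᵐ ω ∂P,
      (condDistrib (fun ω => feet X Y ω n) (past τ X Y n) P (past τ X Y n ω)).real B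
        = (nextChord α (chords (feet X Y ω) n)).real B := by
    intro B hB
    have h1 := condDistrib_ae_eq_condExp (μ := P) (hS.measurable_past n) hYm hB
    rw [comap_past] at h1
    have h2 := hS.law n (Prod.snd ⁻¹' B) (measurable_snd hB)
    filter_upwards [h1, h2, hS.ae_eq_chords] with ω h1 h2 h3
    rw [h1]
    refine Eq.trans ?_ (h2.trans ?_)
    · rfl
    · rw [h3 n, nextChord, measureReal_def, measureReal_def, Measure.map_apply measurable_snd hB]
  have hall : ∀ᵐ ω ∂P, ∀ B ∈ C,
      (condDistrib (fun ω => feet X Y ω n) (past τ X Y n) P (past τ X Y n ω)).real B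
        = (nextChord α (chords (feet X Y ω) n)).real B := by
    rw [ae_ball_iff hCc]
    intro B hB
    refine hone B ?_
    have hB' := MeasurableSpace.measurableSet_generateFrom hB
    rwa [← hgen] at hB'
  filter_upwards [hall, hone univ MeasurableSet.univ] with ω h1 h2
  have hfin : IsFiniteMeasure (nextChord α (chords (feet X Y ω) n)) := by
    refine ⟨?_⟩
    by_contra h
    rw [not_lt, top_le_iff] at h
    rw [probReal_univ, measureReal_def, h] at h2
    simp at h2
  refine ext_of_generate_finite C hgen (fun s hs t ht _ => hCalg.inter_mem hs ht)
    (fun B hB => ?_) ?_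
  · exact (measureReal_eq_measureReal_iff).1 (h1 B hB)
  · exact (measureReal_eq_measureReal_iff).1 h2

/-- Integrating over the next chord, given the first `n` ones. -/
lemma IsFigelaProcess.lintegral_next [IsProbabilityMeasure P]
    (hS : IsFigelaProcess P α τ X Y S) (n : ℕ)
    {h : (ℕ → Circle × Circle) → Circle × Circle → ℝ≥0∞}
    (hh : Measurable fun q : (ℕ → Circle × Circle) × (Circle × Circle) => h q.1 q.2) :
    ∫⁻ ω, h (trunc n (feet X Y ω)) (feet X Y ω n) ∂P
      = ∫⁻ ω, ∫⁻ p, h (trunc n (feet X Y ω)) p ∂nextChord α (chords (feet X Y ω) n) ∂P := by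
  have hYm : Measurable fun ω => feet X Y ω n := (measurable_pi_apply n).comp hS.measurable_feet
  have hXm := hS.measurable_past n
  set κ := condDistrib (fun ω => feet X Y ω n) (past τ X Y n) P with hκ
  set H : ((ℕ → ℝ) × (ℕ → Circle × Circle)) × (Circle × Circle) → ℝ≥0∞ := fun q => h q.1.2 q.2
  have hH : Measurable H :=
    hh.comp ((measurable_snd.comp measurable_fst).prodMk measurable_snd)
  have h1 : ∫⁻ ω, h (trunc n (feet X Y ω)) (feet X Y ω n) ∂P
      = ∫⁻ q, H q ∂(P.map fun ω => (past τ X Y n ω, feet X Y ω n)) :=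
    (lintegral_map hH (hXm.prodMk hYm)).symm
  rw [h1, ← compProd_map_condDistrib hYm.aemeasurable, Measure.lintegral_compProd hH,
    lintegral_map (hH.lintegral_kernel_prod_right') hXm]
  refine lintegral_congr_ae ?_
  filter_upwards [hS.condDistrib_ae_eq n] with ω hω
  rw [hω]
  rfl

lemma IsFigelaProcess.ae_isGood [IsProbabilityMeasure P] (hS : IsFigelaProcess P α τ X Y S) :
    ∀ᵐ ω ∂P, IsGood (feet X Y ω) := by
  have key : ∀ n, ∀ᵐ ω ∂P, ∀ i < n,
      0 < side (feet X Y ω i) (feet X Y ω n).1 * side (feet X Y ω i) (feet X Y ω n).2 := by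
    intro n
    set B : Set ((ℕ → Circle × Circle) × (Circle × Circle)) :=
      {q | ¬ ∀ i < n, 0 < side (q.1 i) q.2.1 * side (q.1 i) q.2.2} with hB
    have hBm : MeasurableSet B := by
      have : B = ⋃ i, ⋃ (_ : i < n), {q | side (q.1 i) q.2.1 * side (q.1 i) q.2.2 ≤ 0} := by
        ext q; simp [hB]
      rw [this]
      refine MeasurableSet.iUnion fun i => MeasurableSet.iUnion fun _ => ?_
      exact measurableSet_le ((measurable_side_apply (by fun_prop) (by fun_prop)).mul
        (measurable_side_apply (by fun_prop) (by fun_prop))) measurable_const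
    have h1 := hS.lintegral_next n (h := fun c p => B.indicator (fun _ => 1) (c, p))
      (measurable_const.indicator hBm)
    have h2 : ∫⁻ ω, ∫⁻ p, B.indicator (fun _ => (1 : ℝ≥0∞)) (trunc n (feet X Y ω), p)
        ∂nextChord α (chords (feet X Y ω) n) ∂P = 0 := by
      have : ∀ᵐ ω ∂P, ∫⁻ p, B.indicator (fun _ => (1 : ℝ≥0∞)) (trunc n (feet X Y ω), p)
          ∂nextChord α (chords (feet X Y ω) n) = 0 := by
        filter_upwards [hS.ae_ne] with ω hω
        refine lintegral_eq_zero_of_ae_eq_zero ?_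
        filter_upwards [nextChord_ae_same_side α (c := feet X Y ω) (n := n) fun i _ => hω i]
          with p hp
        refine indicator_of_notMem ?_ _
        simp only [hB, mem_ofPred_eq, not_not]
        intro i hi
        rw [trunc_apply hi]; exact hp i hi
      rw [lintegral_congr_ae this, lintegral_zero]
    rw [h2, lintegral_eq_zero_iff (f := fun ω => B.indicator (fun _ => (1 : ℝ≥0∞))
      (trunc n (feet X Y ω), feet X Y ω n)) ((measurable_const.indicator hBm).comp
      (((measurable_trunc n).comp hS.measurable_feet).prodMk
        ((measurable_pi_apply n).comp hS.measurable_feet)))] at h1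
    filter_upwards [h1] with ω hω i hi
    have h3 : (trunc n (feet X Y ω), feet X Y ω n) ∉ B := by
      intro hmem
      simp only [indicator_of_mem hmem] at hω
      exact one_ne_zero hω
    simp only [hB, mem_ofPred_eq, not_not] at h3
    have := h3 i hi
    rwa [trunc_apply hi] at this
  filter_upwards [hS.ae_ne, ae_all_iff.2 key] with ω h1 h2 n
  exact ⟨h1 n, h2 n⟩

end Trajectories

/-! ### The first split of a fragment -/

section Family

variable {γ : Type*} [MeasurableSpace γ] {A : γ → Set ℝ}

lemma measurable_measureReal_family (hA : MeasurableSet {q : γ × ℝ | q.2 ∈ A q.1}) :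
    Measurable fun s => volume.real (A s) :=
  (measurable_measure_prodMk_left hA).ennreal_toReal

lemma measurable_glue_family (hA : MeasurableSet {q : γ × ℝ | q.2 ∈ A q.1}) {t : γ → ℝ}
    (ht : Measurable t) : Measurable fun s => glue (A s) (t s) := by
  refine measurable_measureReal_family (A := fun s => A s ∩ Iio (t s)) ?_
  exact hA.inter (measurableSet_lt measurable_snd (ht.comp measurable_fst))

lemma measurableSet_family_comp {δ : Type*} [MeasurableSpace δ]
    (hA : MeasurableSet {q : γ × ℝ | q.2 ∈ A q.1}) {f : δ → γ} {t : δ → ℝ} (hf : Measurable f)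
    (ht : Measurable t) : MeasurableSet {s | t s ∈ A (f s)} :=
  (hf.prodMk ht) hA

lemma measurableSet_hits_family {δ : Type*} [MeasurableSpace δ]
    (hA : MeasurableSet {q : γ × ℝ | q.2 ∈ A q.1}) {f : δ → γ} {p : δ → Circle × Circle}
    (hf : Measurable f) (hp : Measurable p) : MeasurableSet {s | Hits (p s) (A (f s))} :=
  (measurableSet_family_comp hA hf ((measurable_ang.comp measurable_fst).comp hp)).inter
    (measurableSet_family_comp hA hf ((measurable_ang.comp measurable_snd).comp hp))

end Family

/-- On the event that the next chord splits a given fragment, the mean of a function of the two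
pieces, read in the glued interval, is that of a uniform split. -/
lemma lintegral_children_nextChord (α : ℝ) {c : ℕ → Circle × Circle} (hc : IsGood c) {n : ℕ}
    {A : Set ℝ} (hA : IsPiece c n A) {Ψ : ℝ → List ℝ → ℝ≥0∞}
    (hΨ : Measurable fun q : ℝ × List ℝ => Ψ q.1 q.2) (v : List ℝ) :
    ∫⁻ p in {p | Hits p A}, children Ψ (volume.real A) v (glue A (lo p)) (glue A (hi p))
        ∂nextChord α (chords c n)
      = ∫⁻ _ in {p | Hits p A}, splitMean Ψ (volume.real A) v ∂nextChord α (chords c n) := by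
  have hA1 : A ⊆ Ico 0 1 := by
    obtain ⟨R, -, rfl⟩ := hA; exact fun t ht => ht.1
  have hmono := glue_mono hA1
  have hgm := hmono.measurable
  obtain ⟨κ, hκ⟩ := nextChord_hits α hc hA
  set ℓ := volume.real A
  have hchm : Measurable fun q : ℝ × ℝ => children Ψ ℓ v (min q.1 q.2) (max q.1 q.2) :=
    measurable_children hΨ measurable_const measurable_const (by fun_prop) (by fun_prop)
  have hG : ∀ p : Circle × Circle, children Ψ ℓ v (glue A (lo p)) (glue A (hi p))
      = (fun s t => children Ψ ℓ v (min (glue A s) (glue A t)) (max (glue A s) (glue A t)))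
        (ang p.1) (ang p.2) := by
    intro p
    simp only [lo, hi, hmono.map_min, hmono.map_max]
  have hpush : ∀ f : ℝ → ℝ≥0∞, Measurable f →
      ∫⁻ s in A, f (glue A s) = ∫⁻ s in Ico 0 ℓ, f s := by
    intro f hf
    rw [← map_glue hA1, lintegral_map hf hgm]
  have h1 : ∫⁻ s in A, ∫⁻ t in A, children Ψ ℓ v (min (glue A s) (glue A t))
        (max (glue A s) (glue A t))
      = ∫⁻ s in Ico 0 ℓ, ∫⁻ t in Ico 0 ℓ, children Ψ ℓ v (min s t) (max s t) := by
    have hin : ∀ s, ∫⁻ t in A, children Ψ ℓ v (min (glue A s) (glue A t))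
        (max (glue A s) (glue A t)) = ∫⁻ t in Ico 0 ℓ, children Ψ ℓ v (min (glue A s) t)
          (max (glue A s) t) := fun s =>
      hpush (fun t => children Ψ ℓ v (min (glue A s) t) (max (glue A s) t))
        (hchm.comp (measurable_const.prodMk measurable_id))
    simp only [hin]
    exact hpush (fun s => ∫⁻ t in Ico 0 ℓ, children Ψ ℓ v (min s t) (max s t))
      hchm.lintegral_prod_right'
  simp only [hG]
  rw [hκ (fun s t => children Ψ ℓ v (min (glue A s) (glue A t)) (max (glue A s) (glue A t)))
    (hchm.comp ((hgm.comp measurable_fst).prodMk (hgm.comp measurable_snd))), h1,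
    hκ (fun _ _ => splitMean Ψ ℓ v) measurable_const]
  congr 1
  have hvol : volume A = ENNReal.ofReal ℓ := (ofReal_measureReal (volume_ne_top hA1)).symm
  simp only [lintegral_const, Measure.restrict_apply_univ, hvol, splitMean]
  rcases (measureReal_nonneg : 0 ≤ ℓ).lt_or_eq with h | h
  · have h0 : ENNReal.ofReal ℓ ≠ 0 := by simpa using h
    set I := ∫⁻ s in Ico 0 ℓ, ∫⁻ t in Ico 0 ℓ, children Ψ ℓ v (min s t) (max s t)
    calc I = ((ENNReal.ofReal ℓ)⁻¹ * ENNReal.ofReal ℓ) ^ 2 * I := by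
          rw [ENNReal.inv_mul_cancel h0 ENNReal.ofReal_ne_top]; simp
      _ = _ := by ring
  · have h' : ℓ = 0 := h.symm
    simp [h']

section Trajectories

variable {Ω : Type*} [MeasurableSpace Ω] {P : Measure Ω} [IsProbabilityMeasure P] {α : ℝ}
  {τ : ℕ → Ω → ℝ} {X Y : ℕ → Ω → Circle} {S : ℝ → Ω → Set (Sym2 Circle)}

/-- The trajectories in `E` for which the fragment `A` is split first by the chord `N`. Both `E` and
`A` depend on the first `n` chords only. -/
def FirstSplit (A : (ℕ → Circle × Circle) → Set ℝ) (E : Set (ℕ → Circle × Circle)) (n N : ℕ) :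
    Set (ℕ → Circle × Circle) :=
  {c | trunc n c ∈ E ∧ (∀ k, n ≤ k → k < N → ¬ Hits (c k) (A (trunc n c))) ∧
    Hits (c N) (A (trunc n c))}

/-- The trajectories in `E` for which the fragment `A` is split by none of the chords from `n` to
`N - 1`. -/
def Unsplit (A : (ℕ → Circle × Circle) → Set ℝ) (E : Set (ℕ → Circle × Circle)) (n N : ℕ) :
    Set (ℕ → Circle × Circle) :=
  {c | trunc n c ∈ E ∧ ∀ k, n ≤ k → k < N → ¬ Hits (c k) (A (trunc n c))}

lemma measurableSet_unsplit {A : (ℕ → Circle × Circle) → Set ℝ} {E : Set (ℕ → Circle × Circle)}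
    (hA : MeasurableSet {q : (ℕ → Circle × Circle) × ℝ | q.2 ∈ A q.1}) (hE : MeasurableSet E)
    (n N : ℕ) : MeasurableSet (Unsplit A E n N) := by
  have e : Unsplit A E n N = (trunc n ⁻¹' E) ∩
      ⋂ k, ⋂ (_ : n ≤ k), ⋂ (_ : k < N), {c | Hits (c k) (A (trunc n c))}ᶜ := by
    ext c; simp [Unsplit]
  rw [e]
  refine (measurable_trunc n hE).inter ?_
  refine MeasurableSet.iInter fun k => MeasurableSet.iInter fun _ =>
    MeasurableSet.iInter fun _ => ?_
  exact (measurableSet_hits_family hA (measurable_trunc n) (measurable_pi_apply k)).compl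

lemma measurableSet_firstSplit {A : (ℕ → Circle × Circle) → Set ℝ}
    {E : Set (ℕ → Circle × Circle)}
    (hA : MeasurableSet {q : (ℕ → Circle × Circle) × ℝ | q.2 ∈ A q.1}) (hE : MeasurableSet E)
    (n N : ℕ) : MeasurableSet (FirstSplit A E n N) := by
  have h1 := measurableSet_unsplit hA hE n N
  have h2 := measurableSet_hits_family hA (measurable_trunc n) (measurable_pi_apply N)
  convert h1.inter h2 using 1
  ext c; simp only [FirstSplit, Unsplit, mem_ofPred_eq, mem_inter_iff, and_assoc]

lemma trunc_mem_unsplit {A : (ℕ → Circle × Circle) → Set ℝ} {E : Set (ℕ → Circle × Circle)}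
    {n N : ℕ} (hN : n ≤ N) {c : ℕ → Circle × Circle} :
    trunc N c ∈ Unsplit A E n N ↔ c ∈ Unsplit A E n N := by
  simp only [Unsplit, mem_ofPred_eq, trunc_trunc hN]
  refine and_congr_right fun _ => forall_congr' fun k => forall₂_congr fun _ hk => ?_
  rw [trunc_apply hk]

lemma IsPiece.of_unsplit {A : (ℕ → Circle × Circle) → Set ℝ} {E : Set (ℕ → Circle × Circle)}
    {n N : ℕ} (hN : n ≤ N) {c : ℕ → Circle × Circle} (hc : IsGood c)
    (h : IsPiece c n (A (trunc n c))) (hU : c ∈ Unsplit A E n N) : IsPiece c N (A (trunc n c)) := by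
  have hp : ∀ m, n ≤ m → m ≤ N → IsPiece c m (A (trunc n c)) := by
    intro m hm
    induction m, hm using Nat.le_induction with
    | base => exact fun _ => h
    | succ m hm ih => exact fun h => (ih (by omega)).succ hc (hU.2 m hm (by omega))
  exact hp N hN le_rfl

/-- Integrating over the chord that splits `A` first, given the chords before it. -/
lemma IsFigelaProcess.lintegral_firstSplit_eq (hS : IsFigelaProcess P α τ X Y S)
    {n N : ℕ} (hN : n ≤ N) {A : (ℕ → Circle × Circle) → Set ℝ} {E : Set (ℕ → Circle × Circle)}
    (hA : MeasurableSet {q : (ℕ → Circle × Circle) × ℝ | q.2 ∈ A q.1}) (hE : MeasurableSet E)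
    {F : (ℕ → Circle × Circle) → Circle × Circle → ℝ≥0∞}
    (hF : Measurable fun q : (ℕ → Circle × Circle) × (Circle × Circle) => F q.1 q.2) :
    ∫⁻ ω in {ω | feet X Y ω ∈ FirstSplit A E n N}, F (trunc n (feet X Y ω)) (feet X Y ω N) ∂P
      = ∫⁻ ω, (Unsplit A E n N).indicator (fun c => ∫⁻ p in {p | Hits p (A (trunc n c))},
          F (trunc n c) p ∂nextChord α (chords c N)) (feet X Y ω) ∂P := by
  set T : Set ((ℕ → Circle × Circle) × (Circle × Circle)) :=
    {q | q.1 ∈ Unsplit A E n N ∧ Hits q.2 (A (trunc n q.1))} with hT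
  have hTm : MeasurableSet T :=
    (measurable_fst (measurableSet_unsplit hA hE n N)).inter
      (measurableSet_hits_family hA ((measurable_trunc n).comp measurable_fst) measurable_snd)
  have hTiff : ∀ c p, (trunc N c, p) ∈ T ↔ c ∈ Unsplit A E n N ∧ Hits p (A (trunc n c)) := by
    intro c p
    change trunc N c ∈ Unsplit A E n N ∧ Hits p (A (trunc n (trunc N c))) ↔ _
    rw [trunc_mem_unsplit hN, trunc_trunc hN]
  have h := hS.lintegral_next N (h := fun c p => T.indicator (fun q => F (trunc n q.1) q.2) (c, p))
    ((hF.comp (((measurable_trunc n).comp measurable_fst).prodMk measurable_snd)).indicator hTm)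
  have hmS : MeasurableSet {ω | feet X Y ω ∈ FirstSplit A E n N} :=
    hS.measurable_feet (measurableSet_firstSplit hA hE n N)
  rw [← lintegral_indicator hmS]
  refine Eq.trans (lintegral_congr fun ω => ?_) (h.trans (lintegral_congr fun ω => ?_))
  · by_cases hω : feet X Y ω ∈ FirstSplit A E n N
    · have hmem : (trunc N (feet X Y ω), feet X Y ω N) ∈ T :=
        (hTiff _ _).2 ⟨⟨hω.1, hω.2.1⟩, hω.2.2⟩
      rw [indicator_of_mem (by exact hω), indicator_of_mem hmem, trunc_trunc hN]
    · have hmem : (trunc N (feet X Y ω), feet X Y ω N) ∉ T := fun h => by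
        have h' := (hTiff _ _).1 h
        exact hω ⟨h'.1.1, h'.1.2, h'.2⟩
      rw [indicator_of_notMem (by exact hω), indicator_of_notMem hmem]
  · by_cases hω : feet X Y ω ∈ Unsplit A E n N
    · have hAm : MeasurableSet {p : Circle × Circle | Hits p (A (trunc n (feet X Y ω)))} :=
        measurableSet_hits_family hA (f := fun _ : Circle × Circle => trunc n (feet X Y ω))
          measurable_const measurable_id
      rw [indicator_of_mem hω, ← lintegral_indicator hAm]
      refine lintegral_congr fun p => ?_
      by_cases hp : Hits p (A (trunc n (feet X Y ω)))
      · rw [indicator_of_mem ((hTiff _ _).2 ⟨hω, hp⟩), indicator_of_mem (by exact hp),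
          trunc_trunc hN]
      · rw [indicator_of_notMem (fun h => hp ((hTiff _ _).1 h).2),
          indicator_of_notMem (by exact hp)]
    · rw [indicator_of_notMem hω]
      refine (lintegral_congr fun p => ?_).trans lintegral_zero
      exact indicator_of_notMem (fun h => hω ((hTiff _ _).1 h).1) _

/-- When a fragment is split for the first time, the mean of a function of its two pieces is that of
a uniform split. -/
lemma IsFigelaProcess.lintegral_firstSplit (hS : IsFigelaProcess P α τ X Y S)
    {Ψ : ℝ → List ℝ → ℝ≥0∞} (hΨ : Measurable fun q : ℝ × List ℝ => Ψ q.1 q.2) {n N : ℕ} (hN : n ≤ N)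
    {A : (ℕ → Circle × Circle) → Set ℝ} {v : (ℕ → Circle × Circle) → List ℝ}
    {E : Set (ℕ → Circle × Circle)}
    (hA : MeasurableSet {q : (ℕ → Circle × Circle) × ℝ | q.2 ∈ A q.1}) (hv : Measurable v)
    (hE : MeasurableSet E)
    (hpiece : ∀ c, IsGood c → trunc n c ∈ E → IsPiece c n (A (trunc n c))) :
    ∫⁻ ω in {ω | feet X Y ω ∈ FirstSplit A E n N},
        children Ψ (volume.real (A (trunc n (feet X Y ω)))) (v (trunc n (feet X Y ω)))
          (glue (A (trunc n (feet X Y ω))) (lo (feet X Y ω N)))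
          (glue (A (trunc n (feet X Y ω))) (hi (feet X Y ω N))) ∂P
      = ∫⁻ ω in {ω | feet X Y ω ∈ FirstSplit A E n N},
        splitMean Ψ (volume.real (A (trunc n (feet X Y ω)))) (v (trunc n (feet X Y ω))) ∂P := by
  have hAfst : MeasurableSet
      {r : ((ℕ → Circle × Circle) × (Circle × Circle)) × ℝ | r.2 ∈ A r.1.1} :=
    measurableSet_family_comp hA (δ := ((ℕ → Circle × Circle) × (Circle × Circle)) × ℝ)
      (f := fun r => r.1.1) (t := fun r => r.2)
      (measurable_fst.comp measurable_fst) measurable_snd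
  have hℓm : Measurable fun q : (ℕ → Circle × Circle) × (Circle × Circle) => volume.real (A q.1) :=
    (measurable_measureReal_family hA).comp measurable_fst
  have hvm : Measurable fun q : (ℕ → Circle × Circle) × (Circle × Circle) => v q.1 :=
    hv.comp measurable_fst
  have h1 : Measurable fun q : (ℕ → Circle × Circle) × (Circle × Circle) =>
      children Ψ (volume.real (A q.1)) (v q.1) (glue (A q.1) (lo q.2)) (glue (A q.1) (hi q.2)) :=
    measurable_children hΨ hℓm hvm
      (measurable_glue_family (A := fun q : (ℕ → Circle × Circle) × (Circle × Circle) => A q.1)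
        hAfst (measurable_lo.comp measurable_snd))
      (measurable_glue_family (A := fun q : (ℕ → Circle × Circle) × (Circle × Circle) => A q.1)
        hAfst (measurable_hi.comp measurable_snd))
  have h2 : Measurable fun q : (ℕ → Circle × Circle) × (Circle × Circle) =>
      splitMean Ψ (volume.real (A q.1)) (v q.1) :=
    Measurable.comp (g := fun r : ℝ × List ℝ => splitMean Ψ r.1 r.2)
      (f := fun q : (ℕ → Circle × Circle) × (Circle × Circle) => (volume.real (A q.1), v q.1))
      (measurable_splitMean hΨ) (hℓm.prodMk hvm)
  have e1 := hS.lintegral_firstSplit_eq hN hA hE (F := fun c p => children Ψ (volume.real (A c))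
    (v c) (glue (A c) (lo p)) (glue (A c) (hi p))) h1
  have e2 := hS.lintegral_firstSplit_eq hN hA hE
    (F := fun c _ => splitMean Ψ (volume.real (A c)) (v c)) h2
  rw [e1, e2]
  refine lintegral_congr_ae ?_
  filter_upwards [hS.ae_isGood] with ω hω
  by_cases hmem : feet X Y ω ∈ Unsplit A E n N
  · rw [indicator_of_mem hmem, indicator_of_mem hmem]
    exact lintegral_children_nextChord α hω
      (IsPiece.of_unsplit hN hω (hpiece _ hω hmem.1) hmem) hΨ _
  · rw [indicator_of_notMem hmem, indicator_of_notMem hmem]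

end Trajectories

/-! ### The probability of a long-lived line of descent -/

lemma trunc_mem_firstSplit {A : (ℕ → Circle × Circle) → Set ℝ} {E : Set (ℕ → Circle × Circle)}
    {n N : ℕ} (hN : n ≤ N) {c : ℕ → Circle × Circle} :
    trunc (N + 1) c ∈ FirstSplit A E n N ↔ c ∈ FirstSplit A E n N := by
  simp only [FirstSplit, mem_ofPred_eq, trunc_trunc (hN.trans N.le_succ),
    trunc_apply (Nat.lt_succ_self N)]
  refine and_congr_right fun _ => and_congr_left fun _ =>
    forall_congr' fun k => forall₂_congr fun _ hk => ?_
  rw [trunc_apply (hk.trans N.lt_succ_self)]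

lemma disjoint_firstSplit {A : (ℕ → Circle × Circle) → Set ℝ} {E : Set (ℕ → Circle × Circle)}
    {n N N' : ℕ} (hN : n ≤ N) (h : N < N') : Disjoint (FirstSplit A E n N) (FirstSplit A E n N') :=
  Set.disjoint_left.2 fun _ h1 h2 => h2.2.1 N hN h h1.2.2

section Trajectories

variable {Ω : Type*} [MeasurableSpace Ω] {P : Measure Ω} {α : ℝ}
  {τ : ℕ → Ω → ℝ} {X Y : ℕ → Ω → Circle} {S : ℝ → Ω → Set (Sym2 Circle)}

/-- For every fragment `A`, with cuts `v`, that is a measurable function of the first `n` chords,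
given on an event `E` of these chords, the probability of a long-lived line of descent from `A` with
flags `w` is at most the mean of `survival w`. -/
def SurvivalBound (P : Measure Ω) (X Y : ℕ → Ω → Circle) (w : List Bool) : Prop :=
  ∀ (n : ℕ) (A : (ℕ → Circle × Circle) → Set ℝ) (v : (ℕ → Circle × Circle) → List ℝ)
    (E : Set (ℕ → Circle × Circle)), MeasurableSet {q : (ℕ → Circle × Circle) × ℝ | q.2 ∈ A q.1} →
    Measurable v → MeasurableSet E → (∀ c, A c ⊆ Ico 0 1) →
    (∀ c, IsGood c → trunc n c ∈ E → IsPiece c n (A (trunc n c))) →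
    P {ω | trunc n (feet X Y ω) ∈ E ∧
        LongLived w (feet X Y ω) n (A (trunc n (feet X Y ω))) (v (trunc n (feet X Y ω)))}
      ≤ ∫⁻ ω in {ω | trunc n (feet X Y ω) ∈ E},
        survival w (volume.real (A (trunc n (feet X Y ω)))) (v (trunc n (feet X Y ω))) ∂P

/-- The bound for the piece between the feet of the chord that splits `A` first. -/
lemma SurvivalBound.inner {w : List Bool} (hw : SurvivalBound P X Y w) {n N : ℕ} (hN : n ≤ N)
    {A : (ℕ → Circle × Circle) → Set ℝ} {v : (ℕ → Circle × Circle) → List ℝ}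
    {E : Set (ℕ → Circle × Circle)}
    (hA : MeasurableSet {q : (ℕ → Circle × Circle) × ℝ | q.2 ∈ A q.1}) (hv : Measurable v)
    (hE : MeasurableSet E) (hA1 : ∀ c, A c ⊆ Ico 0 1)
    (hpiece : ∀ c, IsGood c → c ∈ FirstSplit A E n N → IsPiece c N (A (trunc n c))) :
    P {ω | feet X Y ω ∈ FirstSplit A E n N ∧ LongLived w (feet X Y ω) (N + 1)
        (A (trunc n (feet X Y ω)) ∩ Ioo (lo (feet X Y ω N)) (hi (feet X Y ω N)))
        (inside (glue (A (trunc n (feet X Y ω))) (lo (feet X Y ω N)))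
          (glue (A (trunc n (feet X Y ω))) (hi (feet X Y ω N))) (v (trunc n (feet X Y ω))))}
      ≤ ∫⁻ ω in {ω | feet X Y ω ∈ FirstSplit A E n N},
        survival w (glue (A (trunc n (feet X Y ω))) (hi (feet X Y ω N))
            - glue (A (trunc n (feet X Y ω))) (lo (feet X Y ω N)))
          (inside (glue (A (trunc n (feet X Y ω))) (lo (feet X Y ω N)))
            (glue (A (trunc n (feet X Y ω))) (hi (feet X Y ω N)))
            (v (trunc n (feet X Y ω)))) ∂P := by
  have hAn : MeasurableSet {q : (ℕ → Circle × Circle) × ℝ | q.2 ∈ A (trunc n q.1)} :=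
    measurableSet_family_comp hA ((measurable_trunc n).comp measurable_fst) measurable_snd
  have hlo : Measurable fun c : ℕ → Circle × Circle => lo (c N) :=
    measurable_lo.comp (measurable_pi_apply N)
  have hhi : Measurable fun c : ℕ → Circle × Circle => hi (c N) :=
    measurable_hi.comp (measurable_pi_apply N)
  have hglo := measurable_glue_family (A := fun c => A (trunc n c)) hAn hlo
  have hghi := measurable_glue_family (A := fun c => A (trunc n c)) hAn hhi
  have h := hw (N + 1) (fun c => A (trunc n c) ∩ Ioo (lo (c N)) (hi (c N)))
    (fun c => inside (glue (A (trunc n c)) (lo (c N))) (glue (A (trunc n c)) (hi (c N)))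
      (v (trunc n c))) (FirstSplit A E n N)
    (hAn.inter ((measurableSet_lt (hlo.comp measurable_fst) measurable_snd).inter
      (measurableSet_lt measurable_snd (hhi.comp measurable_fst))))
    (measurable_inside hglo hghi
      (hv.comp (measurable_trunc n)))
    (measurableSet_firstSplit hA hE n N) (fun c => inter_subset_left.trans (hA1 _)) ?_
  · simpa only [trunc_mem_firstSplit hN, trunc_trunc (hN.trans N.le_succ),
      trunc_apply (Nat.lt_succ_self N), measureReal_inter_Ioo (hA1 _) (lo_le_hi _)] using h
  · intro c hc hm
    rw [trunc_mem_firstSplit hN] at hm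
    simp only [trunc_trunc (hN.trans N.le_succ), trunc_apply (Nat.lt_succ_self N)]
    exact (isPiece_split hc (hpiece c hc hm) hm.2.2).1

/-- The bound for the piece outside the feet of the chord that splits `A` first. -/
lemma SurvivalBound.outer {w : List Bool} (hw : SurvivalBound P X Y w) {n N : ℕ} (hN : n ≤ N)
    {A : (ℕ → Circle × Circle) → Set ℝ} {v : (ℕ → Circle × Circle) → List ℝ}
    {E : Set (ℕ → Circle × Circle)}
    (hA : MeasurableSet {q : (ℕ → Circle × Circle) × ℝ | q.2 ∈ A q.1}) (hv : Measurable v)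
    (hE : MeasurableSet E) (hA1 : ∀ c, A c ⊆ Ico 0 1)
    (hpiece : ∀ c, IsGood c → c ∈ FirstSplit A E n N → IsPiece c N (A (trunc n c))) :
    P {ω | feet X Y ω ∈ FirstSplit A E n N ∧ LongLived w (feet X Y ω) (N + 1)
        (A (trunc n (feet X Y ω)) \ Icc (lo (feet X Y ω N)) (hi (feet X Y ω N)))
        (glue (A (trunc n (feet X Y ω))) (lo (feet X Y ω N)) ::
          outside (glue (A (trunc n (feet X Y ω))) (lo (feet X Y ω N)))
          (glue (A (trunc n (feet X Y ω))) (hi (feet X Y ω N))) (v (trunc n (feet X Y ω))))}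
      ≤ ∫⁻ ω in {ω | feet X Y ω ∈ FirstSplit A E n N},
        survival w (volume.real (A (trunc n (feet X Y ω))) -
            (glue (A (trunc n (feet X Y ω))) (hi (feet X Y ω N))
              - glue (A (trunc n (feet X Y ω))) (lo (feet X Y ω N))))
          (glue (A (trunc n (feet X Y ω))) (lo (feet X Y ω N)) ::
            outside (glue (A (trunc n (feet X Y ω))) (lo (feet X Y ω N)))
            (glue (A (trunc n (feet X Y ω))) (hi (feet X Y ω N)))
            (v (trunc n (feet X Y ω)))) ∂P := by
  have hAn : MeasurableSet {q : (ℕ → Circle × Circle) × ℝ | q.2 ∈ A (trunc n q.1)} :=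
    measurableSet_family_comp hA ((measurable_trunc n).comp measurable_fst) measurable_snd
  have hlo : Measurable fun c : ℕ → Circle × Circle => lo (c N) :=
    measurable_lo.comp (measurable_pi_apply N)
  have hhi : Measurable fun c : ℕ → Circle × Circle => hi (c N) :=
    measurable_hi.comp (measurable_pi_apply N)
  have hglo := measurable_glue_family (A := fun c => A (trunc n c)) hAn hlo
  have hghi := measurable_glue_family (A := fun c => A (trunc n c)) hAn hhi
  have h := hw (N + 1) (fun c => A (trunc n c) \ Icc (lo (c N)) (hi (c N)))
    (fun c => glue (A (trunc n c)) (lo (c N)) ::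
      outside (glue (A (trunc n c)) (lo (c N))) (glue (A (trunc n c)) (hi (c N)))
      (v (trunc n c))) (FirstSplit A E n N)
    (hAn.diff ((measurableSet_le (hlo.comp measurable_fst) measurable_snd).inter
      (measurableSet_le measurable_snd (hhi.comp measurable_fst))))
    (measurable_list_cons hglo
      (measurable_outside hglo hghi
        (hv.comp (measurable_trunc n))))
    (measurableSet_firstSplit hA hE n N) (fun c => sdiff_subset.trans (hA1 _)) ?_
  · simpa only [trunc_mem_firstSplit hN, trunc_trunc (hN.trans N.le_succ),
      trunc_apply (Nat.lt_succ_self N), measureReal_diff_Icc (hA1 _) (lo_le_hi _)] using h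
  · intro c hc hm
    rw [trunc_mem_firstSplit hN] at hm
    simp only [trunc_trunc (hN.trans N.le_succ), trunc_apply (Nat.lt_succ_self N)]
    exact (isPiece_split hc (hpiece c hc hm) hm.2.2).2

/-- The union bound over the two offspring, summed over the number of the chord that splits the
fragment first. -/
lemma SurvivalBound.measure_split_le [IsProbabilityMeasure P]
    (hS : IsFigelaProcess P α τ X Y S) {w : List Bool} (hw : SurvivalBound P X Y w) {n : ℕ}
    {A : (ℕ → Circle × Circle) → Set ℝ} {v : (ℕ → Circle × Circle) → List ℝ}
    {E : Set (ℕ → Circle × Circle)}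
    (hA : MeasurableSet {q : (ℕ → Circle × Circle) × ℝ | q.2 ∈ A q.1}) (hv : Measurable v)
    (hE : MeasurableSet E) (hA1 : ∀ c, A c ⊆ Ico 0 1)
    (hpiece : ∀ c, IsGood c → trunc n c ∈ E → IsPiece c n (A (trunc n c))) (f : Bool) :
    P {ω | trunc n (feet X Y ω) ∈ E ∧
        LongLived (f :: w) (feet X Y ω) n (A (trunc n (feet X Y ω))) (v (trunc n (feet X Y ω)))}
      ≤ ∫⁻ ω in {ω | trunc n (feet X Y ω) ∈ E}, splitMean (survival w)
        (volume.real (A (trunc n (feet X Y ω)))) (v (trunc n (feet X Y ω))) ∂P := by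
  have hFm : ∀ N, MeasurableSet {ω | feet X Y ω ∈ FirstSplit A E n N} := fun N =>
    hS.measurable_feet (measurableSet_firstSplit hA hE n N)
  have hAn : MeasurableSet {q : (ℕ → Circle × Circle) × ℝ | q.2 ∈ A (trunc n q.1)} :=
    measurableSet_family_comp hA ((measurable_trunc n).comp measurable_fst) measurable_snd
  have hstep : ∀ m c, IsGood c → c ∈ FirstSplit A E n (n + m) → IsPiece c (n + m) (A (trunc n c)) :=
    fun m c hc hm => IsPiece.of_unsplit (Nat.le_add_right n m) hc (hpiece c hc hm.1)
      ⟨hm.1, hm.2.1⟩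
  have hle : ∀ m, _ := fun m => add_le_add
    (hw.inner (Nat.le_add_right n m) hA hv hE hA1 (hstep m))
    (hw.outer (Nat.le_add_right n m) hA hv hE hA1 (hstep m))
  have hsum : ∀ m, _ := fun m => hS.lintegral_firstSplit (measurable_survival w)
    (Nat.le_add_right n m) hA hv hE hpiece
  calc _ ≤ P (⋃ m, ({ω | feet X Y ω ∈ FirstSplit A E n (n + m) ∧
            LongLived w (feet X Y ω) (n + m + 1)
              (A (trunc n (feet X Y ω)) ∩ Ioo (lo (feet X Y ω (n + m))) (hi (feet X Y ω (n + m))))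
              (inside (glue (A (trunc n (feet X Y ω))) (lo (feet X Y ω (n + m))))
                (glue (A (trunc n (feet X Y ω))) (hi (feet X Y ω (n + m))))
                (v (trunc n (feet X Y ω))))} ∪
          {ω | feet X Y ω ∈ FirstSplit A E n (n + m) ∧
            LongLived w (feet X Y ω) (n + m + 1)
              (A (trunc n (feet X Y ω)) \ Icc (lo (feet X Y ω (n + m))) (hi (feet X Y ω (n + m))))
              (glue (A (trunc n (feet X Y ω))) (lo (feet X Y ω (n + m))) ::
                outside (glue (A (trunc n (feet X Y ω))) (lo (feet X Y ω (n + m))))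
                (glue (A (trunc n (feet X Y ω))) (hi (feet X Y ω (n + m))))
                (v (trunc n (feet X Y ω))))})) := by
        refine measure_mono ?_
        rintro ω ⟨h1, -, N, hN, hhit, hno, hor⟩
        obtain ⟨m, rfl⟩ := Nat.exists_eq_add_of_le hN
        have hF : feet X Y ω ∈ FirstSplit A E n (n + m) := ⟨h1, hno, hhit⟩
        exact mem_iUnion.2 ⟨m, hor.imp (fun h => ⟨hF, h⟩) fun h => ⟨hF, h⟩⟩
    _ ≤ ∑' m, ∫⁻ ω in {ω | feet X Y ω ∈ FirstSplit A E n (n + m)}, splitMean (survival w)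
        (volume.real (A (trunc n (feet X Y ω)))) (v (trunc n (feet X Y ω))) ∂P := by
      refine (measure_iUnion_le _).trans (ENNReal.tsum_le_tsum fun m => ?_)
      refine (measure_union_le _ _).trans ((hle m).trans ?_)
      rw [← hsum m, ← lintegral_add_left]
      · rfl
      · have hlo : Measurable fun c : ℕ → Circle × Circle => lo (c (n + m)) :=
          measurable_lo.comp (measurable_pi_apply _)
        have hhi : Measurable fun c : ℕ → Circle × Circle => hi (c (n + m)) :=
          measurable_hi.comp (measurable_pi_apply _)
        have h1 := measurable_glue_family (A := fun c => A (trunc n c)) hAn hlo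
        have h2 := measurable_glue_family (A := fun c => A (trunc n c)) hAn hhi
        have h3 : Measurable fun c : ℕ → Circle × Circle =>
            (glue (A (trunc n c)) (hi (c (n + m))) - glue (A (trunc n c)) (lo (c (n + m))),
            inside (glue (A (trunc n c)) (lo (c (n + m)))) (glue (A (trunc n c)) (hi (c (n + m))))
              (v (trunc n c))) :=
          (h2.sub h1).prodMk (measurable_inside h1 h2 (hv.comp (measurable_trunc n)))
        exact Measurable.comp (g := fun r : ℝ × List ℝ => survival w r.1 r.2)
          (measurable_survival w) (h3.comp hS.measurable_feet)
    _ = ∫⁻ ω in ⋃ m, {ω | feet X Y ω ∈ FirstSplit A E n (n + m)}, splitMean (survival w)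
        (volume.real (A (trunc n (feet X Y ω)))) (v (trunc n (feet X Y ω))) ∂P := by
      refine (lintegral_iUnion (fun m => hFm _) ?_ _).symm
      refine (pairwise_disjoint_on _).2 fun i j hij => ?_
      exact (disjoint_firstSplit (Nat.le_add_right n i) (by omega)).preimage (feet X Y)
    _ ≤ _ := lintegral_mono_set (iUnion_subset fun m ω hω => hω.1)

lemma survivalBound [IsProbabilityMeasure P] (hS : IsFigelaProcess P α τ X Y S)
    (w : List Bool) : SurvivalBound P X Y w := by
  induction w with
  | nil =>
    intro n A v E _ _ _ _ _
    simp [LongLived, survival]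
  | cons f w ih =>
    intro n A v E hA hv hE hA1 hpiece
    have hr : Measurable fun c => splitMean (survival w) (volume.real (A c)) (v c) :=
      Measurable.comp (g := fun r : ℝ × List ℝ => splitMean (survival w) r.1 r.2)
        (f := fun c => (volume.real (A c), v c)) (measurable_splitMean (measurable_survival w))
        ((measurable_measureReal_family hA).prodMk hv)
    set L : Set (ℕ → Circle × Circle) := {c | f = true ∧ (v c).length < 3} with hL
    have hLm : MeasurableSet L :=
      (MeasurableSet.const (f = true)).inter
        ((measurable_length.comp hv) (measurableSet_Iio (a := 3)))
    set B : Set (ℕ → Circle × Circle) :=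
      {c | splitMean (survival w) (volume.real (A c)) (v c) ≤ 1} with hB
    have hBm : MeasurableSet B := measurableSet_le hr measurable_const
    have hmE : ∀ F : Set (ℕ → Circle × Circle), MeasurableSet F →
        MeasurableSet {ω | trunc n (feet X Y ω) ∈ F} := fun F hF =>
      hS.measurable_feet (measurable_trunc n hF)
    -- the union bound is used where it is at most `1`, and the trivial bound elsewhere
    set E₁ := E ∩ Lᶜ ∩ B with hE₁
    set E₂ := (E ∩ Lᶜ) \ B with hE₂
    have hE₁m : MeasurableSet E₁ := (hE.inter hLm.compl).inter hBm
    have hE₂m : MeasurableSet E₂ := (hE.inter hLm.compl).diff hBm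
    calc _ ≤ P ({ω | trunc n (feet X Y ω) ∈ E₁ ∧ LongLived (f :: w) (feet X Y ω) n
            (A (trunc n (feet X Y ω))) (v (trunc n (feet X Y ω)))} ∪
            {ω | trunc n (feet X Y ω) ∈ E₂}) := by
          refine measure_mono ?_
          rintro ω ⟨h1, h2⟩
          have h3 : trunc n (feet X Y ω) ∉ L := fun h => absurd (h2.1 h.1) (by have := h.2; omega)
          by_cases hb : trunc n (feet X Y ω) ∈ B
          · exact Or.inl ⟨⟨⟨h1, h3⟩, hb⟩, h2⟩
          · exact Or.inr ⟨⟨h1, h3⟩, hb⟩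
      _ ≤ _ := measure_union_le _ _
      _ ≤ ∫⁻ ω in {ω | trunc n (feet X Y ω) ∈ E₁}, survival (f :: w)
            (volume.real (A (trunc n (feet X Y ω)))) (v (trunc n (feet X Y ω))) ∂P +
          ∫⁻ ω in {ω | trunc n (feet X Y ω) ∈ E₂}, survival (f :: w)
            (volume.real (A (trunc n (feet X Y ω)))) (v (trunc n (feet X Y ω))) ∂P := by
          refine add_le_add ?_ ?_
          · refine (ih.measure_split_le hS hA hv hE₁m hA1
              (fun c hc h => hpiece c hc h.1.1) f).trans ?_
            refine setLIntegral_mono' (hmE _ hE₁m) fun ω hω => ?_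
            have hflag : ¬ (f = true ∧ (v (trunc n (feet X Y ω))).length < 3) := hω.1.2
            rw [survival, if_neg hflag]
            exact le_min hω.2 le_rfl
          · rw [← setLIntegral_one]
            refine setLIntegral_mono' (hmE _ hE₂m) fun ω hω => ?_
            have hflag : ¬ (f = true ∧ (v (trunc n (feet X Y ω))).length < 3) := hω.1.2
            rw [survival, if_neg hflag]
            exact le_min le_rfl (not_le.1 hω.2).le
      _ = ∫⁻ ω in {ω | trunc n (feet X Y ω) ∈ E₁} ∪ {ω | trunc n (feet X Y ω) ∈ E₂},
            survival (f :: w)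
            (volume.real (A (trunc n (feet X Y ω)))) (v (trunc n (feet X Y ω))) ∂P :=
          (lintegral_union (hmE _ hE₂m)
            (Set.disjoint_left.2 fun ω h1 h2 => h2.2 h1.2)).symm
      _ ≤ _ := lintegral_mono_set (union_subset (fun ω h => h.1.1) fun ω h => h.1.1)

lemma measure_longLived_le [IsProbabilityMeasure P] (hS : IsFigelaProcess P α τ X Y S)
    (w : List Bool) :
    P {ω | LongLived w (feet X Y ω) 0 (Ico 0 1) []} ≤ typeBound w 0 := by
  have h := survivalBound hS w 0 (fun _ => Ico 0 1) (fun _ => []) univ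
    (measurable_snd measurableSet_Ico) measurable_const MeasurableSet.univ (fun _ => Subset.rfl)
    fun c _ _ => isPiece_zero c
  have h2 := cutIntegral_survival_le w 0 1
  simp only [cutIntegral, pow_zero, one_mul] at h2
  simpa using h.trans (by simpa using h2)

/-- Almost surely, for each `k` there is an `m` such that no line of descent has at least three cuts
in all the generations `k, …, k + m - 1`. -/
lemma ae_forall_exists_not_longLived [IsProbabilityMeasure P] (hS : IsFigelaProcess P α τ X Y S) :
    ∀ᵐ ω ∂P, ∀ k, ∃ m, ¬ LongLived (List.replicate k false ++ List.replicate m true)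
      (feet X Y ω) 0 (Ico 0 1) [] := by
  refine ae_all_iff.2 fun k => ?_
  rw [ae_iff]
  refine le_antisymm (ge_of_tendsto' (tendsto_typeBound k 0) fun m => ?_) zero_le
  refine (measure_mono ?_).trans (measure_longLived_le hS _)
  intro ω hω
  simp only [not_exists, not_not, mem_ofPred_eq] at hω
  exact hω m

end Trajectories

end Figela

end

theorem lemma5 {Ω : Type*} [MeasurableSpace Ω] (P : MeasureTheory.Measure Ω)
    [MeasureTheory.IsProbabilityMeasure P] (α : ℝ) (hα : 0 ≤ α)
    (τ : ℕ → Ω → ℝ) (X Y : ℕ → Ω → Circle) (S : ℝ → Ω → Set (Sym2 Circle))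
    (hS : Figela.IsFigelaProcess P α τ X Y S) :
    ∀ᵐ ω ∂P, ¬ ∃ ρ : ℕ → Set ℂ,
      Figela.IsRay (fun n => τ n ω) (fun t => S t ω) ρ ∧
        ∀ᶠ k in Filter.atTop, 3 < Figela.ends (ρ k) := by
  open Figela in
  filter_upwards [ae_forall_exists_not_longLived hS, hS.ae_isGood, hS.ae_eq_chords]
    with ω hω hc hs
  rintro ⟨ρ, ⟨h0, hρ⟩, hev⟩
  obtain ⟨k, hk⟩ := eventually_atTop.1 hev
  obtain ⟨m, hm⟩ := hω k
  have hang : angles (ρ 0) = Ico 0 1 := by rw [h0, angles_disk]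
  refine hm (hang ▸ longLived_of_ray hc hs _ 0 ρ [] hρ ?_ (by simp) ?_ fun i hi => hk i ?_)
  · rw [h0]; exact disk_mem_fragments _
  · -- the whole circle has no gap once it is cut open
    rw [hang]
    exact fun s hs t ht _ h => absurd (fun u hu => ⟨hs.1.trans hu.1, hu.2.trans_lt ht.2⟩) h
  · by_contra hlt
    rw [List.getElem?_append_left (by simpa using hlt)] at hi
    simp [List.getElem?_replicate] at hi
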